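/- Let $(X,d)$ be a separable metric space, $\mu$ a finite Borel measure on $X$, and suppose that $X=\mathbb{R}^n$ with the Euclidean metric for some $n$, or that $\mu$ is doubling, i.e. there is a constant $C$ with $\mu(B(x,2r))\le C\mu(B(x,r))$ for all $x\in\operatorname{spt}\mu$ and $r>0$. Here $B(x,r)$ denotes the open ball. Let $K:\{(x,y)\in X\times X: x\ne y\}\to\mathbb{R}$ be Borel measurable, antisymmetric ($K(x,y)=-K(y,x)$), and bounded on $\{(x,y): d(x,y)>\delta\}$ for every $\delta>0$. For $\epsilon>0$ put $$T_\epsilon f(x)=\int_{X\setminus B(x,\epsilon)}K(x,y)f(y)\,d\mu(y),\qquad T^*f(x)=\sup_{\epsilon>0}|T_\epsilon f(x)|.$$ Let $h:(0,\infty)\to(0,\infty)$ be a non-decreasing function with $\lim_{r\to0}h(r)=0$ and, for some constant $C$, $h(2r)\le Ch(r)$ for all $r>0$. Suppose that $$|K(x,y)|\le\frac1{h(d(x,y))}\quad(x\ne y),\qquad |K(x,y)-K(x,z)|\le\frac{d(y,z)}{d(x,y)\,h(d(x,y))}\quad (x\neq y,\ z\ne x,\ d(x,y)>2d(y,z)),$$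 that $\mu(B(x,r))\le h(r)$ for all $x\in X$ and $r>0$, and that $\lim_{r\to0}\mu(B(x,r))/h(r)=0$ for $\mu$-almost all $x\in X$. Suppose finally that $T^*$ is bounded in $L^2(\mu)$: there is a constant $C_0$ with $\int (T^*f)^2\,d\mu\le C_0\int f^2\,d\mu$ for all $f\in L^2(\mu)$. Then there is a unique bounded linear operator $T:L^2(\mu)\to L^2(\mu)$ with $\lim_{\epsilon\to0}\int T_\epsilon(f)g\,d\mu=\int T(f)g\,d\mu$ for all $f,g\in L^2(\mu)$. It has a unique extension to a linear operator, again denoted by $T$, from $L^1(\mu)$ to the space of $\mu$-a.e. equivalence classes of real measurable functions on $X$ that satisfies, for some constant $C$, the weak type inequality $\mu(\{x:|Tf(x)|>t\})\le C\|f\|_1/t$ for all $f\in L^1(\mu)$ and $t>0$. For every $f\in L^1(\mu)$, $$\lim_{\epsilon\to0}T_\epsilon f(x)=Tf(x)\qquad\text{for }\mu\text{-almost all }x\in X.$$ -/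

import Mathlib

open MeasureTheory Filter Topology Set
open scoped ENNReal NNReal

namespace SingularIntegral

/-- The metric space `X` is a Euclidean space `ℝⁿ`, up to an isometry. -/
def IsEuclidean (X : Type*) [MetricSpace X] : Prop :=
  ∃ n : ℕ, Nonempty (X ≃ᵢ EuclideanSpace ℝ (Fin n))

/-- `μ` is doubling: `μ(B(x, 2r)) ≤ C μ(B(x, r))` for all `x` in the support of `μ` and all
`r > 0`. (For `μ ≠ 0`, if the inequality holds at all `x : X`, then the support is all of `X`, so
this contains the notion in which `x` ranges over `X`.) -/
def IsDoubling {X : Type*} [MetricSpace X] [MeasurableSpace X] (μ : Measure X) : Prop :=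
  ∃ C : ℝ≥0, ∀ x ∈ μ.support, ∀ r : ℝ, 0 < r →
    μ (Metric.ball x (2 * r)) ≤ C * μ (Metric.ball x r)

/-- Borel measurable antisymmetric kernels off the diagonal, bounded away from the diagonal.
The values `K x x` are irrelevant. -/
structure IsAntisymmKernel {X : Type*} [MetricSpace X] [MeasurableSpace X]
    (K : X → X → ℝ) : Prop where
  measurable : Measurable (fun p : {p : X × X // p.1 ≠ p.2} => K p.1.1 p.1.2)
  antisymm : ∀ x y : X, x ≠ y → K x y = -K y x
  bounded : ∀ δ : ℝ, 0 < δ → ∃ M : ℝ, ∀ x y : X, δ < dist x y → |K x y| ≤ M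

/-- The truncated operator `T_ε f (x) = ∫_{X ∖ B(x, ε)} K(x, y) f(y) dμ(y)`, with open balls. -/
noncomputable def truncated {X : Type*} [MetricSpace X] [MeasurableSpace X]
    (μ : Measure X) (K : X → X → ℝ) (ε : ℝ) (f : X → ℝ) (x : X) : ℝ :=
  ∫ y in (Metric.ball x ε)ᶜ, K x y * f y ∂μ

/-- The maximal operator `T^* f (x) = sup_{ε > 0} |T_ε f (x)|`, with values in `[0, ∞]`. -/
noncomputable def maximal {X : Type*} [MetricSpace X] [MeasurableSpace X]
    (μ : Measure X) (K : X → X → ℝ) (f : X → ℝ) (x : X) : ℝ≥0∞ :=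
  ⨆ (ε : ℝ) (_ : 0 < ε), ENNReal.ofReal |truncated μ K ε f x|

/-- `T^*` is bounded in `L²(μ)`: `∫ (T^* f)² dμ ≤ C₀ ∫ f² dμ` for all `f ∈ L²(μ)`. -/
def MaximalBoundedL2 {X : Type*} [MetricSpace X] [MeasurableSpace X]
    (μ : Measure X) (K : X → X → ℝ) : Prop :=
  ∃ C₀ : ℝ≥0, ∀ f : X → ℝ, MemLp f 2 μ →
    ∫⁻ x, maximal μ K f x ^ 2 ∂μ ≤ C₀ * ∫⁻ x, ENNReal.ofReal (f x ^ 2) ∂μ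

/-- The bounded operator `T` on `L²(μ)` is the weak limit of the `T_ε` as `ε → 0`:
`∫ T_ε(f) g dμ → ∫ T(f) g dμ` for all `f, g ∈ L²(μ)`. -/
def IsWeakLimit {X : Type*} [MetricSpace X] [MeasurableSpace X]
    (μ : Measure X) (K : X → X → ℝ) (T : Lp ℝ 2 μ →L[ℝ] Lp ℝ 2 μ) : Prop :=
  ∀ f g : Lp ℝ 2 μ,
    Tendsto (fun ε : ℝ => ∫ x, truncated μ K ε f x * g x ∂μ) (𝓝[>] 0)
      (𝓝 (∫ x, T f x * g x ∂μ))

/-- `S`, a linear operator from `L¹(μ)` to the `μ`-a.e. equivalence classes of measurable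
functions, extends `T` (from `L²(μ)`, which is contained in `L¹(μ)` when `μ` is finite) and
satisfies a weak `L¹` inequality `μ {|S f| > t} ≤ C ‖f‖₁ / t`. -/
structure IsWeakTypeExtension {X : Type*} [MeasurableSpace X] (μ : Measure X)
    (T : Lp ℝ 2 μ →L[ℝ] Lp ℝ 2 μ) (S : Lp ℝ 1 μ →ₗ[ℝ] (X →ₘ[μ] ℝ)) : Prop where
  extends_L2 : ∀ (f : Lp ℝ 2 μ) (g : Lp ℝ 1 μ),
    (g : X → ℝ) =ᵐ[μ] (f : X → ℝ) → (S g : X → ℝ) =ᵐ[μ] (T f : X → ℝ)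
  weak_type : ∃ C : ℝ, ∀ (f : Lp ℝ 1 μ) (t : ℝ), 0 < t →
    μ {x | t < |(S f : X → ℝ) x|} ≤ ENNReal.ofReal (C * ‖f‖ / t)

end SingularIntegral

/-! The proof rests on three facts: the truncations are uniformly of weak type (1,1), they converge
weakly in `L²`, and the weak limit is recovered pointwise along radii where `μ` is doubling.

Weak limit. By antisymmetry, `∫ T_ε f · g` is half the double integral of the truncated kernel
against `f(y)g(x) - f(x)g(y)`. For bounded Lipschitz `f` and `g` this factor is `O(d(x,y))`, and
`d/h(d)` is integrable by growth and doubling of `h`, so the limit exists by dominated convergence.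
The uniform `L²` bound extends it to all of `L²`, and Riesz representation gives `T`.

Weak type. `μ` need not be doubling, so no Calderón–Zygmund decomposition into doubling balls is
used. A finite sum of point masses is spread out into densities of the same masses whose sum is at
most one and equals one on balls around the atoms (`exists_disjoint_densities`). The union of these
balls has measure at most the total mass; off it, the atoms differ from the densities by size and
smoothness terms. The remaining part is tested against indicators of its level sets. Duality
produces truncations of the indicator at radii that depend on the atom, and this is where the `L²`
bound of the maximal operator, not just of each `T_ε`, enters. Integrable functions are then
discretized at a scale comparable to `ε`.

Pointwise convergence for bounded `f`. Either geometric hypothesis gives a differentiation theorem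
for closed balls and a polynomial lower bound for `μ(B(x,r))` almost everywhere. The latter forces
doubling radii above every small radius. Between a radius and the first doubling radius above it,
the ratio `μ(B)/h` at least doubles at each step, so the change of `T_ε f(x)` is controlled by the
ratio at the top, which tends to zero. At a doubling scale `ρ`, let `E` be a set on which the
density tends to zero uniformly, and average `Tf` over `P = E ∩ B(x,r)` with `ρ ≤ r ≤ 2ρ`. Near `x`,
`f` is replaced by `f(x)` times the indicator of `E`: the error is small in `L²`, the indicator of
`P` paired with itself gives zero by antisymmetry, and the interaction of `P` with the surrounding
annulus is small for a good choice of `r` (`exists_setLIntegral_prod_le`). The far part is nearly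
constant by smoothness and equals `T_{8ρ} f(x)` up to a small error. As the average of `Tf` tends to
`Tf(x)`, the truncations converge to it.

Pointwise convergence for integrable `f`. Weak type and density of Lipschitz functions give
convergence in measure to some `U`. After subtraction of `f(x)` times the indicator of `E`, already
treated, the averages at `x` are small. On a doubling ball the weak type inequality, convergence in
measure and approximate continuity of the limit then leave a common good point, and its value is
transferred to `x` (`tendsto_truncated_of_small_averages`). The pointwise limits form the extension
`S`, which is unique because weak type operators are continuous into convergence in measure. -/

namespace SingularIntegral

/-- A positive, non-decreasing function on `(0, ∞)` that is doubling with constant `C`. -/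
structure IsGauge (h : ℝ → ℝ) (C : ℝ) : Prop where
  pos : ∀ r : ℝ, 0 < r → 0 < h r
  mono : ∀ r s : ℝ, 0 < r → r ≤ s → h r ≤ h s
  doubling : ∀ r : ℝ, 0 < r → h (2 * r) ≤ C * h r

/-- An everywhere antisymmetric, jointly measurable kernel that satisfies the size and smoothness
conditions of the gauge `h`, and a measure whose growth is bounded by `h`. -/
structure IsCZKernel {X : Type*} [MetricSpace X] [MeasurableSpace X] (μ : Measure X)
    (K : X → X → ℝ) (h : ℝ → ℝ) (C : ℝ) : Prop extends IsGauge h C where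
  lim : Tendsto h (𝓝[>] 0) (𝓝 0)
  measurable : Measurable (Function.uncurry K)
  antisymm : ∀ x y : X, K x y = -K y x
  size : ∀ x y : X, x ≠ y → |K x y| ≤ 1 / h (dist x y)
  smooth : ∀ x y z : X, x ≠ y → z ≠ x → 2 * dist y z < dist x y →
      |K x y - K x z| ≤ dist y z / (dist x y * h (dist x y))
  growth : ∀ (x : X) (r : ℝ), 0 < r → μ.real (Metric.ball x r) ≤ h r

/-! ### Dyadic annulus sums for a doubling gauge -/

namespace IsGauge

variable {h : ℝ → ℝ} {C : ℝ}

theorem one_le (hh : IsGauge h C) : 1 ≤ C := by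
  have h1 := hh.pos 1 one_pos
  have h2 := hh.mono 1 (2 * 1) one_pos (by norm_num)
  have h3 := hh.doubling 1 one_pos
  by_contra! hC
  nlinarith

theorem nonneg_const (hh : IsGauge h C) : 0 ≤ C := zero_le_one.trans hh.one_le

theorem le_pow_mul (hh : IsGauge h C) (n : ℕ) {r : ℝ} (hr : 0 < r) :
    h (2 ^ n * r) ≤ C ^ n * h r := by
  induction n with
  | zero => simp
  | succ n ih =>
    calc h (2 ^ (n + 1) * r) = h (2 * (2 ^ n * r)) := by ring_nf
      _ ≤ C * h (2 ^ n * r) := hh.doubling _ (by positivity)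
      _ ≤ C * (C ^ n * h r) := by
        have := hh.nonneg_const
        gcongr
      _ = C ^ (n + 1) * h r := by ring

variable {X : Type*} [MetricSpace X] [SecondCountableTopology X] [MeasurableSpace X]
  [BorelSpace X]

/-- On the annulus of inner radius `2 ^ k * r` the integrand is at most `2⁻ᵏ / h (2 ^ k * r)`, while
doubling bounds the mass by `C * η * h (2 ^ k * r)`; the geometric series sums to `2 * C * η`. The
measure `ν` is general because the lemma is also applied to `|f| μ`, where `η` is small. -/
theorem lintegral_compl_ball_le (hh : IsGauge h C) {ν : Measure X} {x : X} {r η : ℝ}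
    (hr : 0 < r) (hη : 0 ≤ η)
    (hν : ∀ s, r ≤ s → ν (Metric.ball x s) ≤ ENNReal.ofReal (η * h s)) :
    ∫⁻ y in (Metric.ball x r)ᶜ, ENNReal.ofReal (r / (dist y x * h (dist y x))) ∂ν
      ≤ ENNReal.ofReal (2 * C * η) := by
  have hC := hh.nonneg_const
  set A : ℕ → Set X := fun k => {y | 2 ^ k * r ≤ dist y x ∧ dist y x < 2 ^ (k + 1) * r} with hA
  have hsub : (Metric.ball x r)ᶜ ⊆ ⋃ k, A k := by
    intro y hy
    have hy' : r ≤ dist y x := by simpa using hy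
    obtain ⟨n, hn, hn'⟩ := exists_nat_pow_near (x := dist y x / r) (y := 2)
      ((one_le_div hr).2 hy') one_lt_two
    refine mem_iUnion.2 ⟨n, ?_, ?_⟩
    · exact (le_div_iff₀ hr).1 hn
    · exact (div_lt_iff₀ hr).1 hn'
  have hmeas : ∀ k, MeasurableSet (A k) := fun k =>
    (measurableSet_le measurable_const (measurable_id.dist measurable_const)).inter
      (measurableSet_lt (measurable_id.dist measurable_const) measurable_const)
  have hk : ∀ k, ∫⁻ y in A k, ENNReal.ofReal (r / (dist y x * h (dist y x))) ∂ν
      ≤ ENNReal.ofReal (C * η * (1 / 2) ^ k) := by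
    intro k
    have hkr : 0 < 2 ^ k * r := by positivity
    have hpos := hh.pos _ hkr
    calc ∫⁻ y in A k, ENNReal.ofReal (r / (dist y x * h (dist y x))) ∂ν
        ≤ ∫⁻ y in A k, ENNReal.ofReal ((1 / 2) ^ k / h (2 ^ k * r)) ∂ν := by
          refine setLIntegral_mono' (hmeas k) fun y hy => ENNReal.ofReal_le_ofReal ?_
          have h1 := hh.mono _ _ hkr hy.1
          calc r / (dist y x * h (dist y x)) ≤ r / ((2 ^ k * r) * h (2 ^ k * r)) := by
                gcongr
                exact hy.1
            _ = (1 / 2) ^ k / h (2 ^ k * r) := by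
                rw [one_div, inv_pow]
                field_simp
      _ = ENNReal.ofReal ((1 / 2) ^ k / h (2 ^ k * r)) * ν (A k) := by
          rw [setLIntegral_const]
      _ ≤ ENNReal.ofReal ((1 / 2) ^ k / h (2 ^ k * r)) * ENNReal.ofReal (η * h (2 ^ (k + 1) * r)) := by
          gcongr
          refine (measure_mono fun y hy => ?_).trans (hν _ ?_)
          · exact hy.2
          · have : (1 : ℝ) ≤ 2 ^ (k + 1) := one_le_pow₀ one_le_two
            nlinarith
      _ = ENNReal.ofReal ((1 / 2) ^ k / h (2 ^ k * r) * (η * h (2 ^ (k + 1) * r))) := by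
          rw [← ENNReal.ofReal_mul (by positivity)]
      _ ≤ ENNReal.ofReal (C * η * (1 / 2) ^ k) := by
          refine ENNReal.ofReal_le_ofReal ?_
          have h2 : h (2 ^ (k + 1) * r) ≤ C * h (2 ^ k * r) := by
            rw [show (2 : ℝ) ^ (k + 1) * r = 2 * (2 ^ k * r) by ring]
            exact hh.doubling _ hkr
          calc (1 / 2) ^ k / h (2 ^ k * r) * (η * h (2 ^ (k + 1) * r))
              ≤ (1 / 2) ^ k / h (2 ^ k * r) * (η * (C * h (2 ^ k * r))) := by gcongr
            _ = C * η * (1 / 2) ^ k := by field_simp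
  calc ∫⁻ y in (Metric.ball x r)ᶜ, ENNReal.ofReal (r / (dist y x * h (dist y x))) ∂ν
      ≤ ∫⁻ y in ⋃ k, A k, ENNReal.ofReal (r / (dist y x * h (dist y x))) ∂ν :=
        lintegral_mono_set hsub
    _ ≤ ∑' k, ∫⁻ y in A k, ENNReal.ofReal (r / (dist y x * h (dist y x))) ∂ν :=
        lintegral_iUnion_le _ _
    _ ≤ ∑' k : ℕ, ENNReal.ofReal (C * η * (1 / 2) ^ k) := ENNReal.tsum_le_tsum hk
    _ = ENNReal.ofReal (∑' k : ℕ, C * η * (1 / 2) ^ k) :=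
        (ENNReal.ofReal_tsum_of_nonneg (fun k => by positivity)
          (summable_geometric_two.mul_left _)).symm
    _ = ENNReal.ofReal (2 * C * η) := by rw [tsum_mul_left, tsum_geometric_two]; ring_nf

/-- The counterpart for shrinking annuli: the numerator `dist y x` supplies the geometric factor.
This is the integrability that tames the singularity of the kernel whenever a factor of order of the
distance is available. -/
theorem lintegral_ball_le (hh : IsGauge h C) {ν : Measure X} {x : X} {R η : ℝ}
    (hR : 0 < R) (hη : 0 ≤ η)
    (hν : ∀ s, 0 < s → s ≤ R → ν (Metric.ball x s) ≤ ENNReal.ofReal (η * h s)) :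
    ∫⁻ y in Metric.ball x R, ENNReal.ofReal (dist y x / h (dist y x)) ∂ν
      ≤ ENNReal.ofReal (2 * C * η * R) := by
  have hC := hh.nonneg_const
  set A : ℕ → Set X :=
    fun k => {y | (1 / 2) ^ (k + 1) * R ≤ dist y x ∧ dist y x < (1 / 2) ^ k * R} with hA
  have hsub : Metric.ball x R ⊆ {x} ∪ ⋃ k, A k := by
    intro y hy
    rcases eq_or_ne y x with rfl | hne
    · simp
    right
    have hd : 0 < dist y x := dist_pos.2 hne
    have hy' : dist y x < R := by simpa using hy
    obtain ⟨n, hn, hn'⟩ := exists_nat_pow_near_of_lt_one (x := dist y x / R) (y := 1 / 2)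
      (by positivity) ((div_le_one hR).2 hy'.le) (by norm_num) (by norm_num)
    -- The power lemma gives intervals closed above, the annuli are closed below; a distance equal
    -- to an endpoint moves to the next larger annulus.
    rcases hn'.eq_or_lt with he | hlt
    · cases n with
      | zero =>
        have := (div_eq_iff hR.ne').1 he
        simp at this
        exact absurd this hy'.ne
      | succ n =>
        refine mem_iUnion.2 ⟨n, ?_, ?_⟩
        · rw [← he, div_mul_cancel₀ _ hR.ne']
        · rw [(div_eq_iff hR.ne').1 he]
          exact mul_lt_mul_of_pos_right
            (pow_lt_pow_right_of_lt_one₀ (by norm_num) (by norm_num) n.lt_succ_self) hR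
    · refine mem_iUnion.2 ⟨n, ?_, ?_⟩
      · exact ((lt_div_iff₀ hR).1 hn).le
      · exact (div_lt_iff₀ hR).1 hlt
  have hmeas : ∀ k, MeasurableSet (A k) := fun k =>
    (measurableSet_le measurable_const (measurable_id.dist measurable_const)).inter
      (measurableSet_lt (measurable_id.dist measurable_const) measurable_const)
  have hk : ∀ k, ∫⁻ y in A k, ENNReal.ofReal (dist y x / h (dist y x)) ∂ν
      ≤ ENNReal.ofReal (C * η * R * (1 / 2) ^ k) := by
    intro k
    have hkr : 0 < (1 / 2) ^ (k + 1) * R := by positivity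
    have hpos := hh.pos _ hkr
    calc ∫⁻ y in A k, ENNReal.ofReal (dist y x / h (dist y x)) ∂ν
        ≤ ∫⁻ y in A k, ENNReal.ofReal ((1 / 2) ^ k * R / h ((1 / 2) ^ (k + 1) * R)) ∂ν := by
          refine setLIntegral_mono' (hmeas k) fun y hy => ENNReal.ofReal_le_ofReal ?_
          have h1 := hh.mono _ _ hkr hy.1
          have h2 := hy.2.le
          gcongr
      _ = ENNReal.ofReal ((1 / 2) ^ k * R / h ((1 / 2) ^ (k + 1) * R)) * ν (A k) := by
          rw [setLIntegral_const]
      _ ≤ ENNReal.ofReal ((1 / 2) ^ k * R / h ((1 / 2) ^ (k + 1) * R)) *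
            ENNReal.ofReal (η * h ((1 / 2) ^ k * R)) := by
          gcongr
          refine (measure_mono fun y hy => ?_).trans (hν _ (by positivity) ?_)
          · exact hy.2
          · have : (1 / 2 : ℝ) ^ k ≤ 1 := pow_le_one₀ (by norm_num) (by norm_num)
            nlinarith
      _ = ENNReal.ofReal ((1 / 2) ^ k * R / h ((1 / 2) ^ (k + 1) * R) *
            (η * h ((1 / 2) ^ k * R))) := by
          rw [← ENNReal.ofReal_mul (by positivity)]
      _ ≤ ENNReal.ofReal (C * η * R * (1 / 2) ^ k) := by
          refine ENNReal.ofReal_le_ofReal ?_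
          have h2 : h ((1 / 2) ^ k * R) ≤ C * h ((1 / 2) ^ (k + 1) * R) := by
            rw [show (1 / 2 : ℝ) ^ k * R = 2 * ((1 / 2) ^ (k + 1) * R) by ring]
            exact hh.doubling _ hkr
          calc (1 / 2) ^ k * R / h ((1 / 2) ^ (k + 1) * R) * (η * h ((1 / 2) ^ k * R))
              ≤ (1 / 2) ^ k * R / h ((1 / 2) ^ (k + 1) * R) *
                  (η * (C * h ((1 / 2) ^ (k + 1) * R))) := by gcongr
            _ = C * η * R * (1 / 2) ^ k := by
                generalize h ((1 / 2) ^ (k + 1) * R) = u at hpos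
                field_simp
  -- The integrand vanishes at the centre, so an atom of `ν` at `x` would do no harm.
  have h0 : ∫⁻ y in ({x} : Set X), ENNReal.ofReal (dist y x / h (dist y x)) ∂ν = 0 := by
    simp
  calc ∫⁻ y in Metric.ball x R, ENNReal.ofReal (dist y x / h (dist y x)) ∂ν
      ≤ ∫⁻ y in {x} ∪ ⋃ k, A k, ENNReal.ofReal (dist y x / h (dist y x)) ∂ν :=
        lintegral_mono_set hsub
    _ ≤ 0 + ∑' k, ∫⁻ y in A k, ENNReal.ofReal (dist y x / h (dist y x)) ∂ν :=
        (lintegral_union_le _ _ _).trans (add_le_add h0.le (lintegral_iUnion_le _ _))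
    _ ≤ ∑' k : ℕ, ENNReal.ofReal (C * η * R * (1 / 2) ^ k) := by
        rw [zero_add]
        exact ENNReal.tsum_le_tsum hk
    _ = ENNReal.ofReal (∑' k : ℕ, C * η * R * (1 / 2) ^ k) :=
        (ENNReal.ofReal_tsum_of_nonneg (fun k => by positivity)
          (summable_geometric_two.mul_left _)).symm
    _ = ENNReal.ofReal (2 * C * η * R) := by rw [tsum_mul_left, tsum_geometric_two]; ring_nf

end IsGauge

end SingularIntegral


/-! ### Elementary properties of truncated kernels -/

namespace SingularIntegral

set_option linter.unusedSectionVars false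

/-- The kernel `K`, set to zero where the points have distance less than `ε`. -/
noncomputable def truncKernel {X : Type*} [MetricSpace X] (K : X → X → ℝ) (ε : ℝ) (x y : X) : ℝ :=
  open Classical in if ε ≤ dist x y then K x y else 0

variable {X : Type*} [MetricSpace X] {K : X → X → ℝ} {ε : ℝ} {x y : X}

theorem truncKernel_of_le (hxy : ε ≤ dist x y) : truncKernel K ε x y = K x y := if_pos hxy

theorem truncKernel_of_lt (hxy : dist x y < ε) : truncKernel K ε x y = 0 := if_neg hxy.not_ge

variable [MeasurableSpace X]

theorem truncated_eq_integral [BorelSpace X] (μ : Measure X) (f : X → ℝ) :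
    truncated μ K ε f x = ∫ y, truncKernel K ε x y * f y ∂μ := by
  rw [truncated, ← integral_indicator Metric.isOpen_ball.measurableSet.compl]
  congr 1 with y
  by_cases hxy : ε ≤ dist x y
  · rw [truncKernel_of_le hxy, indicator_of_mem]
    simpa [dist_comm] using hxy
  · rw [truncKernel_of_lt (not_le.1 hxy), indicator_of_notMem, zero_mul]
    simpa [dist_comm] using hxy

theorem truncated_congr_ae {μ : Measure X} {f g : X → ℝ} (hfg : f =ᵐ[μ] g) :
    truncated μ K ε f = truncated μ K ε g := by
  ext x
  refine integral_congr_ae (ae_restrict_of_ae ?_)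
  filter_upwards [hfg] with y hy
  simp [hy]

theorem truncated_const_mul (μ : Measure X) (c : ℝ) (f : X → ℝ) (x : X) :
    truncated μ K ε (fun y => c * f y) x = c * truncated μ K ε f x := by
  rw [truncated, truncated, ← integral_const_mul]
  congr 1 with y
  ring

theorem integral_integral_mul_swap {μ : Measure X} [IsFiniteMeasure μ] {L : X → X → ℝ} {M : ℝ}
    (hL : Measurable (Function.uncurry L)) (hM : ∀ x y, |L x y| ≤ M) {f g : X → ℝ}
    (hf : Integrable f μ) (hg : Integrable g μ) :
    ∫ x, (∫ y, L x y * f y ∂μ) * g x ∂μ = ∫ y, (∫ x, L x y * g x ∂μ) * f y ∂μ := by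
  have hint : Integrable (fun p : X × X => L p.1 p.2 * (g p.1 * f p.2)) (μ.prod μ) :=
    (hg.mul_prod hf).bdd_mul hL.aestronglyMeasurable (c := M)
      (Eventually.of_forall fun p => hM p.1 p.2)
  calc ∫ x, (∫ y, L x y * f y ∂μ) * g x ∂μ
      = ∫ x, ∫ y, L x y * (g x * f y) ∂μ ∂μ := by
        congr 1 with x
        rw [← integral_mul_const]
        congr 1 with y
        ring
    _ = ∫ y, ∫ x, L x y * (g x * f y) ∂μ ∂μ := integral_integral_swap hint
    _ = ∫ y, (∫ x, L x y * g x ∂μ) * f y ∂μ := by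
        congr 1 with y
        rw [← integral_mul_const]
        congr 1 with x
        ring

namespace IsCZKernel

variable [SecondCountableTopology X] [BorelSpace X] {μ : Measure X} {h : ℝ → ℝ} {C : ℝ}

theorem self_eq_zero (hK : IsCZKernel μ K h C) (x : X) : K x x = 0 := by
  have := hK.antisymm x x
  linarith

theorem abs_le (hK : IsCZKernel μ K h C) (hε : 0 < ε) (hxy : ε ≤ dist x y) :
    |K x y| ≤ 1 / h ε := by
  have h1 := hK.size x y (dist_pos.1 (hε.trans_le hxy))
  have h2 := hK.mono _ _ hε hxy
  have h3 := hK.pos _ hε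
  exact h1.trans (by gcongr)

theorem abs_truncKernel_le (hK : IsCZKernel μ K h C) (hε : 0 < ε) (x y : X) :
    |truncKernel K ε x y| ≤ 1 / h ε := by
  by_cases hxy : ε ≤ dist x y
  · rw [truncKernel_of_le hxy]
    exact hK.abs_le hε hxy
  · rw [truncKernel_of_lt (not_le.1 hxy), abs_zero]
    have := hK.pos _ hε
    positivity

theorem truncKernel_antisymm (hK : IsCZKernel μ K h C) (ε : ℝ) (x y : X) :
    truncKernel K ε x y = -truncKernel K ε y x := by
  by_cases hxy : ε ≤ dist x y
  · rw [truncKernel_of_le hxy, truncKernel_of_le (by rwa [dist_comm]), hK.antisymm]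
  · rw [truncKernel_of_lt (not_le.1 hxy), truncKernel_of_lt (by rwa [dist_comm, ← not_le]),
      neg_zero]

theorem measurable_truncKernel (hK : IsCZKernel μ K h C) (ε : ℝ) :
    Measurable (Function.uncurry (truncKernel K ε)) := by
  unfold truncKernel
  exact Measurable.ite (measurableSet_le measurable_const
    (measurable_fst.dist measurable_snd)) hK.measurable measurable_const

theorem measurable_truncKernel_right (hK : IsCZKernel μ K h C) (ε : ℝ) (x : X) :
    Measurable (truncKernel K ε x) :=
  (hK.measurable_truncKernel ε).comp measurable_prodMk_left

theorem measurable_truncKernel_left (hK : IsCZKernel μ K h C) (ε : ℝ) (y : X) :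
    Measurable (fun x => truncKernel K ε x y) :=
  (hK.measurable_truncKernel ε).comp measurable_prodMk_right

theorem integrable_truncKernel_mul (hK : IsCZKernel μ K h C) (hε : 0 < ε) (x : X) {f : X → ℝ}
    (hf : Integrable f μ) : Integrable (fun y => truncKernel K ε x y * f y) μ :=
  hf.bdd_mul (hK.measurable_truncKernel_right ε x).aestronglyMeasurable
    (Eventually.of_forall fun y => hK.abs_truncKernel_le hε x y)

theorem abs_truncated_le (hK : IsCZKernel μ K h C) (hε : 0 < ε) (x : X) {f : X → ℝ}
    (hf : Integrable f μ) : |truncated μ K ε f x| ≤ (∫ y, |f y| ∂μ) / h ε := by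
  rw [truncated_eq_integral]
  calc |∫ y, truncKernel K ε x y * f y ∂μ| ≤ ∫ y, |truncKernel K ε x y * f y| ∂μ :=
        abs_integral_le_integral_abs
    _ ≤ ∫ y, 1 / h ε * |f y| ∂μ := by
        refine integral_mono (hK.integrable_truncKernel_mul hε x hf).abs
          (hf.abs.const_mul _) fun y => ?_
        simp only [abs_mul]
        gcongr
        exact hK.abs_truncKernel_le hε x y
    _ = (∫ y, |f y| ∂μ) / h ε := by rw [integral_const_mul]; ring

theorem truncated_add (hK : IsCZKernel μ K h C) (hε : 0 < ε) (x : X) {f g : X → ℝ}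
    (hf : Integrable f μ) (hg : Integrable g μ) :
    truncated μ K ε (fun y => f y + g y) x = truncated μ K ε f x + truncated μ K ε g x := by
  simp only [truncated_eq_integral, mul_add]
  exact integral_add (hK.integrable_truncKernel_mul hε x hf)
    (hK.integrable_truncKernel_mul hε x hg)

theorem truncated_sub (hK : IsCZKernel μ K h C) (hε : 0 < ε) (x : X) {f g : X → ℝ}
    (hf : Integrable f μ) (hg : Integrable g μ) :
    truncated μ K ε (fun y => f y - g y) x = truncated μ K ε f x - truncated μ K ε g x := by
  simp only [truncated_eq_integral, mul_sub]
  exact integral_sub (hK.integrable_truncKernel_mul hε x hf)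
    (hK.integrable_truncKernel_mul hε x hg)

theorem measurable_truncated [SFinite μ] (hK : IsCZKernel μ K h C) (ε : ℝ) {f : X → ℝ}
    (hf : AEStronglyMeasurable f μ) : Measurable (truncated μ K ε f) := by
  rw [truncated_congr_ae hf.ae_eq_mk]
  have h1 : StronglyMeasurable
      (fun p : X × X => truncKernel K ε p.1 p.2 * hf.mk f p.2) :=
    (hK.measurable_truncKernel ε).stronglyMeasurable.mul
      (hf.stronglyMeasurable_mk.comp_measurable measurable_snd)
  have h2 := h1.integral_prod_right' (ν := μ)
  convert h2.measurable using 1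
  ext x
  rw [truncated_eq_integral]

variable [IsFiniteMeasure μ]

theorem integrable_truncated (hK : IsCZKernel μ K h C) (hε : 0 < ε) {f : X → ℝ}
    (hf : Integrable f μ) : Integrable (truncated μ K ε f) μ :=
  Integrable.of_bound (hK.measurable_truncated ε hf.1).aestronglyMeasurable _
    (Eventually.of_forall fun x => hK.abs_truncated_le hε x hf)

theorem integral_truncated_mul (hK : IsCZKernel μ K h C) (hε : 0 < ε) {f g : X → ℝ}
    (hf : Integrable f μ) (hg : Integrable g μ) :
    ∫ x, truncated μ K ε f x * g x ∂μ = -∫ x, truncated μ K ε g x * f x ∂μ := by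
  simp only [truncated_eq_integral]
  rw [integral_integral_mul_swap (hK.measurable_truncKernel ε) (hK.abs_truncKernel_le hε) hf hg,
    ← integral_neg]
  congr 1 with y
  rw [← neg_mul, ← integral_neg]
  congr 2 with x
  rw [hK.truncKernel_antisymm ε x y]
  ring

/-- Antisymmetry makes the form equal to its own negative. This cancellation later removes the
self-interaction of the set over which `Tf` is averaged. -/
theorem integral_truncated_mul_self (hK : IsCZKernel μ K h C) (hε : 0 < ε) {f : X → ℝ}
    (hf : Integrable f μ) : ∫ x, truncated μ K ε f x * f x ∂μ = 0 := by
  have := hK.integral_truncated_mul hε hf hf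
  linarith

theorem measure_ball_le (hK : IsCZKernel μ K h C) (x : X) {r : ℝ} (hr : 0 < r) :
    μ (Metric.ball x r) ≤ ENNReal.ofReal (h r) := by
  rw [← ofReal_measureReal]
  exact ENNReal.ofReal_le_ofReal (hK.growth x r hr)

/-- A singleton lies in every ball around it, whose mass is at most `h r → 0`. -/
theorem nullSingletonClass (hK : IsCZKernel μ K h C) : NullSingletonClass μ := by
  refine ⟨fun x => ?_⟩
  have h1 : Tendsto (fun r => ENNReal.ofReal (h r)) (𝓝[>] 0) (𝓝 0) := by
    simpa using ENNReal.tendsto_ofReal hK.lim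
  refine le_antisymm (ge_of_tendsto h1 ?_) (zero_le)
  filter_upwards [self_mem_nhdsWithin] with r hr
  refine (measure_mono ?_).trans (hK.measure_ball_le x hr)
  simpa using hr

theorem abs_setIntegral_le (hK : IsCZKernel μ K h C) {f : X → ℝ} {c : ℝ} (hε : 0 < ε) (x : X)
    (hc : ∀ y, |f y| ≤ c) {s : Set X} (hsd : ∀ y ∈ s, ε ≤ dist x y) {R : ℝ} (hR : 0 < R) (hsR : s ⊆ Metric.ball x R) :
    |∫ y in s, K x y * f y ∂μ| ≤ c * h R / h ε := by
  have hpos := hK.pos _ hε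
  have hc0 : 0 ≤ c := (abs_nonneg _).trans (hc x)
  have h1 : ‖∫ y in s, K x y * f y ∂μ‖ ≤ 1 / h ε * c * μ.real s := by
    refine norm_setIntegral_le_of_norm_le_const (measure_lt_top _ _) fun y hy => ?_
    rw [Real.norm_eq_abs, abs_mul]
    have := hK.abs_le hε (hsd y hy)
    have := hc y
    gcongr
  have h2 : μ.real s ≤ h R := (measureReal_mono hsR).trans (hK.growth x R hR)
  calc _ ≤ 1 / h ε * c * μ.real s := h1
    _ ≤ 1 / h ε * c * h R := by gcongr
    _ = _ := by ring

end IsCZKernel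

end SingularIntegral


/-! ### Spreading point masses into densities bounded by one -/

namespace SingularIntegral

set_option linter.unusedSectionVars false

variable {X : Type*} [MetricSpace X] [MeasurableSpace X]
  [BorelSpace X] {μ : Measure X} [IsFiniteMeasure μ]

theorem tendsto_setIntegral_closedBall_nhdsGT {v : X → ℝ} (hv : Integrable v μ) (x : X) (r : ℝ) :
    Tendsto (fun s => ∫ y in Metric.closedBall x s, v y ∂μ) (𝓝[>] r)
      (𝓝 (∫ y in Metric.closedBall x r, v y ∂μ)) := by
  simp only [← integral_indicator Metric.isClosed_closedBall.measurableSet]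
  refine tendsto_integral_filter_of_dominated_convergence (fun y => ‖v y‖) ?_ ?_ hv.norm ?_
  · exact Eventually.of_forall fun s =>
      hv.1.indicator Metric.isClosed_closedBall.measurableSet
  · exact Eventually.of_forall fun s => Eventually.of_forall fun y => norm_indicator_le_norm_self _ _
  · refine Eventually.of_forall fun y => ?_
    by_cases hy : dist y x ≤ r
    · refine tendsto_const_nhds.congr' ?_
      filter_upwards [self_mem_nhdsWithin] with s hs
      have hs' : r < s := hs
      rw [indicator_of_mem (Metric.mem_closedBall.2 hy),
        indicator_of_mem (Metric.mem_closedBall.2 (hy.trans hs'.le))]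
    · refine tendsto_const_nhds.congr' ?_
      have : ∀ᶠ s in 𝓝[>] r, s < dist y x := nhdsWithin_le_nhds (Iio_mem_nhds (not_le.1 hy))
      filter_upwards [this] with s hs
      rw [indicator_of_notMem (by simpa using hy), indicator_of_notMem (by simpa using hs)]

theorem tendsto_setIntegral_closedBall_nhdsLT {v : X → ℝ} (hv : Integrable v μ) (x : X) (r : ℝ) :
    Tendsto (fun s => ∫ y in Metric.closedBall x s, v y ∂μ) (𝓝[<] r)
      (𝓝 (∫ y in Metric.ball x r, v y ∂μ)) := by
  simp only [← integral_indicator Metric.isClosed_closedBall.measurableSet,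
    ← integral_indicator Metric.isOpen_ball.measurableSet]
  refine tendsto_integral_filter_of_dominated_convergence (fun y => ‖v y‖) ?_ ?_ hv.norm ?_
  · exact Eventually.of_forall fun s =>
      hv.1.indicator Metric.isClosed_closedBall.measurableSet
  · exact Eventually.of_forall fun s => Eventually.of_forall fun y => norm_indicator_le_norm_self _ _
  · refine Eventually.of_forall fun y => ?_
    by_cases hy : dist y x < r
    · refine tendsto_const_nhds.congr' ?_
      have : ∀ᶠ s in 𝓝[<] r, dist y x < s := nhdsWithin_le_nhds (Ioi_mem_nhds hy)
      filter_upwards [this] with s hs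
      rw [indicator_of_mem (Metric.mem_ball.2 hy), indicator_of_mem (Metric.mem_closedBall.2 hs.le)]
    · refine tendsto_const_nhds.congr' ?_
      filter_upwards [self_mem_nhdsWithin] with s hs
      have hs' : s < r := hs
      rw [indicator_of_notMem (by simpa using hy), indicator_of_notMem]
      simpa using hs'.trans_le (not_lt.1 hy)

theorem tendsto_setIntegral_closedBall_atTop {v : X → ℝ} (hv : Integrable v μ) (x : X) :
    Tendsto (fun s => ∫ y in Metric.closedBall x s, v y ∂μ) atTop (𝓝 (∫ y, v y ∂μ)) := by
  simp only [← integral_indicator Metric.isClosed_closedBall.measurableSet]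
  refine tendsto_integral_filter_of_dominated_convergence (fun y => ‖v y‖) ?_ ?_ hv.norm ?_
  · exact Eventually.of_forall fun s =>
      hv.1.indicator Metric.isClosed_closedBall.measurableSet
  · exact Eventually.of_forall fun s => Eventually.of_forall fun y => norm_indicator_le_norm_self _ _
  · refine Eventually.of_forall fun y => tendsto_const_nhds.congr' ?_
    filter_upwards [eventually_ge_atTop (dist y x)] with s hs
    rw [indicator_of_mem (Metric.mem_closedBall.2 hs)]

/-- For a measure without atoms, any amount of mass `a < ∫ v` of a density `v` can be taken from
around a given point. -/
theorem exists_le_integral_eq [NullSingletonClass μ] {v : X → ℝ} (hvm : Measurable v)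
    (hv0 : ∀ y, 0 ≤ v y) (hv : Integrable v μ) (x : X) {a : ℝ} (ha : 0 < a)
    (hav : a < ∫ y, v y ∂μ) :
    ∃ (ρ : ℝ) (w : X → ℝ), 0 < ρ ∧ Measurable w ∧ (∀ y, 0 ≤ w y) ∧ (∀ y, w y ≤ v y) ∧
      ∫ y, w y ∂μ = a ∧ (∀ y ∈ Metric.ball x ρ, w y = v y) ∧
      ∀ y, ρ < dist y x → w y = 0 := by
  -- The mass in closed balls is a monotone right-continuous function of the radius with `m 0 = 0`.
  -- The radius sought is the first one where it reaches `a`.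
  set m : ℝ → ℝ := fun s => ∫ y in Metric.closedBall x s, v y ∂μ with hm
  have hmono : Monotone m := fun s t hst =>
    setIntegral_mono_set hv.integrableOn (Eventually.of_forall hv0)
      (Metric.closedBall_subset_closedBall hst).eventuallyLE
  obtain ⟨s₀, hs₀, hs₀'⟩ : ∃ s, 0 ≤ s ∧ a ≤ m s := by
    have := (tendsto_setIntegral_closedBall_atTop hv x).eventually (lt_mem_nhds hav)
    obtain ⟨s, hs⟩ := (this.and (eventually_ge_atTop 0)).exists
    exact ⟨s, hs.2, hs.1.le⟩
  set S : Set ℝ := {s | a ≤ m s} with hS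
  have hm0 : m 0 = 0 := by
    simp only [hm, Metric.closedBall_zero]
    simp
  have hSpos : ∀ s ∈ S, 0 < s := by
    intro s hs
    by_contra! hs0
    have : m s ≤ m 0 := hmono hs0
    have h2 : a ≤ m s := hs
    linarith
  have hne : S.Nonempty := ⟨s₀, hs₀'⟩
  have hbdd : BddBelow S := ⟨0, fun s hs => (hSpos s hs).le⟩
  set ρ := sInf S with hρ
  have hq : a ≤ m ρ := by
    refine ge_of_tendsto (tendsto_setIntegral_closedBall_nhdsGT hv x ρ) ?_
    filter_upwards [self_mem_nhdsWithin] with s hs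
    obtain ⟨s', hs', hs's⟩ := (csInf_lt_iff hbdd hne).1 (show sInf S < s from hs)
    exact le_trans (show a ≤ m s' from hs') (hmono hs's.le)
  have hρpos : 0 < ρ := hSpos ρ hq
  set p := ∫ y in Metric.ball x ρ, v y ∂μ with hp
  have hpa : p ≤ a := by
    refine le_of_tendsto (tendsto_setIntegral_closedBall_nhdsLT hv x ρ) ?_
    filter_upwards [self_mem_nhdsWithin] with s hs
    by_contra! hlt
    exact absurd (csInf_le hbdd (show s ∈ S from hlt.le)) (not_le.2 hs)
  -- The sphere of radius `ρ` may carry mass, so that `m` jumps past `a`. The fraction `c` of the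
  -- sphere brings the mass to exactly `a`.
  obtain ⟨c, hc0, hc1, hc⟩ : ∃ c : ℝ, 0 ≤ c ∧ c ≤ 1 ∧ (1 - c) * p + c * m ρ = a := by
    rcases (hpa.trans hq).eq_or_lt with he | hlt
    · exact ⟨0, le_rfl, zero_le_one, by linarith⟩
    · have hd : 0 < m ρ - p := by linarith
      refine ⟨(a - p) / (m ρ - p), div_nonneg (by linarith) hd.le,
        (div_le_one hd).2 (by linarith), ?_⟩
      field_simp
      ring
  have hmb : MeasurableSet (Metric.ball x ρ) := Metric.isOpen_ball.measurableSet
  have hmc : MeasurableSet (Metric.closedBall x ρ) := Metric.isClosed_closedBall.measurableSet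
  refine ⟨ρ, fun y => (1 - c) * (Metric.ball x ρ).indicator v y +
    c * (Metric.closedBall x ρ).indicator v y, hρpos, ?_, ?_, ?_, ?_, ?_, ?_⟩
  · exact ((hvm.indicator hmb).const_mul _).add ((hvm.indicator hmc).const_mul _)
  · intro y
    have h1 := indicator_nonneg (s := Metric.ball x ρ) (f := v) (fun y _ => hv0 y) y
    have h2 := indicator_nonneg (s := Metric.closedBall x ρ) (f := v) (fun y _ => hv0 y) y
    have : 0 ≤ 1 - c := by linarith
    positivity
  · intro y
    have h1 := indicator_le_self' (s := Metric.ball x ρ) (f := v) (fun y _ => hv0 y) y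
    have h2 := indicator_le_self' (s := Metric.closedBall x ρ) (f := v) (fun y _ => hv0 y) y
    have : 0 ≤ 1 - c := by linarith
    nlinarith
  · rw [integral_add ((hv.indicator hmb).const_mul _) ((hv.indicator hmc).const_mul _),
      integral_const_mul, integral_const_mul, integral_indicator hmb, integral_indicator hmc]
    exact hc
  · intro y hy
    simp only [indicator_of_mem hy, indicator_of_mem (Metric.ball_subset_closedBall hy)]
    ring
  · intro y hy
    have h1 : y ∉ Metric.ball x ρ := by simpa using hy.le
    have h2 : y ∉ Metric.closedBall x ρ := by simpa using hy
    simp [indicator_of_notMem h1, indicator_of_notMem h2]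

/-- Given points `x i` and positive amounts `a i` whose sum is smaller than the total mass, there
are disjoint densities of masses `a i`, located in balls around the points `x i` that are
saturated by the sum of the densities. -/
theorem exists_disjoint_densities [NullSingletonClass μ] {ι : Type*} (s : Finset ι) (x : ι → X)
    (a : ι → ℝ) (ha : ∀ i ∈ s, 0 < a i) (has : ∑ i ∈ s, a i < μ.real univ) :
    ∃ (ρ : ι → ℝ) (w : ι → X → ℝ), (∀ i ∈ s, 0 < ρ i) ∧ (∀ i ∈ s, Measurable (w i)) ∧
      (∀ i ∈ s, ∀ y, 0 ≤ w i y) ∧ (∀ y, ∑ i ∈ s, w i y ≤ 1) ∧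
      (∀ i ∈ s, ∫ y, w i y ∂μ = a i) ∧
      (∀ i ∈ s, ∀ y ∈ Metric.ball (x i) (ρ i), ∑ j ∈ s, w j y = 1) ∧
      ∀ i ∈ s, ∀ y, ρ i < dist y (x i) → w i y = 0 := by
  classical
  induction s using Finset.induction_on with
  | empty => exact ⟨fun _ => 0, fun _ _ => 0, by simp⟩
  | insert b s hb ih =>
    rw [Finset.sum_insert hb] at has
    have hab : 0 < a b := ha b (Finset.mem_insert_self _ _)
    obtain ⟨ρ, w, h1, h2, h3, h4, h5, h6, h7⟩ := ih (fun i hi => ha i (Finset.mem_insert_of_mem hi))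
      (by linarith)
    have hwint : ∀ i ∈ s, Integrable (w i) μ := fun i hi =>
      Integrable.of_bound (h2 i hi).aestronglyMeasurable 1 (Eventually.of_forall fun y => by
        rw [Real.norm_of_nonneg (h3 i hi y)]
        exact (Finset.single_le_sum (f := fun j => w j y) (fun j hj => h3 j hj y) hi).trans (h4 y))
    have hsum : Integrable (fun y => ∑ i ∈ s, w i y) μ := integrable_finsetSum s hwint
    -- Greedy choice: the new density is taken from the capacity `1 - ∑ w i` that the earlier ones
    -- leave. It uses up this capacity on its own ball, which is why the total becomes one there.
    obtain ⟨r, u, k1, k2, k3, k4, k5, k6, k7⟩ :=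
      exists_le_integral_eq (μ := μ) (v := fun y => 1 - ∑ i ∈ s, w i y)
        (measurable_const.sub (Finset.measurable_sum s h2)) (fun y => by linarith [h4 y])
        ((integrable_const 1).sub hsum) (x b) hab (by
          rw [integral_sub (integrable_const 1) hsum, integral_finsetSum s hwint,
            Finset.sum_congr rfl h5]
          simp
          linarith)
    have hne : ∀ i ∈ s, i ≠ b := fun i hi he => hb (he ▸ hi)
    have hs : ∀ y, ∑ i ∈ insert b s, Function.update w b u i y = u y + ∑ i ∈ s, w i y := by
      intro y
      rw [Finset.sum_insert hb, Function.update_self]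
      congr 1
      exact Finset.sum_congr rfl fun i hi => by rw [Function.update_of_ne (hne i hi)]
    refine ⟨Function.update ρ b r, Function.update w b u, ?_, ?_, ?_, ?_, ?_, ?_, ?_⟩
    · refine Finset.forall_mem_insert _ _ _ |>.2 ⟨by simpa using k1, fun i hi => ?_⟩
      rw [Function.update_of_ne (hne i hi)]
      exact h1 i hi
    · refine Finset.forall_mem_insert _ _ _ |>.2 ⟨by simpa using k2, fun i hi => ?_⟩
      rw [Function.update_of_ne (hne i hi)]
      exact h2 i hi
    · refine Finset.forall_mem_insert _ _ _ |>.2 ⟨by simpa using k3, fun i hi => ?_⟩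
      rw [Function.update_of_ne (hne i hi)]
      exact h3 i hi
    · intro y
      rw [hs]
      linarith [k4 y]
    · refine Finset.forall_mem_insert _ _ _ |>.2 ⟨by simpa using k5, fun i hi => ?_⟩
      rw [Function.update_of_ne (hne i hi)]
      exact h5 i hi
    · refine Finset.forall_mem_insert _ _ _ |>.2 ⟨?_, fun i hi => ?_⟩
      · intro y hy
        rw [Function.update_self] at hy
        rw [hs, k6 y hy]
        ring
      · intro y hy
        rw [Function.update_of_ne (hne i hi)] at hy
        rw [hs]
        have := h6 i hi y hy
        have := k3 y
        have := k4 y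
        linarith
    · refine Finset.forall_mem_insert _ _ _ |>.2 ⟨by simpa using k7, fun i hi => ?_⟩
      rw [Function.update_of_ne (hne i hi), Function.update_of_ne (hne i hi)]
      exact h7 i hi

end SingularIntegral


/-! ### The Hörmander condition and the dual estimate near an atom -/

namespace SingularIntegral

set_option linter.unusedSectionVars false

namespace IsCZKernel

variable {X : Type*} [MetricSpace X] [SecondCountableTopology X] [MeasurableSpace X]
  [BorelSpace X] {μ : Measure X} [IsFiniteMeasure μ] {K : X → X → ℝ} {h : ℝ → ℝ} {C : ℝ}

theorem measure_ball_le_mul (hK : IsCZKernel μ K h C) (n : ℕ) (x : X) {r : ℝ} (hr : 0 < r) :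
    μ (Metric.ball x (2 ^ n * r)) ≤ ENNReal.ofReal (C ^ n * h r) :=
  (hK.measure_ball_le x (by positivity)).trans
    (ENNReal.ofReal_le_ofReal (hK.le_pow_mul n hr))

/-- The Hörmander condition, uniformly for all truncations. -/
theorem lintegral_truncKernel_sub_le (hK : IsCZKernel μ K h C) {ε ρ : ℝ} (hε : 0 < ε) (hρ : 0 < ρ)
    {y z : X} (hyz : dist y z ≤ ρ) :
    ∫⁻ x in (Metric.ball y (3 * ρ))ᶜ, ‖truncKernel K ε x y - truncKernel K ε x z‖ₑ ∂μ
      ≤ ENNReal.ofReal (3 * C) := by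
  have hC := hK.nonneg_const
  have hhε := hK.pos _ hε
  -- If both kernel values survive the truncation, smoothness applies. If only one does, it is at
  -- most `1 / h ε`, and `ρ ≤ dist x y / 3` puts `x` within `2 * ε` of `y`.
  have hpt : ∀ x ∈ (Metric.ball y (3 * ρ))ᶜ, ‖truncKernel K ε x y - truncKernel K ε x z‖ₑ ≤
      ENNReal.ofReal (3 * ρ / (dist x y * h (dist x y))) +
        (Metric.ball y (2 * ε)).indicator (fun _ => ENNReal.ofReal (1 / h ε)) x := by
    intro x hx
    have hxy : 3 * ρ ≤ dist x y := by simpa using hx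
    have htri : dist x y ≤ dist x z + ρ := by
      have := dist_triangle x z y
      rw [dist_comm z y] at this
      linarith
    have htri' : dist x z ≤ dist x y + ρ := (dist_triangle x y z).trans (by linarith)
    have hxy0 : 0 < dist x y := by linarith
    have hxz0 : 0 < dist x z := by linarith
    rw [Real.enorm_eq_ofReal_abs]
    by_cases h1 : ε ≤ dist x y <;> by_cases h2 : ε ≤ dist x z
    · rw [truncKernel_of_le h1, truncKernel_of_le h2]
      refine le_trans (ENNReal.ofReal_le_ofReal ?_) le_self_add
      refine (hK.smooth x y z (dist_pos.1 hxy0) (dist_pos.1 hxz0).symm (by linarith)).trans ?_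
      have := hK.pos _ hxy0
      gcongr
      linarith
    · rw [truncKernel_of_le h1, truncKernel_of_lt (not_le.1 h2), sub_zero, indicator_of_mem]
      · exact (ENNReal.ofReal_le_ofReal (hK.abs_le hε h1)).trans le_add_self
      · simp only [Metric.mem_ball]
        linarith [not_le.1 h2]
    · rw [truncKernel_of_le h2, truncKernel_of_lt (not_le.1 h1), zero_sub, abs_neg,
        indicator_of_mem]
      · exact (ENNReal.ofReal_le_ofReal (hK.abs_le hε h2)).trans le_add_self
      · simp only [Metric.mem_ball]
        linarith [not_le.1 h1]
    · rw [truncKernel_of_lt (not_le.1 h1), truncKernel_of_lt (not_le.1 h2)]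
      simp
  calc ∫⁻ x in (Metric.ball y (3 * ρ))ᶜ, ‖truncKernel K ε x y - truncKernel K ε x z‖ₑ ∂μ
      ≤ ∫⁻ x in (Metric.ball y (3 * ρ))ᶜ,
          (ENNReal.ofReal (3 * ρ / (dist x y * h (dist x y))) +
          (Metric.ball y (2 * ε)).indicator (fun _ => ENNReal.ofReal (1 / h ε)) x) ∂μ :=
        setLIntegral_mono' Metric.isOpen_ball.measurableSet.compl hpt
    _ = ∫⁻ x in (Metric.ball y (3 * ρ))ᶜ, ENNReal.ofReal (3 * ρ / (dist x y * h (dist x y))) ∂μ +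
        ∫⁻ x in (Metric.ball y (3 * ρ))ᶜ,
          (Metric.ball y (2 * ε)).indicator (fun _ => ENNReal.ofReal (1 / h ε)) x ∂μ :=
        lintegral_add_right _ (measurable_const.indicator Metric.isOpen_ball.measurableSet)
    -- The annulus sum with `η = 1` gives `2 * C`; the ball of radius `2 * ε` costs one doubling
    -- step, hence another `C`.
    _ ≤ ENNReal.ofReal (2 * C * 1) + ENNReal.ofReal C := by
        refine add_le_add (hK.lintegral_compl_ball_le (by positivity) zero_le_one
          fun s hs => by simpa using hK.measure_ball_le y (by linarith)) ?_
        refine (setLIntegral_le_lintegral _ _).trans ?_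
        rw [lintegral_indicator_const Metric.isOpen_ball.measurableSet]
        calc ENNReal.ofReal (1 / h ε) * μ (Metric.ball y (2 * ε))
            ≤ ENNReal.ofReal (1 / h ε) * ENNReal.ofReal (C * h ε) := by
              gcongr
              simpa using hK.measure_ball_le_mul 1 y hε
          _ = ENNReal.ofReal C := by
              rw [← ENNReal.ofReal_mul (by positivity)]
              congr 1
              field_simp
    _ = ENNReal.ofReal (3 * C) := by
        rw [← ENNReal.ofReal_add (by positivity) (by positivity)]
        ring_nf

/-- A density near `u` is compared with the point mass at `u`. -/
theorem lintegral_mul_truncKernel_sub_truncated_le (hK : IsCZKernel μ K h C) {ε ρ : ℝ}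
    (hε : 0 < ε) (hρ : 0 < ρ) {u : X} {w : X → ℝ} (hw : Integrable w μ) (hw0 : ∀ y, 0 ≤ w y)
    (hwu : ∀ y, ρ < dist y u → w y = 0) :
    ∫⁻ x in (Metric.ball u (3 * ρ))ᶜ, ‖(∫ y, w y ∂μ) * truncKernel K ε x u - truncated μ K ε w x‖ₑ ∂μ
      ≤ ENNReal.ofReal (3 * C * ∫ y, w y ∂μ) := by
  have hC := hK.nonneg_const
  have hpt : ∀ x, ‖(∫ y, w y ∂μ) * truncKernel K ε x u - truncated μ K ε w x‖ₑ ≤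
      ∫⁻ y, ‖truncKernel K ε x u - truncKernel K ε x y‖ₑ * ‖w y‖ₑ ∂μ := by
    intro x
    have : (∫ y, w y ∂μ) * truncKernel K ε x u - truncated μ K ε w x =
        ∫ y, (truncKernel K ε x u - truncKernel K ε x y) * w y ∂μ := by
      rw [truncated_eq_integral, mul_comm, ← integral_const_mul,
        ← integral_sub (hw.const_mul _) (hK.integrable_truncKernel_mul hε x hw)]
      congr 1 with y
      ring
    rw [this]
    refine (enorm_integral_le_lintegral_enorm _).trans_eq ?_
    simp only [enorm_mul]
  have hm1 : Measurable (fun p : X × X => ‖truncKernel K ε p.1 u - truncKernel K ε p.1 p.2‖ₑ) :=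
    (((hK.measurable_truncKernel_left ε u).comp measurable_fst).sub
      (hK.measurable_truncKernel ε)).enorm
  calc ∫⁻ x in (Metric.ball u (3 * ρ))ᶜ,
        ‖(∫ y, w y ∂μ) * truncKernel K ε x u - truncated μ K ε w x‖ₑ ∂μ
      ≤ ∫⁻ x in (Metric.ball u (3 * ρ))ᶜ,
          ∫⁻ y, ‖truncKernel K ε x u - truncKernel K ε x y‖ₑ * ‖w y‖ₑ ∂μ ∂μ :=
        lintegral_mono hpt
    _ = ∫⁻ y, ∫⁻ x in (Metric.ball u (3 * ρ))ᶜ,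
          ‖truncKernel K ε x u - truncKernel K ε x y‖ₑ * ‖w y‖ₑ ∂μ ∂μ := by
        refine lintegral_lintegral_swap ?_
        exact hm1.aemeasurable.mul (hw.1.enorm.comp_snd)
    _ ≤ ∫⁻ y, ENNReal.ofReal (3 * C) * ‖w y‖ₑ ∂μ := by
        refine lintegral_mono fun y => ?_
        dsimp only
        rw [lintegral_mul_const' _ _ enorm_ne_top]
        rcases le_or_gt (dist y u) ρ with hy | hy
        · gcongr
          exact hK.lintegral_truncKernel_sub_le hε hρ (by rwa [dist_comm])
        · simp [hwu y hy]
    _ = ENNReal.ofReal (3 * C) * ENNReal.ofReal (∫ y, w y ∂μ) := by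
        rw [lintegral_const_mul'' _ hw.1.enorm,
          ofReal_integral_eq_lintegral_ofReal hw (Eventually.of_forall hw0)]
        congr 2 with y
        rw [Real.enorm_eq_ofReal_abs, abs_of_nonneg (hw0 y)]
    _ = ENNReal.ofReal (3 * C * ∫ y, w y ∂μ) := by
        rw [← ENNReal.ofReal_mul (by positivity)]

/-- Fubini moves the operator onto `ψ`. For `y` within `ρ` of `u`, points outside the ball of radius
`3 * ρ` around `u` have distance at least `2 * ρ` from `y`, so the restricted adjoint is minus a
truncation of `ψ` at the larger radius `max ε (2 * ρ)`, up to the points of that ball at this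
distance or more from `y`. The latter contribute at most `C`, by size and growth. The shift of the
radius keeps the error independent of `ε`. -/
theorem abs_integral_indicator_truncated_mul_le (hK : IsCZKernel μ K h C) {ε ρ : ℝ}
    (hε : 0 < ε) (hρ : 0 < ρ) {u : X} {w ψ : X → ℝ} (hw : Integrable w μ) (hw0 : ∀ y, 0 ≤ w y)
    (hwu : ∀ y, ρ < dist y u → w y = 0) (hψ : Integrable ψ μ) (hψ1 : ∀ x, |ψ x| ≤ 1) :
    |∫ x, ((Metric.ball u (3 * ρ))ᶜ.indicator (truncated μ K ε w) x) * ψ x ∂μ|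
      ≤ ∫ y, w y * (|truncated μ K (max ε (2 * ρ)) ψ y| + C) ∂μ := by
  have hC := hK.nonneg_const
  set ε' := max ε (2 * ρ) with hε'
  have hε'0 : 0 < ε' := hε.trans_le (le_max_left _ _)
  set S : Set X := (Metric.ball u (3 * ρ))ᶜ with hS
  have hSm : MeasurableSet S := Metric.isOpen_ball.measurableSet.compl
  set L : X → X → ℝ := fun x y => S.indicator (fun x => truncKernel K ε x y) x with hL
  have hLm : Measurable (Function.uncurry L) := by
    have : Function.uncurry L =
        (Prod.fst ⁻¹' S).indicator (Function.uncurry (truncKernel K ε)) := by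
      ext ⟨x, y⟩
      by_cases hx : x ∈ S
      · simp [hL, hx]
      · simp [hL, hx]
    rw [this]
    exact (hK.measurable_truncKernel ε).indicator (measurable_fst hSm)
  have hLb : ∀ x y, |L x y| ≤ 1 / h ε := fun x y => by
    by_cases hx : x ∈ S
    · simpa [hL, hx] using hK.abs_truncKernel_le hε x y
    · have := hK.pos _ hε
      simp only [hL, indicator_of_notMem hx, abs_zero]
      positivity
  have h1 : ∀ x, S.indicator (truncated μ K ε w) x = ∫ y, L x y * w y ∂μ := by
    intro x
    by_cases hx : x ∈ S
    · simp [hL, hx, truncated_eq_integral]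
    · simp [hL, hx]
  simp only [h1]
  rw [integral_integral_mul_swap hLm hLb hw hψ]
  have hTb : Integrable (truncated μ K ε' ψ) μ := hK.integrable_truncated hε'0 hψ
  have hTbd : ∀ y, ‖|truncated μ K ε' ψ y| + C‖ ≤ (∫ y, |ψ y| ∂μ) / h ε' + C := fun y => by
    rw [Real.norm_of_nonneg (by positivity)]
    gcongr
    exact hK.abs_truncated_le hε'0 y hψ
  refine (abs_integral_le_integral_abs).trans (integral_mono_of_nonneg
    (Eventually.of_forall fun y => abs_nonneg _) ?_ (Eventually.of_forall fun y => ?_))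
  · exact hw.mul_bdd (hTb.abs.add (integrable_const C)).1 (Eventually.of_forall hTbd)
  dsimp only
  rw [abs_mul, abs_of_nonneg (hw0 y), mul_comm]
  rcases lt_or_ge ρ (dist y u) with hy | hy
  · simp [hwu y hy]
  refine mul_le_mul_of_nonneg_left ?_ (hw0 y)
  set A : Set X := {x | dist x u < 3 * ρ ∧ ε' ≤ dist y x} with hA
  have hAm : MeasurableSet A :=
    (measurableSet_lt (measurable_id.dist measurable_const) measurable_const).inter
      (measurableSet_le measurable_const (measurable_const.dist measurable_id))
  have hsum : ∫ x, L x y * ψ x ∂μ = -truncated μ K ε' ψ y + ∫ x in A, K y x * ψ x ∂μ := by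
    have i1 : Integrable (fun x => L x y * ψ x) μ :=
      hψ.bdd_mul (c := 1 / h ε) (hLm.comp measurable_prodMk_right).aestronglyMeasurable
        (Eventually.of_forall fun x => hLb x y)
    rw [truncated_eq_integral, ← integral_indicator hAm, eq_neg_add_iff_add_eq,
      ← integral_add (hK.integrable_truncKernel_mul hε'0 y hψ) i1]
    congr 1 with x
    by_cases hx1 : x ∈ S
    · have hxu : 3 * ρ ≤ dist x u := by simpa [hS] using hx1
      have hxA : x ∉ A := fun hxA => absurd hxA.1 (not_lt.2 hxu)
      have hyx : 2 * ρ ≤ dist y x := by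
        have := dist_triangle x y u
        rw [dist_comm x y] at this
        linarith
      rw [indicator_of_notMem hxA]
      simp only [hL, indicator_of_mem hx1]
      by_cases hxε : ε ≤ dist y x
      · rw [truncKernel_of_le (max_le hxε hyx), truncKernel_of_le (by rwa [dist_comm]),
          hK.antisymm x y]
        ring
      · rw [truncKernel_of_lt ((not_le.1 hxε).trans_le (le_max_left _ _)),
          truncKernel_of_lt (by rw [dist_comm]; exact not_le.1 hxε)]
        ring
    · have hxu : dist x u < 3 * ρ := by simpa [hS] using hx1
      simp only [hL, indicator_of_notMem hx1]
      by_cases hxε : ε' ≤ dist y x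
      · rw [indicator_of_mem (show x ∈ A from ⟨hxu, hxε⟩), truncKernel_of_le hxε]
        ring
      · rw [indicator_of_notMem (fun hxA : x ∈ A => hxε hxA.2), truncKernel_of_lt (not_le.1 hxε)]
        ring
  have hA' : |∫ x in A, K y x * ψ x ∂μ| ≤ C := by
    have hpos := hK.pos (2 * ρ) (by positivity)
    -- Such points have distance between `2 * ρ` and `4 * ρ` from `y`, and `h (4 * ρ) ≤ C * h (2 *
    -- ρ)`.
    refine (hK.abs_setIntegral_le (ε := 2 * ρ) (by positivity) y hψ1
      (fun x hx => (le_max_right _ _).trans hx.2) (R := 2 * (2 * ρ)) (by positivity) ?_).trans ?_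
    · intro x hx
      have := dist_triangle x u y
      have h3 := hx.1
      rw [dist_comm u y] at this
      simp only [Metric.mem_ball]
      linarith
    · rw [one_mul, div_le_iff₀ hpos]
      exact hK.doubling _ (by positivity)
  rw [hsum]
  calc |-truncated μ K ε' ψ y + ∫ x in A, K y x * ψ x ∂μ|
      ≤ |-truncated μ K ε' ψ y| + |∫ x in A, K y x * ψ x ∂μ| := abs_add_le _ _
    _ ≤ _ := by rw [abs_neg]; gcongr

end IsCZKernel

end SingularIntegral


/-! ### Weak type inequality for finite sums of atoms -/

namespace SingularIntegral

set_option linter.unusedSectionVars false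

variable {X : Type*} [MetricSpace X] [SecondCountableTopology X] [MeasurableSpace X]
  [BorelSpace X] {μ : Measure X} [IsFiniteMeasure μ] {K : X → X → ℝ} {h : ℝ → ℝ} {C : ℝ}

/-- The maximal operator of the kernel is bounded in `L²` with constant `C₀`. -/
def MaximalBound (μ : Measure X) (K : X → X → ℝ) (C₀ : ℝ≥0) : Prop :=
  ∀ f : X → ℝ, MemLp f 2 μ →
    ∫⁻ x, maximal μ K f x ^ 2 ∂μ ≤ C₀ * ∫⁻ x, ENNReal.ofReal (f x ^ 2) ∂μ

theorem ofReal_abs_truncated_le_maximal {ε : ℝ} (hε : 0 < ε) (f : X → ℝ) (x : X) :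
    ENNReal.ofReal |truncated μ K ε f x| ≤ maximal μ K f x :=
  le_iSup₂ (f := fun (ε : ℝ) (_ : 0 < ε) => ENNReal.ofReal |truncated μ K ε f x|) ε hε

theorem memLp_two_of_bound {f : X → ℝ} (hf : AEStronglyMeasurable f μ) {M : ℝ}
    (hM : ∀ x, |f x| ≤ M) : MemLp f 2 μ :=
  MemLp.of_bound hf M (Eventually.of_forall hM)

namespace IsCZKernel

/-- Each density has its own truncation radius, but all the truncations are dominated by the maximal
function of `ψ`. The bound follows from `m ≤ l / 2 + m ^ 2 / (2 * l)`, integrated against a weight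
between 0 and 1; the free parameter `l` later allows the last term to be absorbed. -/
theorem integral_mul_le_of_sum_le_one (hK : IsCZKernel μ K h C) {C₀ : ℝ≥0}
    (hT : MaximalBound μ K C₀) {ι : Type*} (s : Finset ι) (w : ι → X → ℝ) (ε : ι → ℝ)
    (hε : ∀ i ∈ s, 0 < ε i)
    (hwm : ∀ i ∈ s, Measurable (w i)) (hw0 : ∀ i ∈ s, ∀ y, 0 ≤ w i y)
    (hw1 : ∀ y, ∑ i ∈ s, w i y ≤ 1) {ψ : X → ℝ} (hψ : AEStronglyMeasurable ψ μ)
    (hψ1 : ∀ x, |ψ x| ≤ 1) {l : ℝ} (hl : 0 < l) :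
    ∑ i ∈ s, ∫ y, w i y * |truncated μ K (ε i) ψ y| ∂μ ≤
      l / 2 * ∑ i ∈ s, ∫ y, w i y ∂μ + C₀ / (2 * l) * ∫ y, ψ y ^ 2 ∂μ := by
  classical
  have hψi : Integrable ψ μ := Integrable.of_bound hψ 1 (Eventually.of_forall hψ1)
  -- A finite supremum replaces the maximal function, so that measurability and integrability are
  -- immediate.
  set m : X → ℝ≥0 := fun y => s.sup fun i => ‖truncated μ K (ε i) ψ y‖₊ with hm
  have hmle : ∀ i ∈ s, ∀ y, |truncated μ K (ε i) ψ y| ≤ m y := fun i hi y => by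
    have : ‖truncated μ K (ε i) ψ y‖₊ ≤ m y :=
      Finset.le_sup (f := fun i => ‖truncated μ K (ε i) ψ y‖₊) hi
    exact_mod_cast this
  have hmm : Measurable m := by
    rw [hm]
    clear hw1 hmle hm m
    induction s using Finset.induction_on with
    | empty => simp
    | insert b s hb ih =>
      simp only [Finset.sup_insert]
      refine Measurable.sup (hK.measurable_truncated _ hψ).nnnorm (ih ?_ ?_ ?_)
      · exact fun i hi => hε i (Finset.mem_insert_of_mem hi)
      · exact fun i hi => hwm i (Finset.mem_insert_of_mem hi)
      · exact fun i hi => hw0 i (Finset.mem_insert_of_mem hi)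
  have hmb : ∃ M : ℝ≥0, ∀ y, m y ≤ M := by
    refine ⟨s.sup fun i => Real.toNNReal ((∫ y, |ψ y| ∂μ) / h (ε i)), fun y => ?_⟩
    refine Finset.sup_mono_fun fun i hi => ?_
    rw [← NNReal.coe_le_coe]
    exact (hK.abs_truncated_le (hε i hi) y hψi).trans (Real.le_coe_toNNReal _)
  obtain ⟨M, hM⟩ := hmb
  have hm2i : Integrable (fun y => (m y : ℝ) ^ 2) μ :=
    Integrable.of_bound (hmm.coe_nnreal_real.pow_const 2).aestronglyMeasurable ((M : ℝ) ^ 2)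
      (Eventually.of_forall fun y => by
        rw [Real.norm_of_nonneg (by positivity)]
        have : (m y : ℝ) ≤ M := by exact_mod_cast hM y
        gcongr)
  have hψ2i : Integrable (fun y => ψ y ^ 2) μ :=
    Integrable.of_bound (hψ.pow 2) 1 (Eventually.of_forall fun y => by
      rw [Real.norm_of_nonneg (by positivity), ← sq_abs]
      exact pow_le_one₀ (abs_nonneg _) (hψ1 y))
  have hm2 : ∫ y, (m y : ℝ) ^ 2 ∂μ ≤ C₀ * ∫ y, ψ y ^ 2 ∂μ := by
    have h1 : ∫⁻ y, ENNReal.ofReal ((m y : ℝ) ^ 2) ∂μ ≤ C₀ * ∫⁻ x, ENNReal.ofReal (ψ x ^ 2) ∂μ := by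
      refine (lintegral_mono fun y => ?_).trans (hT ψ (memLp_two_of_bound hψ hψ1))
      rw [ENNReal.ofReal_pow (NNReal.coe_nonneg _), ENNReal.ofReal_coe_nnreal]
      gcongr
      rw [hm, ENNReal.coe_finset_sup]
      refine Finset.sup_le fun i hi => ?_
      refine le_trans (le_of_eq ?_) (ofReal_abs_truncated_le_maximal (hε i hi) ψ y)
      rw [← Real.enorm_eq_ofReal_abs]
      rfl
    rw [← ofReal_integral_eq_lintegral_ofReal hm2i (Eventually.of_forall fun y => by positivity),
      ← ofReal_integral_eq_lintegral_ofReal hψ2i (Eventually.of_forall fun y => by positivity),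
      ← ENNReal.ofReal_coe_nnreal, ← ENNReal.ofReal_mul (by positivity)] at h1
    refine (ENNReal.ofReal_le_ofReal_iff ?_).1 h1
    have : 0 ≤ ∫ y, ψ y ^ 2 ∂μ := integral_nonneg fun y => by positivity
    positivity
  have hwi1 : ∀ i ∈ s, ∀ y, w i y ≤ 1 := fun i hi y =>
    (Finset.single_le_sum (f := fun j => w j y) (fun j hj => hw0 j hj y) hi).trans (hw1 y)
  have hwint : ∀ i ∈ s, Integrable (w i) μ := fun i hi =>
    Integrable.of_bound (hwm i hi).aestronglyMeasurable 1 (Eventually.of_forall fun y => by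
      rw [Real.norm_of_nonneg (hw0 i hi y)]
      exact hwi1 i hi y)
  have hint : ∀ i ∈ s, Integrable (fun y => w i y * |truncated μ K (ε i) ψ y|) μ := fun i hi =>
    (hwint i hi).mul_bdd (c := (∫ y, |ψ y| ∂μ) / h (ε i))
      (hK.measurable_truncated _ hψ).abs.aestronglyMeasurable
      (Eventually.of_forall fun y => by
        rw [Real.norm_of_nonneg (abs_nonneg _)]
        exact hK.abs_truncated_le (hε i hi) y hψi)
  have hsumi : Integrable (fun y => ∑ i ∈ s, w i y) μ := integrable_finsetSum s hwint
  calc ∑ i ∈ s, ∫ y, w i y * |truncated μ K (ε i) ψ y| ∂μ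
      = ∫ y, ∑ i ∈ s, w i y * |truncated μ K (ε i) ψ y| ∂μ := (integral_finsetSum s hint).symm
    _ ≤ ∫ y, (l / 2 * ∑ i ∈ s, w i y + 1 / (2 * l) * (m y : ℝ) ^ 2) ∂μ := by
        refine integral_mono (integrable_finsetSum s hint)
          ((hsumi.const_mul _).add (hm2i.const_mul _)) fun y => ?_
        have h1 : ∑ i ∈ s, w i y * |truncated μ K (ε i) ψ y| ≤ (∑ i ∈ s, w i y) * m y := by
          rw [Finset.sum_mul]
          exact Finset.sum_le_sum fun i hi => mul_le_mul_of_nonneg_left (hmle i hi y) (hw0 i hi y)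
        have h2 : 0 ≤ ∑ i ∈ s, w i y := Finset.sum_nonneg fun i hi => hw0 i hi y
        have h3 := hw1 y
        set S := ∑ i ∈ s, w i y
        have h4 : (m y : ℝ) ≤ l / 2 + 1 / (2 * l) * (m y : ℝ) ^ 2 := by
          rw [← sub_nonneg]
          have : l / 2 + 1 / (2 * l) * (m y : ℝ) ^ 2 - m y = (l - m y) ^ 2 / (2 * l) := by
            field_simp
            ring
          rw [this]
          positivity
        have h5 : 0 ≤ 1 / (2 * l) * (m y : ℝ) ^ 2 := by positivity
        dsimp only
        calc _ ≤ S * m y := h1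
          _ ≤ S * (l / 2 + 1 / (2 * l) * (m y : ℝ) ^ 2) := by gcongr
          _ ≤ _ := by nlinarith
    _ = l / 2 * ∑ i ∈ s, ∫ y, w i y ∂μ + 1 / (2 * l) * ∫ y, (m y : ℝ) ^ 2 ∂μ := by
        rw [integral_add (hsumi.const_mul _) (hm2i.const_mul _), integral_const_mul,
          integral_const_mul, integral_finsetSum s hwint]
    _ ≤ l / 2 * ∑ i ∈ s, ∫ y, w i y ∂μ + 1 / (2 * l) * (C₀ * ∫ y, ψ y ^ 2 ∂μ) := by gcongr
    _ = _ := by ring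

/-- The weak type inequality for sums of point masses, uniformly for all truncations. -/
theorem measure_sum_atoms_le (hK : IsCZKernel μ K h C) {C₀ : ℝ≥0} (hT : MaximalBound μ K C₀)
    {ε : ℝ} (hε : 0 < ε) {ι : Type*} (s : Finset ι) (u : ι → X) (a : ι → ℝ)
    (ha : ∀ i ∈ s, 0 < a i) :
    μ {x | 2 < |∑ i ∈ s, a i * truncKernel K ε x (u i)|} ≤
      ENNReal.ofReal ((1 + (C ^ 2 + 3 * C) + 2 * (C₀ + 1 + 2 * C)) * ∑ i ∈ s, a i) := by
  have hC := hK.nonneg_const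
  have := hK.nullSingletonClass
  set A := ∑ i ∈ s, a i with hA
  have hA0 : 0 ≤ A := Finset.sum_nonneg fun i hi => (ha i hi).le
  -- If the atoms outweigh the space, there is no room for the densities, but then the claim is
  -- trivial. The summand 1 of the constant covers this case, as well as the exceptional set in the
  -- other one.
  rcases le_or_gt (μ.real univ) A with hle | hlt
  · refine (measure_mono (subset_univ _)).trans ?_
    rw [← ofReal_measureReal]
    refine ENNReal.ofReal_le_ofReal (hle.trans ?_)
    have : 0 ≤ (C ^ 2 + 3 * C) + 2 * (C₀ + 1 + 2 * C) := by positivity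
    nlinarith
  obtain ⟨ρ, w, h1, h2, h3, h4, h5, h6, h7⟩ := exists_disjoint_densities s u a ha hlt
  have hwint : ∀ i ∈ s, Integrable (w i) μ := fun i hi =>
    Integrable.of_bound (h2 i hi).aestronglyMeasurable 1 (Eventually.of_forall fun y => by
      rw [Real.norm_of_nonneg (h3 i hi y)]
      exact (Finset.single_le_sum (f := fun j => w j y) (fun j hj => h3 j hj y) hi).trans (h4 y))
  set E : Set X := ⋃ i ∈ s, Metric.ball (u i) (ρ i) with hE
  have hEm : MeasurableSet E :=
    Finset.measurableSet_biUnion s fun i _ => Metric.isOpen_ball.measurableSet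
  set D : ι → Set X := fun i => Metric.ball (u i) (3 * ρ i) with hD
  have hDm : ∀ i, MeasurableSet (D i) := fun i => Metric.isOpen_ball.measurableSet
  set G : X → ℝ := fun x => ∑ i ∈ s, (D i)ᶜ.indicator (truncated μ K ε (w i)) x with hG
  -- Three regions for each atom: the saturated ball is discarded, `R₁` is the atom alone in the
  -- shell from `ρ` to `3 * ρ`, where the size bound suffices, and `R₂` is the difference of atom
  -- and density farther out, where the Hörmander condition applies.
  set R₁ : ι → X → ℝ := fun i => (D i \ Metric.ball (u i) (ρ i)).indicator
    (fun x => a i * truncKernel K ε x (u i)) with hR₁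
  set R₂ : ι → X → ℝ := fun i => (D i)ᶜ.indicator
    (fun x => a i * truncKernel K ε x (u i) - truncated μ K ε (w i) x) with hR₂
  have hTm : ∀ i ∈ s, Measurable (truncated μ K ε (w i)) := fun i hi =>
    hK.measurable_truncated ε (hwint i hi).1
  have hGm : Measurable G := Finset.measurable_sum s fun i hi => (hTm i hi).indicator (hDm i).compl
  -- the mass of the exceptional set
  have hEμ : μ E ≤ ENNReal.ofReal A := by
    have hsum : Integrable (fun y => ∑ i ∈ s, w i y) μ := integrable_finsetSum s hwint
    have hAint : A = ∫ y, ∑ i ∈ s, w i y ∂μ := by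
      rw [integral_finsetSum s hwint, hA]
      exact Finset.sum_congr rfl fun i hi => (h5 i hi).symm
    rw [hAint, ofReal_integral_eq_lintegral_ofReal hsum (Eventually.of_forall fun y =>
      Finset.sum_nonneg fun i hi => h3 i hi y), ← lintegral_indicator_one hEm]
    refine lintegral_mono fun y => ?_
    by_cases hy : y ∈ E
    · obtain ⟨i, hi, hyi⟩ := mem_iUnion₂.1 hy
      simp [hy, h6 i hi y hyi]
    · simp [hy]
  -- the decomposition off the exceptional set
  have hdec : ∀ x ∉ E, ∑ i ∈ s, a i * truncKernel K ε x (u i) =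
      ∑ i ∈ s, (R₁ i x + R₂ i x) + G x := by
    intro x hx
    rw [hG, ← Finset.sum_add_distrib]
    refine Finset.sum_congr rfl fun i hi => ?_
    by_cases hxD : x ∈ D i
    · have hxb : x ∉ Metric.ball (u i) (ρ i) := fun hxb => hx (mem_iUnion₂.2 ⟨i, hi, hxb⟩)
      have k1 : x ∈ D i \ Metric.ball (u i) (ρ i) := ⟨hxD, hxb⟩
      have k2 : x ∉ (D i)ᶜ := fun hx => hx hxD
      simp only [hR₁, hR₂, indicator_of_mem k1, indicator_of_notMem k2, add_zero]
    · have k1 : x ∉ D i \ Metric.ball (u i) (ρ i) := fun hx => hxD hx.1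
      have k2 : x ∈ (D i)ᶜ := hxD
      simp only [hR₁, hR₂, indicator_of_mem k2, indicator_of_notMem k1, zero_add,
        sub_add_cancel]
  have hR₁int : ∀ i ∈ s, ∫⁻ x, ‖R₁ i x‖ₑ ∂μ ≤ ENNReal.ofReal (C ^ 2 * a i) := by
    intro i hi
    have hρ := h1 i hi
    have hpos := hK.pos _ hρ
    have hai := ha i hi
    calc ∫⁻ x, ‖R₁ i x‖ₑ ∂μ
        ≤ ∫⁻ x, (Metric.ball (u i) (2 ^ 2 * ρ i)).indicator
            (fun _ => ENNReal.ofReal (a i / h (ρ i))) x ∂μ := by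
          refine lintegral_mono fun x => ?_
          by_cases hx : x ∈ D i \ Metric.ball (u i) (ρ i)
          · have hx1 : dist x (u i) < 3 * ρ i := hx.1
            have hx2 : ρ i ≤ dist x (u i) := by simpa using hx.2
            rw [indicator_of_mem (show x ∈ Metric.ball (u i) (2 ^ 2 * ρ i) by
              simp only [Metric.mem_ball]; linarith)]
            simp only [hR₁, indicator_of_mem hx]
            rw [Real.enorm_eq_ofReal_abs, abs_mul, abs_of_pos hai, div_eq_mul_one_div]
            refine ENNReal.ofReal_le_ofReal (mul_le_mul_of_nonneg_left ?_ hai.le)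
            by_cases hxε : ε ≤ dist x (u i)
            · rw [truncKernel_of_le hxε]
              exact hK.abs_le hρ hx2
            · rw [truncKernel_of_lt (not_le.1 hxε), abs_zero]
              positivity
          · simp [hR₁, hx]
      _ = ENNReal.ofReal (a i / h (ρ i)) * μ (Metric.ball (u i) (2 ^ 2 * ρ i)) :=
          lintegral_indicator_const Metric.isOpen_ball.measurableSet _
      _ ≤ ENNReal.ofReal (a i / h (ρ i)) * ENNReal.ofReal (C ^ 2 * h (ρ i)) := by
          gcongr
          exact hK.measure_ball_le_mul 2 _ hρ
      _ = ENNReal.ofReal (C ^ 2 * a i) := by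
          rw [← ENNReal.ofReal_mul (by positivity)]
          congr 1
          field_simp
  have hR₂int : ∀ i ∈ s, ∫⁻ x, ‖R₂ i x‖ₑ ∂μ ≤ ENNReal.ofReal (3 * C * a i) := by
    intro i hi
    have := hK.lintegral_mul_truncKernel_sub_truncated_le hε (h1 i hi) (hwint i hi) (h3 i hi)
      (h7 i hi)
    rw [h5 i hi, ← lintegral_indicator (hDm i).compl] at this
    refine le_trans (lintegral_mono fun x => ?_) this
    by_cases hx : x ∈ (D i)ᶜ
    · rw [indicator_of_mem (show x ∈ (Metric.ball (u i) (3 * ρ i))ᶜ from hx)]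
      simp only [hR₂, indicator_of_mem hx, le_refl]
    · simp only [hR₂, indicator_of_notMem hx, enorm_zero, zero_le]
  have hR₁m : ∀ i, Measurable (R₁ i) := fun i =>
    ((hK.measurable_truncKernel_left ε (u i)).const_mul _).indicator
      ((hDm i).diff Metric.isOpen_ball.measurableSet)
  have hR₂m : ∀ i ∈ s, Measurable (R₂ i) := fun i hi =>
    (((hK.measurable_truncKernel_left ε (u i)).const_mul _).sub (hTm i hi)).indicator (hDm i).compl
  have hRμ : μ {x | 1 < |∑ i ∈ s, (R₁ i x + R₂ i x)|} ≤
      ENNReal.ofReal ((C ^ 2 + 3 * C) * A) := by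
    calc μ {x | 1 < |∑ i ∈ s, (R₁ i x + R₂ i x)|}
        ≤ μ {x | 1 ≤ ‖∑ i ∈ s, (R₁ i x + R₂ i x)‖ₑ} := by
          refine measure_mono fun x hx => ?_
          have hx' : 1 < |∑ i ∈ s, (R₁ i x + R₂ i x)| := hx
          simp only [mem_ofPred_eq, Real.enorm_eq_ofReal_abs]
          rw [← ENNReal.ofReal_one]
          exact ENNReal.ofReal_le_ofReal hx'.le
      _ ≤ ∫⁻ x, ‖∑ i ∈ s, (R₁ i x + R₂ i x)‖ₑ ∂μ := by
          have hm : Measurable fun x => ‖∑ i ∈ s, (R₁ i x + R₂ i x)‖ₑ :=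
            (Finset.measurable_sum s fun i hi => (hR₁m i).add (hR₂m i hi)).enorm
          simpa using mul_meas_ge_le_lintegral hm 1
      _ ≤ ∫⁻ x, ∑ i ∈ s, (‖R₁ i x‖ₑ + ‖R₂ i x‖ₑ) ∂μ := by
          refine lintegral_mono fun x => (enorm_sum_le _ _).trans ?_
          exact Finset.sum_le_sum fun i _ => enorm_add_le _ _
      _ = ∑ i ∈ s, (∫⁻ x, ‖R₁ i x‖ₑ ∂μ + ∫⁻ x, ‖R₂ i x‖ₑ ∂μ) := by
          refine (lintegral_finsetSum' (f := fun i x => ‖R₁ i x‖ₑ + ‖R₂ i x‖ₑ) s fun i hi =>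
            ((hR₁m i).enorm.add (hR₂m i hi).enorm).aemeasurable).trans ?_
          exact Finset.sum_congr rfl fun i _ => lintegral_add_left (hR₁m i).enorm _
      _ ≤ ∑ i ∈ s, ENNReal.ofReal ((C ^ 2 + 3 * C) * a i) := by
          refine Finset.sum_le_sum fun i hi => ?_
          have hai := (ha i hi).le
          rw [add_mul, ENNReal.ofReal_add (by positivity) (by positivity)]
          exact add_le_add (hR₁int i hi) (hR₂int i hi)
      _ = ENNReal.ofReal ((C ^ 2 + 3 * C) * A) := by
          rw [← ENNReal.ofReal_sum_of_nonneg fun i hi => by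
            have hai := (ha i hi).le
            positivity, hA, Finset.mul_sum]
  -- the duality estimate for the main term
  have hpair : ∀ ψ : X → ℝ, Measurable ψ → (∀ x, |ψ x| ≤ 1) →
      |∫ x, G x * ψ x ∂μ| ≤ (C₀ + 1) / 2 * A + C₀ / (2 * (C₀ + 1)) * ∫ y, ψ y ^ 2 ∂μ + C * A := by
    intro ψ hψ hψ1
    have hψi : Integrable ψ μ :=
      Integrable.of_bound hψ.aestronglyMeasurable 1 (Eventually.of_forall hψ1)
    have hTi : ∀ i ∈ s, Integrable (fun x => (D i)ᶜ.indicator (truncated μ K ε (w i)) x * ψ x) μ :=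
      fun i hi => ((hK.integrable_truncated hε (hwint i hi)).indicator (hDm i).compl).mul_bdd (c := 1)
        hψ.aestronglyMeasurable (Eventually.of_forall hψ1)
    have hwT : ∀ i ∈ s, Integrable
        (fun y => w i y * |truncated μ K (max ε (2 * ρ i)) ψ y|) μ := fun i hi => by
      have hm : 0 < max ε (2 * ρ i) := hε.trans_le (le_max_left _ _)
      refine (hwint i hi).mul_bdd (c := (∫ y, |ψ y| ∂μ) / h (max ε (2 * ρ i)))
        (hK.measurable_truncated _ hψ.aestronglyMeasurable).abs.aestronglyMeasurable
        (Eventually.of_forall fun y => ?_)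
      rw [Real.norm_of_nonneg (abs_nonneg _)]
      exact hK.abs_truncated_le hm y hψi
    -- With `l = C₀ + 1` the coefficient of `∫ ψ ^ 2` is at most one half. For an indicator `ψ`,
    -- half of the measure of the set can then be absorbed into the left side.
    have hl : (0 : ℝ) < C₀ + 1 := by positivity
    have key := hK.integral_mul_le_of_sum_le_one hT s w (fun i => max ε (2 * ρ i))
      (fun i _ => hε.trans_le (le_max_left _ _)) h2 h3 h4 hψ.aestronglyMeasurable hψ1 hl
    have hAw : ∑ i ∈ s, ∫ y, w i y ∂μ = A := Finset.sum_congr rfl h5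
    rw [hAw] at key
    calc |∫ x, G x * ψ x ∂μ|
        = |∑ i ∈ s, ∫ x, (D i)ᶜ.indicator (truncated μ K ε (w i)) x * ψ x ∂μ| := by
          rw [← integral_finsetSum s hTi]
          simp only [hG, Finset.sum_mul]
      _ ≤ ∑ i ∈ s, |∫ x, (D i)ᶜ.indicator (truncated μ K ε (w i)) x * ψ x ∂μ| :=
          Finset.abs_sum_le_sum_abs _ _
      _ ≤ ∑ i ∈ s, ∫ y, w i y * (|truncated μ K (max ε (2 * ρ i)) ψ y| + C) ∂μ :=
          Finset.sum_le_sum fun i hi => hK.abs_integral_indicator_truncated_mul_le hε (h1 i hi)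
            (hwint i hi) (h3 i hi) (h7 i hi) hψi hψ1
      _ = ∑ i ∈ s, ∫ y, w i y * |truncated μ K (max ε (2 * ρ i)) ψ y| ∂μ + C * A := by
          rw [hA, Finset.mul_sum, ← Finset.sum_add_distrib]
          refine Finset.sum_congr rfl fun i hi => ?_
          simp only [mul_add]
          rw [integral_add (hwT i hi) ((hwint i hi).mul_const C), integral_mul_const, h5 i hi,
            mul_comm C]
      _ ≤ _ := by gcongr
  have hhalf : (C₀ : ℝ) / (2 * (C₀ + 1)) ≤ 1 / 2 := by
    rw [div_le_div_iff₀ (by positivity) (by positivity)]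
    nlinarith [C₀.coe_nonneg]
  have hGi : Integrable G μ := integrable_finsetSum s fun i hi =>
    (hK.integrable_truncated hε (hwint i hi)).indicator (hDm i).compl
  have hset : ∀ F : Set X, MeasurableSet F → μ.real F ≤ |∫ x, G x * F.indicator 1 x ∂μ| →
      μ F ≤ ENNReal.ofReal ((C₀ + 1 + 2 * C) * A) := by
    intro F hF hle
    have hp := hpair (F.indicator 1) (measurable_one.indicator hF) fun x => by
      by_cases hx : x ∈ F <;> simp [hx]
    have hsq : ∫ y, (F.indicator (1 : X → ℝ) y) ^ 2 ∂μ = μ.real F := by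
      rw [← integral_indicator_one hF]
      congr 1 with y
      by_cases hy : y ∈ F <;> simp [hy]
    rw [hsq] at hp
    rw [← ofReal_measureReal]
    refine ENNReal.ofReal_le_ofReal ?_
    have h0 : 0 ≤ μ.real F := measureReal_nonneg
    have : (C₀ : ℝ) / (2 * (C₀ + 1)) * μ.real F ≤ 1 / 2 * μ.real F := by gcongr
    linarith
  have hmul : ∀ F : Set X, ∀ x, G x * F.indicator (1 : X → ℝ) x = F.indicator G x := by
    intro F x
    by_cases hx : x ∈ F <;> simp [hx]
  have hG1 : μ {x | 1 < G x} ≤ ENNReal.ofReal ((C₀ + 1 + 2 * C) * A) := by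
    have hF : MeasurableSet {x | 1 < G x} := measurableSet_lt measurable_const hGm
    refine hset _ hF (le_trans ?_ (le_abs_self _))
    simp only [hmul]
    rw [← integral_indicator_one hF]
    refine integral_mono ((integrable_const (1 : ℝ)).indicator hF) (hGi.indicator hF) fun x => ?_
    by_cases hx : 1 < G x
    · simpa [indicator, hx] using hx.le
    · simp [indicator, hx]
  have hG2 : μ {x | G x < -1} ≤ ENNReal.ofReal ((C₀ + 1 + 2 * C) * A) := by
    have hF : MeasurableSet {x | G x < -1} := measurableSet_lt hGm measurable_const
    refine hset _ hF (le_trans ?_ (neg_le_abs _))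
    simp only [hmul]
    rw [← integral_indicator_one hF, ← integral_neg]
    refine integral_mono ((integrable_const (1 : ℝ)).indicator hF) (hGi.indicator hF).neg
      fun x => ?_
    by_cases hx : G x < -1
    · simp [indicator, hx]
      linarith
    · simp [indicator, hx]
  -- Where the sum of the atoms exceeds 2 in modulus and `x` lies off `E`, either the error terms or
  -- `G` exceed 1 in modulus. The sign of `G` is treated by two separate test sets.
  have hfin : {x | 2 < |∑ i ∈ s, a i * truncKernel K ε x (u i)|} ⊆
      (E ∪ {x | 1 < |∑ i ∈ s, (R₁ i x + R₂ i x)|}) ∪ ({x | 1 < G x} ∪ {x | G x < -1}) := by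
    intro x hx
    by_contra hcon
    simp only [mem_union, mem_ofPred_eq, not_or, not_lt] at hcon
    obtain ⟨⟨c1, c2⟩, c3, c4⟩ := hcon
    have hx' : 2 < |∑ i ∈ s, a i * truncKernel K ε x (u i)| := hx
    rw [hdec x c1] at hx'
    have := abs_add_le (∑ i ∈ s, (R₁ i x + R₂ i x)) (G x)
    have : |G x| ≤ 1   := _root_.abs_le.2 ⟨c4, c3⟩
    linarith
  calc μ {x | 2 < |∑ i ∈ s, a i * truncKernel K ε x (u i)|}
      ≤ (ENNReal.ofReal A + ENNReal.ofReal ((C ^ 2 + 3 * C) * A)) +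
        (ENNReal.ofReal ((C₀ + 1 + 2 * C) * A) + ENNReal.ofReal ((C₀ + 1 + 2 * C) * A)) := by
        refine (measure_mono hfin).trans ((measure_union_le _ _).trans ?_)
        gcongr
        · exact (measure_union_le _ _).trans (add_le_add hEμ hRμ)
        · exact (measure_union_le _ _).trans (add_le_add hG1 hG2)
    _ = _ := by
        rw [← ENNReal.ofReal_add (by positivity) (by positivity),
          ← ENNReal.ofReal_add (by positivity) (by positivity),
          ← ENNReal.ofReal_add (by positivity) (by positivity)]
        congr 1
        ring

end IsCZKernel

end SingularIntegral


/-! ### Weak type inequality for integrable functions -/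

namespace SingularIntegral

set_option linter.unusedSectionVars false

namespace IsCZKernel

variable {X : Type*} [MetricSpace X] [SecondCountableTopology X] [MeasurableSpace X]
  [BorelSpace X] {μ : Measure X} [IsFiniteMeasure μ] {K : X → X → ℝ} {h : ℝ → ℝ} {C : ℝ}

theorem truncated_sum (hK : IsCZKernel μ K h C) {ε : ℝ} (hε : 0 < ε) {ι : Type*} (s : Finset ι)
    {f : ι → X → ℝ} (hf : ∀ i ∈ s, Integrable (f i) μ) (x : X) :
    truncated μ K ε (fun y => ∑ i ∈ s, f i y) x = ∑ i ∈ s, truncated μ K ε (f i) x := by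
  simp only [truncated_eq_integral, Finset.mul_sum]
  exact integral_finsetSum s fun i hi => hK.integrable_truncKernel_mul hε x (hf i hi)

/-- The function is cut along countably many cells, each within `ε / 4` of a point, and each piece
is compared with an atom of the same mass at that point. The cost is `3 * C` times the mass by the
Hörmander condition. The level 4 is made up of 2 for the atoms, 1 for the comparison, and 1 for the
cells left out of a finite sum. -/
theorem exists_measure_lt_abs_truncated_le_of_nonneg (hK : IsCZKernel μ K h C) {C₀ : ℝ≥0}
    (hT : MaximalBound μ K C₀) :
    ∃ B : ℝ, 0 ≤ B ∧ ∀ (ε : ℝ) (f : X → ℝ), 0 < ε → Integrable f μ → (∀ y, 0 ≤ f y) →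
      μ {x | 4 < |truncated μ K ε f x|} ≤ ENNReal.ofReal (B * ∫ y, f y ∂μ) := by
  classical
  have hC := hK.nonneg_const
  set B₀ : ℝ := 1 + (C ^ 2 + 3 * C) + 2 * (C₀ + 1 + 2 * C) with hB₀
  have hB₀0 : 0 ≤ B₀ := by positivity
  refine ⟨B₀ + 3 * C, by positivity, fun ε f hε hf hf0 => ?_⟩
  rcases isEmpty_or_nonempty X with hX | hX
  · simp [Subsingleton.elim {x | 4 < |truncated μ K ε f x|} ∅]
  have hρ : 0 < ε / 4 := by positivity
  set u : ℕ → X := TopologicalSpace.denseSeq X with hu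
  set V : ℕ → Set X := fun n => Metric.ball (u n) (ε / 4) with hV
  set P : ℕ → Set X := disjointed V with hP
  have hPV : ∀ n, P n ⊆ V n := disjointed_subset V
  have hPm : ∀ n, MeasurableSet (P n) := fun n =>
    MeasurableSet.disjointed (fun n => Metric.isOpen_ball.measurableSet) n
  have hPd : Pairwise (Function.onFun Disjoint P) := disjoint_disjointed V
  have hPU : ⋃ n, P n = univ := by
    rw [hP, iUnion_disjointed, eq_univ_iff_forall]
    intro x
    obtain ⟨y, hy, n, rfl⟩ :=
      Metric.dense_iff.1 (TopologicalSpace.denseRange_denseSeq X) x (ε / 4) hρ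
    exact mem_iUnion.2 ⟨n, Metric.mem_ball_comm.1 hy⟩
  set w : ℕ → X → ℝ := fun n => (P n).indicator f with hw
  have hwi : ∀ n, Integrable (w n) μ := fun n => hf.indicator (hPm n)
  have hw0 : ∀ n y, 0 ≤ w n y := fun n y => indicator_nonneg (fun y _ => hf0 y) y
  have hwu : ∀ n y, ε / 4 < dist y (u n) → w n y = 0 := fun n y hy =>
    indicator_of_notMem (fun hyP => absurd (hPV n hyP) (by simpa [hV] using hy.le)) _
  set α : ℕ → ℝ := fun n => ∫ y, w n y ∂μ with hα
  have hα0 : ∀ n, 0 ≤ α n := fun n => integral_nonneg (hw0 n)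
  have hαsum : HasSum α (∫ y, f y ∂μ) := by
    have := hasSum_integral_iUnion hPm hPd (f := f) (μ := μ) (by rw [hPU]; exact hf.integrableOn)
    rw [hPU, setIntegral_univ] at this
    have hαe : α = fun n => ∫ y in P n, f y ∂μ := funext fun n => integral_indicator (hPm n)
    rw [hαe]
    exact this
  have hαle : ∀ m, ∑ n ∈ Finset.range m, α n ≤ ∫ y, f y ∂μ := fun m =>
    sum_le_hasSum _ (fun n _ => hα0 n) hαsum
  have hpiece : ∀ n, ∫⁻ x, ‖α n * truncKernel K ε x (u n) - truncated μ K ε (w n) x‖ₑ ∂μ ≤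
      ENNReal.ofReal (3 * C * α n) := by
    intro n
    refine le_trans ?_ (hK.lintegral_mul_truncKernel_sub_truncated_le hε hρ (hwi n) (hw0 n) (hwu n))
    rw [← lintegral_indicator Metric.isOpen_ball.measurableSet.compl]
    refine lintegral_mono fun x => ?_
    by_cases hx : x ∈ (Metric.ball (u n) (3 * (ε / 4)))ᶜ
    · rw [indicator_of_mem hx]
    · have hx' : dist x (u n) < 3 * (ε / 4) := by simpa using hx
      -- With the radius `ε / 4`, points `x` within `3 * (ε / 4)` of the centre see the whole cell
      -- at distance less than `ε`, so both the atom and the density are truncated away and no near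
      -- part remains.
      have h0 : truncated μ K ε (w n) x = 0 := by
        rw [truncated_eq_integral]
        refine integral_eq_zero_of_ae (Eventually.of_forall fun y => ?_)
        rcases lt_or_ge (ε / 4) (dist y (u n)) with hy | hy
        · simp [hwu n y hy]
        · have := dist_triangle x (u n) y
          rw [dist_comm (u n) y] at this
          simp [truncKernel_of_lt (K := K) (show dist x y < ε by linarith)]
      simp only
      rw [h0, truncKernel_of_lt (by linarith)]
      simp
  have hfin : ∀ m, μ {x | 3 < |∑ n ∈ Finset.range m, truncated μ K ε (w n) x|} ≤
      ENNReal.ofReal ((B₀ + 3 * C) * ∫ y, f y ∂μ) := by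
    intro m
    -- The inequality for atoms requires positive masses, so cells of mass zero are dropped.
    set s : Finset ℕ := (Finset.range m).filter fun n => 0 < α n with hs
    have hatoms : ∀ x, ∑ n ∈ Finset.range m, α n * truncKernel K ε x (u n) =
        ∑ n ∈ s, α n * truncKernel K ε x (u n) := by
      intro x
      rw [hs, Finset.sum_filter]
      refine Finset.sum_congr rfl fun n _ => ?_
      split_ifs with h0
      · rfl
      · rw [le_antisymm (not_lt.1 h0) (hα0 n), zero_mul]
    have hsle : ∑ n ∈ s, α n ≤ ∫ y, f y ∂μ :=
      (Finset.sum_le_sum_of_subset_of_nonneg (Finset.filter_subset _ _)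
        fun n _ _ => hα0 n).trans (hαle m)
    have h1 := hK.measure_sum_atoms_le hT hε s u α fun n hn => (Finset.mem_filter.1 hn).2
    rw [← hB₀] at h1
    set F : X → ℝ := fun x => ∑ n ∈ Finset.range m,
      (α n * truncKernel K ε x (u n) - truncated μ K ε (w n) x) with hF
    have hFn : ∀ n, Measurable fun x =>
        α n * truncKernel K ε x (u n) - truncated μ K ε (w n) x := fun n =>
      ((hK.measurable_truncKernel_left ε (u n)).const_mul _).sub
        (hK.measurable_truncated ε (hwi n).1)
    have hFm : Measurable F := Finset.measurable_sum _ fun n _ => hFn n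
    have h2 : μ {x | 1 ≤ ‖F x‖ₑ} ≤ ENNReal.ofReal (3 * C * ∫ y, f y ∂μ) := by
      calc μ {x | 1 ≤ ‖F x‖ₑ} ≤ ∫⁻ x, ‖F x‖ₑ ∂μ := by
            simpa using mul_meas_ge_le_lintegral hFm.enorm 1
        _ ≤ ∫⁻ x, ∑ n ∈ Finset.range m,
              ‖α n * truncKernel K ε x (u n) - truncated μ K ε (w n) x‖ₑ ∂μ :=
            lintegral_mono fun x => enorm_sum_le _ _
        _ = ∑ n ∈ Finset.range m,
              ∫⁻ x, ‖α n * truncKernel K ε x (u n) - truncated μ K ε (w n) x‖ₑ ∂μ :=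
            lintegral_finsetSum _ fun n _ => (hFn n).enorm
        _ ≤ ∑ n ∈ Finset.range m, ENNReal.ofReal (3 * C * α n) :=
            Finset.sum_le_sum fun n _ => hpiece n
        _ = ENNReal.ofReal (3 * C * ∑ n ∈ Finset.range m, α n) := by
            rw [Finset.mul_sum, ENNReal.ofReal_sum_of_nonneg fun n _ => by
              have := hα0 n
              positivity]
        _ ≤ _ := ENNReal.ofReal_le_ofReal (by
            have := hαle m
            gcongr)
    calc μ {x | 3 < |∑ n ∈ Finset.range m, truncated μ K ε (w n) x|}
        ≤ μ ({x | 2 < |∑ n ∈ s, α n * truncKernel K ε x (u n)|} ∪ {x | 1 ≤ ‖F x‖ₑ}) := by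
          refine measure_mono fun x hx => ?_
          by_contra hcon
          simp only [mem_union, mem_ofPred_eq, not_or, not_lt, not_le] at hcon
          obtain ⟨c1, c2⟩ := hcon
          have hx' : 3 < |∑ n ∈ Finset.range m, truncated μ K ε (w n) x| := hx
          rw [← hatoms] at c1
          rw [Real.enorm_eq_ofReal_abs, ← ENNReal.ofReal_one,
            ENNReal.ofReal_lt_ofReal_iff one_pos] at c2
          have : ∑ n ∈ Finset.range m, truncated μ K ε (w n) x =
              ∑ n ∈ Finset.range m, α n * truncKernel K ε x (u n) - F x := by
            simp [hF]
          rw [this] at hx'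
          have := abs_sub (∑ n ∈ Finset.range m, α n * truncKernel K ε x (u n)) (F x)
          linarith
      _ ≤ ENNReal.ofReal (B₀ * ∫ y, f y ∂μ) + ENNReal.ofReal (3 * C * ∫ y, f y ∂μ) := by
          refine (measure_union_le _ _).trans (add_le_add (h1.trans ?_) h2)
          exact ENNReal.ofReal_le_ofReal (by gcongr)
      _ = ENNReal.ofReal ((B₀ + 3 * C) * ∫ y, f y ∂μ) := by
          have : 0 ≤ ∫ y, f y ∂μ := integral_nonneg hf0
          rw [← ENNReal.ofReal_add (by positivity) (by positivity), ← add_mul]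
  -- passage to the limit, for the fixed truncation
  have hlim : ∀ᶠ m in atTop, ∫ y, f y ∂μ - ∑ n ∈ Finset.range m, α n < h ε := by
    have h1 : Tendsto (fun m => ∫ y, f y ∂μ - ∑ n ∈ Finset.range m, α n) atTop
        (𝓝 (∫ y, f y ∂μ - ∫ y, f y ∂μ)) := tendsto_const_nhds.sub hαsum.tendsto_sum_nat
    rw [sub_self] at h1
    exact h1.eventually (gt_mem_nhds (hK.pos _ hε))
  obtain ⟨m, hm⟩ := hlim.exists
  refine (measure_mono fun x hx => ?_).trans (hfin m)
  have hx' : 4 < |truncated μ K ε f x| := hx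
  have hsumint : Integrable (fun y => ∑ n ∈ Finset.range m, w n y) μ :=
    integrable_finsetSum _ fun n _ => hwi n
  have hle : ∀ y, ∑ n ∈ Finset.range m, w n y ≤ f y := by
    intro y
    have : ∑ n ∈ Finset.range m, w n y = (⋃ n ∈ Finset.range m, P n).indicator f y := by
      rw [Finset.indicator_biUnion _ _ fun i _ j _ hij => hPd hij]
    rw [this]
    exact indicator_le_self' (fun y _ => hf0 y) y
  -- For a fixed `ε` the operator is bounded from `L¹` to the bounded functions with norm at most `1
  -- / h ε`, so a remainder of mass less than `h ε` changes the value by less than 1.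
  have hdiff : |truncated μ K ε (fun y => f y - ∑ n ∈ Finset.range m, w n y) x| < 1 := by
    refine (hK.abs_truncated_le hε x (hf.sub hsumint)).trans_lt ?_
    rw [div_lt_one (hK.pos _ hε)]
    have : ∫ y, |f y - ∑ n ∈ Finset.range m, w n y| ∂μ =
        ∫ y, f y ∂μ - ∑ n ∈ Finset.range m, α n := by
      rw [← integral_finsetSum _ fun n _ => hwi n, ← integral_sub hf hsumint]
      congr 1 with y
      exact abs_of_nonneg (sub_nonneg.2 (hle y))
    exact this.trans_lt hm
  rw [hK.truncated_sub hε x hf hsumint, hK.truncated_sum hε _ fun n _ => hwi n] at hdiff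
  show 3 < |∑ n ∈ Finset.range m, truncated μ K ε (w n) x|
  have := abs_sub_abs_le_abs_sub (truncated μ K ε f x)
    (∑ n ∈ Finset.range m, truncated μ K ε (w n) x)
  linarith

/-- The weak type `(1, 1)` inequality, uniformly for all truncations. -/
theorem exists_measure_lt_abs_truncated_le (hK : IsCZKernel μ K h C) {C₀ : ℝ≥0}
    (hT : MaximalBound μ K C₀) :
    ∃ B : ℝ, 0 ≤ B ∧ ∀ (ε t : ℝ) (f : X → ℝ), 0 < ε → 0 < t → Integrable f μ →
      μ {x | t < |truncated μ K ε f x|} ≤ ENNReal.ofReal (B * (∫ y, |f y| ∂μ) / t) := by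
  obtain ⟨B, hB, hBf⟩ := hK.exists_measure_lt_abs_truncated_le_of_nonneg hT
  have hpos : ∀ (ε t : ℝ) (f : X → ℝ), 0 < ε → 0 < t → Integrable f μ → (∀ y, 0 ≤ f y) →
      μ {x | t < |truncated μ K ε f x|} ≤ ENNReal.ofReal (4 * B * (∫ y, f y ∂μ) / t) := by
    intro ε t f hε ht hf hf0
    have := hBf ε (fun y => (4 / t) * f y) hε (hf.const_mul _)
      (fun y => mul_nonneg (by positivity) (hf0 y))
    simp only [truncated_const_mul, integral_const_mul] at this
    refine le_trans (measure_mono fun x hx => ?_) (this.trans_eq ?_)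
    · have hx' : t < |truncated μ K ε f x| := hx
      simp only [mem_ofPred_eq]
      rw [abs_mul, abs_of_pos (by positivity), div_mul_eq_mul_div, lt_div_iff₀ ht]
      gcongr
    · congr 1
      ring
  -- Homogeneity turns the level 4 into `t` with constant `4 * B`; splitting into positive and
  -- negative parts at level `t / 2` doubles it.
  refine ⟨8 * B, by positivity, fun ε t f hε ht hf => ?_⟩
  have hp : Integrable (fun y => max (f y) 0) μ := hf.pos_part
  have hn : Integrable (fun y => max (-f y) 0) μ := hf.neg_part
  have h1 := hpos ε (t / 2) _ hε (by positivity) hp fun y => le_max_right _ _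
  have h2 := hpos ε (t / 2) _ hε (by positivity) hn fun y => le_max_right _ _
  have hip : 0 ≤ ∫ y, max (f y) 0 ∂μ := integral_nonneg fun y => le_max_right _ _
  have hin : 0 ≤ ∫ y, max (-f y) 0 ∂μ := integral_nonneg fun y => le_max_right _ _
  have hsub : truncated μ K ε f = fun x =>
      truncated μ K ε (fun y => max (f y) 0) x - truncated μ K ε (fun y => max (-f y) 0) x := by
    ext x
    rw [← hK.truncated_sub hε x hp hn]
    congr 1 with y
    rcases le_total 0 (f y) with hy | hy
    · simp [hy]
    · simp [hy]
  have habs : ∫ y, |f y| ∂μ = ∫ y, max (f y) 0 ∂μ + ∫ y, max (-f y) 0 ∂μ := by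
    rw [← integral_add hp hn]
    congr 1 with y
    rcases le_total 0 (f y) with hy | hy
    · simp [hy, abs_of_nonneg]
    · simp [hy, abs_of_nonpos]
  calc μ {x | t < |truncated μ K ε f x|}
      ≤ μ ({x | t / 2 < |truncated μ K ε (fun y => max (f y) 0) x|} ∪
          {x | t / 2 < |truncated μ K ε (fun y => max (-f y) 0) x|}) := by
        refine measure_mono fun x hx => ?_
        by_contra hcon
        simp only [mem_union, mem_ofPred_eq, not_or, not_lt] at hcon
        have hx' : t < |truncated μ K ε f x| := hx
        rw [hsub] at hx'
        have := abs_sub (truncated μ K ε (fun y => max (f y) 0) x)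
          (truncated μ K ε (fun y => max (-f y) 0) x)
        linarith [hcon.1, hcon.2]
    _ ≤ _ := (measure_union_le _ _).trans (add_le_add h1 h2)
    _ = ENNReal.ofReal (8 * B * (∫ y, |f y| ∂μ) / t) := by
        rw [← ENNReal.ofReal_add (by positivity) (by positivity), habs]
        congr 1
        field_simp
        ring

end IsCZKernel

end SingularIntegral


/-! ### Lipschitz approximation and the antisymmetrized form -/

namespace SingularIntegral

set_option linter.unusedSectionVars false

variable {X : Type*} [MetricSpace X] [MeasurableSpace X]

/-- Bounded Lipschitz functions. -/
def IsBoundedLipschitz (f : X → ℝ) : Prop :=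
  (∃ L : ℝ≥0, LipschitzWith L f) ∧ ∃ M : ℝ, ∀ x, |f x| ≤ M

theorem IsBoundedLipschitz.add {f g : X → ℝ} (hf : IsBoundedLipschitz f)
    (hg : IsBoundedLipschitz g) : IsBoundedLipschitz (f + g) := by
  obtain ⟨⟨L, hL⟩, M, hM⟩ := hf
  obtain ⟨⟨L', hL'⟩, M', hM'⟩ := hg
  exact ⟨⟨L + L', hL.add hL'⟩, M + M', fun x => (abs_add_le _ _).trans (add_le_add (hM x) (hM' x))⟩

variable [BorelSpace X] {μ : Measure X} [IsFiniteMeasure μ]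

/-- A finite Borel measure on a metric space is inner regular by closed sets. The thickened
indicator of a closed `F ⊆ s` differs from the indicator of `s` only on a small set `D`, and by at
most one there. -/
theorem exists_isBoundedLipschitz_eLpNorm_indicator_sub_le {p : ℝ≥0∞} (hp : p ≠ ∞) (c : ℝ)
    {s : Set X} (hs : MeasurableSet s) {ε : ℝ≥0∞} (hε : ε ≠ 0) :
    ∃ g : X → ℝ, eLpNorm (g - s.indicator fun _ => c) p μ ≤ ε ∧ IsBoundedLipschitz g := by
  obtain ⟨η, hη, hηle⟩ := exists_eLpNorm_indicator_le (μ := μ) hp c hε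
  have hη2 : (η : ℝ≥0∞) / 2 ≠ 0 := by simpa using hη.ne'
  obtain ⟨F, hFs, hF, hFμ⟩ := hs.exists_isClosed_sdiff_lt (measure_ne_top μ s) hη2
  have hth : Tendsto (fun r => μ (Metric.thickening r F)) (𝓝[>] 0) (𝓝 (μ F)) :=
    tendsto_measure_thickening_of_isClosed ⟨1, one_pos, measure_ne_top _ _⟩ hF
  have hlt : μ F < μ F + (η : ℝ≥0∞) / 2 := ENNReal.lt_add_right (measure_ne_top _ _) hη2
  obtain ⟨δ, hδ, hδ0⟩ := ((hth.eventually (gt_mem_nhds hlt)).and self_mem_nhdsWithin).exists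
  have hδ0 : 0 < δ := hδ0
  set D : Set X := (Metric.thickening δ F \ F) ∪ (s \ F) with hD
  have hDμ : μ D ≤ η := by
    calc μ D ≤ μ (Metric.thickening δ F \ F) + μ (s \ F) := measure_union_le _ _
      _ ≤ (η : ℝ≥0∞) / 2 + (η : ℝ≥0∞) / 2 := by
          refine add_le_add ?_ hFμ.le
          rw [measure_sdiff (Metric.self_subset_thickening hδ0 F) hF.nullMeasurableSet
            (measure_ne_top _ _)]
          exact tsub_le_iff_left.2 hδ.le
      _ = η := ENNReal.add_halves _
  have hle1 : ∀ x, ((thickenedIndicator hδ0 F x : ℝ≥0) : ℝ) ≤ 1 := fun x => by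
    exact_mod_cast thickenedIndicator_le_one hδ0 F x
  refine ⟨fun x => c * (thickenedIndicator hδ0 F x : ℝ≥0), ?_, ?_, |c|, fun x => ?_⟩
  · refine le_trans (eLpNorm_mono fun x => ?_) (hηle D hDμ)
    by_cases hxD : x ∈ D
    · rw [indicator_of_mem hxD]
      simp only [Pi.sub_apply, Real.norm_eq_abs]
      have h0 : (0 : ℝ) ≤ (thickenedIndicator hδ0 F x : ℝ≥0) := NNReal.coe_nonneg _
      have h1 := hle1 x
      by_cases hxs : x ∈ s
      · rw [indicator_of_mem hxs, ← mul_sub_one, abs_mul]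
        refine mul_le_of_le_one_right (abs_nonneg _) (abs_le.2 ⟨by linarith, by linarith⟩)
      · rw [indicator_of_notMem hxs, sub_zero, abs_mul]
        exact mul_le_of_le_one_right (abs_nonneg _) (abs_le.2 ⟨by linarith, by linarith⟩)
    · have hx : (x ∈ F ∧ x ∈ s) ∨ (x ∉ Metric.thickening δ F ∧ x ∉ s) := by
        by_cases hxF : x ∈ F
        · exact Or.inl ⟨hxF, hFs hxF⟩
        · exact Or.inr ⟨fun h => hxD (Or.inl ⟨h, hxF⟩), fun h => hxD (Or.inr ⟨h, hxF⟩)⟩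
      rcases hx with ⟨h1, h2⟩ | ⟨h1, h2⟩
      · rw [Pi.sub_apply, thickenedIndicator_one hδ0 F h1]
        simp [h2, hxD]
      · rw [Pi.sub_apply, thickenedIndicator_zero hδ0 F h1]
        simp [h2, hxD]
  · refine ⟨‖c‖₊ * δ.toNNReal⁻¹, ?_⟩
    have h1 := lipschitzWith_thickenedIndicator hδ0 F
    refine LipschitzWith.of_dist_le_mul fun x y => ?_
    have h2 := h1.dist_le_mul x y
    rw [NNReal.dist_eq] at h2
    rw [Real.dist_eq, ← mul_sub, abs_mul, NNReal.coe_mul, mul_assoc]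
    exact mul_le_mul_of_nonneg_left h2 (abs_nonneg _)
  · rw [abs_mul, abs_of_nonneg (NNReal.coe_nonneg _)]
    exact mul_le_of_le_one_right (abs_nonneg _) (hle1 x)

theorem exists_isBoundedLipschitz_eLpNorm_sub_le {p : ℝ≥0∞} (hp : p ≠ ∞) {f : X → ℝ}
    (hf : MemLp f p μ) {ε : ℝ≥0∞} (hε : ε ≠ 0) :
    ∃ g : X → ℝ, eLpNorm (f - g) p μ ≤ ε ∧ IsBoundedLipschitz g :=
  hf.induction_dense hp _
    (fun c _ hs _ _ hε => exists_isBoundedLipschitz_eLpNorm_indicator_sub_le hp c hs hε)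
    (fun _ _ hf hg => hf.add hg)
    (fun _ hf => hf.1.choose_spec.continuous.measurable.aestronglyMeasurable) hε

theorem IsBoundedLipschitz.memLp {f : X → ℝ} (hf : IsBoundedLipschitz f) (p : ℝ≥0∞) :
    MemLp f p μ := by
  obtain ⟨⟨L, hL⟩, M, hM⟩ := hf
  exact MemLp.of_bound hL.continuous.measurable.aestronglyMeasurable M (Eventually.of_forall hM)

theorem IsBoundedLipschitz.integrable {f : X → ℝ} (hf : IsBoundedLipschitz f) :
    Integrable f μ := memLp_one_iff_integrable.1 (hf.memLp 1)

namespace IsCZKernel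

variable [SecondCountableTopology X] {K : X → X → ℝ} {h : ℝ → ℝ} {C : ℝ}

/-- Within distance 1 the Lipschitz factor reduces the integrand to `A * d / h d`, which is summed
over annuli; beyond it the kernel is at most `1 / h 1`. The bound does not depend on `x`, as
integration over the product requires. -/
theorem lintegral_mul_le_of_lipschitz (hK : IsCZKernel μ K h C) {A B : ℝ} (hA : 0 ≤ A)
    {Φ : X → ℝ} {x : X} (hΦ : ∀ y, |Φ y| ≤ A * dist y x) (hΦ' : ∀ y, |Φ y| ≤ B) :
    ∫⁻ y, ‖K x y * Φ y‖ₑ ∂μ ≤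
      ENNReal.ofReal A * ENNReal.ofReal (2 * C) + ENNReal.ofReal (1 / h 1 * B) * μ univ := by
  have hb : MeasurableSet (Metric.ball x 1) := Metric.isOpen_ball.measurableSet
  rw [← lintegral_add_compl _ hb]
  refine add_le_add ?_ ?_
  · calc ∫⁻ y in Metric.ball x 1, ‖K x y * Φ y‖ₑ ∂μ
        ≤ ∫⁻ y in Metric.ball x 1, ENNReal.ofReal A * ENNReal.ofReal (dist y x / h (dist y x)) ∂μ := by
          refine lintegral_mono fun y => ?_
          dsimp only
          rw [← ENNReal.ofReal_mul hA, Real.enorm_eq_ofReal_abs, abs_mul]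
          refine ENNReal.ofReal_le_ofReal ?_
          rcases eq_or_ne x y with rfl | hne
          · simp [hK.self_eq_zero]
          · have h1 := hK.size x y hne
            have h2 := hΦ y
            have h3 := hK.pos _ (dist_pos.2 hne)
            rw [dist_comm x y] at h1 h3
            calc |K x y| * |Φ y| ≤ 1 / h (dist y x) * (A * dist y x) := by gcongr
              _ = _ := by ring
      _ = ENNReal.ofReal A * ∫⁻ y in Metric.ball x 1, ENNReal.ofReal (dist y x / h (dist y x)) ∂μ :=
          lintegral_const_mul' _ _ ENNReal.ofReal_ne_top
      _ ≤ ENNReal.ofReal A * ENNReal.ofReal (2 * C) := by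
          gcongr
          have := hK.lintegral_ball_le (ν := μ) (x := x) (R := 1) one_pos zero_le_one
            fun s hs _ => by simpa using hK.measure_ball_le x hs
          simpa using this
  · calc ∫⁻ y in (Metric.ball x 1)ᶜ, ‖K x y * Φ y‖ₑ ∂μ
        ≤ ∫⁻ y in (Metric.ball x 1)ᶜ, ENNReal.ofReal (1 / h 1 * B) ∂μ := by
          refine setLIntegral_mono' hb.compl fun y hy => ?_
          have hy' : 1 ≤ dist x y := by simpa [dist_comm] using hy
          rw [Real.enorm_eq_ofReal_abs, abs_mul]
          refine ENNReal.ofReal_le_ofReal ?_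
          have h1 := hK.abs_le one_pos hy'
          have h2 := hΦ' y
          have h3 := hK.pos 1 one_pos
          gcongr
      _ ≤ ENNReal.ofReal (1 / h 1 * B) * μ univ := by
          rw [setLIntegral_const]
          gcongr
          exact subset_univ _

/-- Averaging the form with its transpose replaces `f y * g x` by half of `Φ x y = f y * g x - f x *
g y`. This vanishes to first order on the diagonal, so `K * Φ` is integrable on the product and
dominates all its truncations. -/
theorem exists_tendsto_integral_truncated_mul (hK : IsCZKernel μ K h C) {f g : X → ℝ}
    (hf : IsBoundedLipschitz f) (hg : IsBoundedLipschitz g) :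
    ∃ l : ℝ, Tendsto (fun ε => ∫ x, truncated μ K ε f x * g x ∂μ) (𝓝[>] 0) (𝓝 l) := by
  have hfi : Integrable f μ := hf.integrable
  have hgi : Integrable g μ := hg.integrable
  obtain ⟨⟨L, hL⟩, M₀, hM₀⟩ := hf
  obtain ⟨⟨L', hL'⟩, M₀', hM₀'⟩ := hg
  obtain ⟨M, hM0, hM⟩ : ∃ M, 0 ≤ M ∧ ∀ x, |f x| ≤ M :=
    ⟨|M₀|, abs_nonneg _, fun x => (hM₀ x).trans (le_abs_self _)⟩
  obtain ⟨M', hM0', hM'⟩ : ∃ M, 0 ≤ M ∧ ∀ x, |g x| ≤ M :=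
    ⟨|M₀'|, abs_nonneg _, fun x => (hM₀' x).trans (le_abs_self _)⟩
  set Φ : X → X → ℝ := fun x y => f y * g x - f x * g y with hΦ
  have hΦm : Measurable (Function.uncurry Φ) := by
    have hfm := hL.continuous.measurable
    have hgm := hL'.continuous.measurable
    exact ((hfm.comp measurable_snd).mul (hgm.comp measurable_fst)).sub
      ((hfm.comp measurable_fst).mul (hgm.comp measurable_snd))
  have hdom : Integrable (fun p : X × X => K p.1 p.2 * Φ p.1 p.2) (μ.prod μ) := by
    have hm : Measurable (fun p : X × X => K p.1 p.2 * Φ p.1 p.2) := hK.measurable.mul hΦm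
    refine ⟨hm.aestronglyMeasurable, ?_⟩
    unfold HasFiniteIntegral
    rw [lintegral_prod _ hm.enorm.aemeasurable]
    set A : ℝ := L * M' + L' * M
    set B : ℝ := 2 * (M * M')
    have hb : ∀ x, ∫⁻ y, ‖K x y * Φ x y‖ₑ ∂μ ≤
        ENNReal.ofReal A * ENNReal.ofReal (2 * C) + ENNReal.ofReal (1 / h 1 * B) * μ univ := by
      intro x
      refine hK.lintegral_mul_le_of_lipschitz (by positivity) (fun y => ?_)
        fun y => ?_
      · have h1 : |f y - f x| ≤ L * dist y x := hL.dist_le_mul y x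
        have h2 : |g y - g x| ≤ L' * dist y x := hL'.dist_le_mul y x
        calc |Φ x y| = |(f y - f x) * g x - (g y - g x) * f x| := by
              simp only [hΦ]
              ring_nf
          _ ≤ |f y - f x| * |g x| + |g y - g x| * |f x| := by
              refine (abs_sub _ _).trans ?_
              rw [abs_mul, abs_mul]
          _ ≤ (L * dist y x) * M' + (L' * dist y x) * M := by
              gcongr
              · exact hM' x
              · exact hM x
          _ = A * dist y x := by ring
      · calc |Φ x y| ≤ |f y| * |g x| + |f x| * |g y| := by
              refine (abs_sub _ _).trans ?_
              rw [abs_mul, abs_mul]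
          _ ≤ M * M' + M * M' := by
              gcongr
              · exact hM y
              · exact hM' x
              · exact hM x
              · exact hM' y
          _ = B := by ring
    refine (lintegral_mono hb).trans_lt ?_
    rw [lintegral_const]
    refine ENNReal.mul_lt_top ?_ (measure_lt_top _ _)
    exact ENNReal.add_lt_top.2 ⟨ENNReal.mul_lt_top ENNReal.ofReal_lt_top ENNReal.ofReal_lt_top,
      ENNReal.mul_lt_top ENNReal.ofReal_lt_top (measure_lt_top _ _)⟩
  have hlim : Tendsto (fun ε => ∫ p : X × X, truncKernel K ε p.1 p.2 * Φ p.1 p.2 ∂(μ.prod μ))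
      (𝓝[>] 0) (𝓝 (∫ p : X × X, K p.1 p.2 * Φ p.1 p.2 ∂(μ.prod μ))) := by
    refine tendsto_integral_filter_of_dominated_convergence
      (fun p => ‖K p.1 p.2 * Φ p.1 p.2‖) ?_ ?_ hdom.norm ?_
    · exact Eventually.of_forall fun ε =>
        ((hK.measurable_truncKernel ε).mul hΦm).aestronglyMeasurable
    · refine Eventually.of_forall fun ε => Eventually.of_forall fun p => ?_
      rcases le_or_gt ε (dist p.1 p.2) with hp | hp
      · rw [truncKernel_of_le hp]
      · rw [truncKernel_of_lt hp, zero_mul, norm_zero]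
        exact norm_nonneg _
    · refine Eventually.of_forall fun p => ?_
      rcases eq_or_ne p.1 p.2 with he | hne
      · have : ∀ ε, truncKernel K ε p.1 p.2 = K p.1 p.2 := by
          intro ε
          rcases le_or_gt ε (dist p.1 p.2) with hp | hp
          · rw [truncKernel_of_le hp]
          · rw [truncKernel_of_lt hp, he, hK.self_eq_zero]
        simp only [this, tendsto_const_nhds]
      · refine tendsto_const_nhds.congr' ?_
        have : ∀ᶠ ε in 𝓝[>] (0 : ℝ), ε < dist p.1 p.2 :=
          nhdsWithin_le_nhds (Iio_mem_nhds (dist_pos.2 hne))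
        filter_upwards [this] with ε hε
        rw [truncKernel_of_le hε.le]
  refine ⟨1 / 2 * ∫ p : X × X, K p.1 p.2 * Φ p.1 p.2 ∂(μ.prod μ),
    (hlim.const_mul (1 / 2)).congr' ?_⟩
  filter_upwards [self_mem_nhdsWithin] with ε hε
  have hε : 0 < ε := hε
  have hi1 : Integrable (fun p : X × X => truncKernel K ε p.1 p.2 * (g p.1 * f p.2)) (μ.prod μ) :=
    (hgi.mul_prod hfi).bdd_mul (c := 1 / h ε) (hK.measurable_truncKernel ε).aestronglyMeasurable
      (Eventually.of_forall fun p => hK.abs_truncKernel_le hε _ _)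
  have hi2 : Integrable (fun p : X × X => truncKernel K ε p.1 p.2 * (f p.1 * g p.2)) (μ.prod μ) :=
    (hfi.mul_prod hgi).bdd_mul (c := 1 / h ε) (hK.measurable_truncKernel ε).aestronglyMeasurable
      (Eventually.of_forall fun p => hK.abs_truncKernel_le hε _ _)
  have e1 : ∀ {f g : X → ℝ},
      Integrable (fun p : X × X => truncKernel K ε p.1 p.2 * (g p.1 * f p.2)) (μ.prod μ) →
      ∫ p : X × X, truncKernel K ε p.1 p.2 * (g p.1 * f p.2) ∂(μ.prod μ) =
        ∫ x, truncated μ K ε f x * g x ∂μ := by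
    intro f g hi
    rw [integral_prod _ hi]
    congr 1 with x
    rw [truncated_eq_integral, ← integral_mul_const]
    congr 1 with y
    ring
  have e2 : ∫ p : X × X, truncKernel K ε p.1 p.2 * Φ p.1 p.2 ∂(μ.prod μ) =
      ∫ x, truncated μ K ε f x * g x ∂μ - ∫ x, truncated μ K ε g x * f x ∂μ := by
    rw [← e1 hi1, ← e1 hi2, ← integral_sub hi1 hi2]
    congr 1 with p
    simp only [hΦ]
    ring
  rw [e2, hK.integral_truncated_mul hε hfi hgi]
  ring

end IsCZKernel

end SingularIntegral


/-! ### The weak limit in `L²` -/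

namespace SingularIntegral

set_option linter.unusedSectionVars false

variable {X : Type*} [MetricSpace X] [SecondCountableTopology X] [MeasurableSpace X]
  [BorelSpace X] {μ : Measure X} [IsFiniteMeasure μ]

theorem norm_toLp_eq_sqrt {f : X → ℝ} (hf : MemLp f 2 μ) :
    ‖hf.toLp f‖ = √(∫ x, f x ^ 2 ∂μ) := by
  have h1 : ‖hf.toLp f‖ ^ 2 = ∫ x, f x ^ 2 ∂μ := by
    rw [← real_inner_self_eq_norm_sq, L2.inner_def]
    refine integral_congr_ae ?_
    filter_upwards [hf.coeFn_toLp] with x hx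
    simp [hx]
  rw [← h1, Real.sqrt_sq (norm_nonneg _)]

theorem abs_integral_mul_le_sqrt {f g : X → ℝ} (hf : MemLp f 2 μ) (hg : MemLp g 2 μ) :
    |∫ x, f x * g x ∂μ| ≤ √(∫ x, f x ^ 2 ∂μ) * √(∫ x, g x ^ 2 ∂μ) := by
  have h1 : ∫ x, f x * g x ∂μ = inner ℝ (hf.toLp f) (hg.toLp g) := by
    rw [L2.inner_def]
    refine integral_congr_ae ?_
    filter_upwards [hf.coeFn_toLp, hg.coeFn_toLp] with x hx hx'
    simp [hx, hx', mul_comm]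
  rw [h1, ← norm_toLp_eq_sqrt hf, ← norm_toLp_eq_sqrt hg]
  exact abs_real_inner_le_norm _ _

/-- Uniform limits of convergent functions converge, by the Cauchy criterion; no candidate for the
limit is needed. -/
theorem tendsto_of_forall_approx {l : Filter ℝ} [NeBot l] {F : ℝ → ℝ}
    (hF : ∀ η > 0, ∃ G : ℝ → ℝ, (∃ a, Tendsto G l (𝓝 a)) ∧ ∀ᶠ ε in l, |F ε - G ε| ≤ η) :
    ∃ a, Tendsto F l (𝓝 a) := by
  refine cauchy_map_iff_exists_tendsto.1 (Metric.cauchy_iff.2 ⟨inferInstance, fun η hη => ?_⟩)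
  obtain ⟨G, ⟨a, ha⟩, hG⟩ := hF (η / 8) (by positivity)
  have hball := ha.eventually (Metric.ball_mem_nhds a (show 0 < η / 8 by positivity))
  refine ⟨F '' {ε | |F ε - G ε| ≤ η / 8 ∧ G ε ∈ Metric.ball a (η / 8)},
    image_mem_map (hG.and hball), ?_⟩
  rintro _ ⟨ε, ⟨h1, h2⟩, rfl⟩ _ ⟨ε', ⟨h1', h2'⟩, rfl⟩
  rw [Metric.mem_ball, Real.dist_eq] at h2 h2'
  rw [Real.dist_eq]
  have k1 := abs_le.1 h1
  have k2 := abs_le.1 h1'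
  have k3 := abs_lt.1 h2
  have k4 := abs_lt.1 h2'
  rw [abs_lt]
  constructor <;> linarith [k1.1, k1.2, k2.1, k2.2, k3.1, k3.2, k4.1, k4.2]

namespace IsCZKernel

variable {K : X → X → ℝ} {h : ℝ → ℝ} {C : ℝ}

theorem memLp_truncated (hK : IsCZKernel μ K h C) {ε : ℝ} (hε : 0 < ε) {f : X → ℝ}
    (hf : Integrable f μ) : MemLp (truncated μ K ε f) 2 μ :=
  memLp_two_of_bound (hK.measurable_truncated ε hf.1).aestronglyMeasurable
    fun x => hK.abs_truncated_le hε x hf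

theorem sqrt_integral_truncated_le (hK : IsCZKernel μ K h C) {C₀ : ℝ≥0} (hT : MaximalBound μ K C₀)
    {ε : ℝ} (hε : 0 < ε) {f : X → ℝ} (hf : MemLp f 2 μ) :
    √(∫ x, truncated μ K ε f x ^ 2 ∂μ) ≤ √C₀ * √(∫ x, f x ^ 2 ∂μ) := by
  have hfi : Integrable f μ := hf.integrable one_le_two
  rw [← Real.sqrt_mul C₀.coe_nonneg]
  refine Real.sqrt_le_sqrt ?_
  have h1 : ∫⁻ x, ENNReal.ofReal (truncated μ K ε f x ^ 2) ∂μ ≤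
      C₀ * ∫⁻ x, ENNReal.ofReal (f x ^ 2) ∂μ := by
    refine (lintegral_mono fun x => ?_).trans (hT f hf)
    rw [← sq_abs, ENNReal.ofReal_pow (abs_nonneg _)]
    gcongr
    exact ofReal_abs_truncated_le_maximal hε f x
  rw [← ofReal_integral_eq_lintegral_ofReal (hK.memLp_truncated hε hfi).integrable_sq
      (Eventually.of_forall fun y => by positivity),
    ← ofReal_integral_eq_lintegral_ofReal hf.integrable_sq
      (Eventually.of_forall fun y => by positivity),
    ← ENNReal.ofReal_coe_nnreal, ← ENNReal.ofReal_mul (by positivity)] at h1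
  refine (ENNReal.ofReal_le_ofReal_iff ?_).1 h1
  have : 0 ≤ ∫ y, f y ^ 2 ∂μ := integral_nonneg fun y => by positivity
  positivity

theorem abs_integral_truncated_mul_le (hK : IsCZKernel μ K h C) {C₀ : ℝ≥0}
    (hT : MaximalBound μ K C₀) {ε : ℝ} (hε : 0 < ε) {f g : X → ℝ} (hf : MemLp f 2 μ)
    (hg : MemLp g 2 μ) :
    |∫ x, truncated μ K ε f x * g x ∂μ| ≤
      √C₀ * √(∫ x, f x ^ 2 ∂μ) * √(∫ x, g x ^ 2 ∂μ) :=
  (abs_integral_mul_le_sqrt (hK.memLp_truncated hε (hf.integrable one_le_two)) hg).trans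
    (mul_le_mul_of_nonneg_right (hK.sqrt_integral_truncated_le hT hε hf) (Real.sqrt_nonneg _))

theorem exists_tendsto_integral_truncated_mul_of_memLp (hK : IsCZKernel μ K h C) {C₀ : ℝ≥0}
    (hT : MaximalBound μ K C₀) {f g : X → ℝ} (hf : MemLp f 2 μ) (hg : MemLp g 2 μ) :
    ∃ l : ℝ, Tendsto (fun ε => ∫ x, truncated μ K ε f x * g x ∂μ) (𝓝[>] 0) (𝓝 l) := by
  refine tendsto_of_forall_approx fun η hη => ?_
  set c := √(C₀ : ℝ) with hc
  have hc0 : 0 ≤ c := Real.sqrt_nonneg _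
  set Nf := √(∫ x, f x ^ 2 ∂μ) with hNf
  set Ng := √(∫ x, g x ^ 2 ∂μ) with hNg
  have hNf0 : 0 ≤ Nf := Real.sqrt_nonneg _
  have hNg0 : 0 ≤ Ng := Real.sqrt_nonneg _
  have key : ∀ {u : X → ℝ}, MemLp u 2 μ → ∀ {s : ℝ}, 0 < s →
      ∃ v : X → ℝ, IsBoundedLipschitz v ∧ √(∫ x, (u x - v x) ^ 2 ∂μ) ≤ s := by
    intro u hu s hs
    obtain ⟨v, hv, hvL⟩ := exists_isBoundedLipschitz_eLpNorm_sub_le (μ := μ) (p := 2)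
      (by simp) hu (ε := ENNReal.ofReal s) (by simpa using hs)
    refine ⟨v, hvL, ?_⟩
    have hd : MemLp (u - v) 2 μ := hu.sub (hvL.memLp 2)
    have := norm_toLp_eq_sqrt hd
    simp only [Pi.sub_apply] at this
    rw [← this, Lp.norm_toLp]
    exact ENNReal.toReal_le_of_le_ofReal hs.le hv
  -- The bound `s ≤ 1` linearizes the product of the two approximation errors; the other bound makes
  -- the total error at most `η`.
  set s : ℝ := min 1 (η / (2 * (c + 1) * (Ng + Nf + 1))) with hs
  have hs0 : 0 < s := by positivity
  obtain ⟨g', hg'L, hg'⟩ := key hg hs0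
  obtain ⟨f', hf'L, hf'⟩ := key hf hs0
  have hf2 : MemLp f' 2 μ := hf'L.memLp 2
  have hg2 : MemLp g' 2 μ := hg'L.memLp 2
  refine ⟨_, hK.exists_tendsto_integral_truncated_mul hf'L hg'L, ?_⟩
  filter_upwards [self_mem_nhdsWithin] with ε hε
  have hε : 0 < ε := hε
  have hfi : Integrable f μ := hf.integrable one_le_two
  have hfi' : Integrable f' μ := hf'L.integrable
  have hTf := hK.memLp_truncated hε hfi
  have hTf' := hK.memLp_truncated hε hfi'
  have hgd : MemLp (fun x => g x - g' x) 2 μ := hg.sub hg2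
  have hfd : MemLp (fun x => f x - f' x) 2 μ := hf.sub hf2
  have hTd := hK.memLp_truncated hε (hfi.sub hfi')
  -- The difference is expanded in `f`, `g`, `f - f'` and `g - g'` only, so that no norms of the
  -- approximants have to be estimated.
  have h1 : ∫ x, truncated μ K ε f x * g x ∂μ - ∫ x, truncated μ K ε f' x * g' x ∂μ =
      ∫ x, truncated μ K ε (fun x => f x - f' x) x * g x ∂μ +
        (∫ x, truncated μ K ε f x * (g x - g' x) ∂μ -
        ∫ x, truncated μ K ε (fun x => f x - f' x) x * (g x - g' x) ∂μ) := by
    have i1 := hTf.integrable_mul hg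
    have i2 := hTf'.integrable_mul hg2
    have i3 := hTd.integrable_mul hg
    have i4 := hTf.integrable_mul hgd
    have i5 := hTd.integrable_mul hgd
    have e1 := integral_sub i1 i2
    have e2 := integral_sub i4 i5
    have e3 := integral_add i3 (i4.sub i5)
    simp only [Pi.mul_apply, Pi.sub_apply] at e1 e2 e3
    have e4 : ∀ x, truncated μ K ε (f - f') x = truncated μ K ε (fun x => f x - f' x) x :=
      fun x => rfl
    simp only [e4] at e2 e3
    rw [← e1, ← e2, ← e3]
    congr 1 with x
    rw [hK.truncated_sub hε x hfi hfi']
    ring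
  have b1 := hK.abs_integral_truncated_mul_le hT hε hfd hg
  have b2 := hK.abs_integral_truncated_mul_le hT hε hf hgd
  have b3 := hK.abs_integral_truncated_mul_le hT hε hfd hgd
  rw [h1]
  have hs1 : s ≤ 1 := min_le_left _ _
  have hsη : s * (2 * (c + 1) * (Ng + Nf + 1)) ≤ η := by
    rw [← le_div_iff₀ (by positivity)]
    exact min_le_right _ _
  calc |_ + (_ - _)| ≤ c * s * Ng + (c * Nf * s + c * s * s) := by
        refine (abs_add_le _ _).trans (add_le_add (b1.trans (by gcongr)) ?_)
        exact (abs_sub _ _).trans (add_le_add (b2.trans (by gcongr)) (b3.trans (by gcongr)))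
    _ ≤ c * s * Ng + (c * Nf * s + c * s * 1) := by gcongr
    _ = c * (s * (Ng + Nf + 1)) := by ring
    _ ≤ (2 * (c + 1)) * (s * (Ng + Nf + 1)) := by
        gcongr
        linarith
    _ = s * (2 * (c + 1) * (Ng + Nf + 1)) := by ring
    _ ≤ η := hsη

theorem norm_eq_sqrt (f : Lp ℝ 2 μ) : ‖f‖ = √(∫ x, (f : X → ℝ) x ^ 2 ∂μ) := by
  rw [← norm_toLp_eq_sqrt (Lp.memLp f), Lp.toLp_coeFn]

theorem exists_isWeakLimit (hK : IsCZKernel μ K h C) {C₀ : ℝ≥0} (hT : MaximalBound μ K C₀) :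
    ∃ T : Lp ℝ 2 μ →L[ℝ] Lp ℝ 2 μ, IsWeakLimit μ K T := by
  have hex : ∀ f g : Lp ℝ 2 μ, ∃ l : ℝ,
      Tendsto (fun ε => ∫ x, truncated μ K ε f x * g x ∂μ) (𝓝[>] 0) (𝓝 l) := fun f g =>
    hK.exists_tendsto_integral_truncated_mul_of_memLp hT (Lp.memLp f) (Lp.memLp g)
  choose B hB using hex
  have hint : ∀ f : Lp ℝ 2 μ, Integrable f μ := fun f => (Lp.memLp f).integrable one_le_two
  have hprod : ∀ (ε : ℝ), 0 < ε → ∀ f g : Lp ℝ 2 μ,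
      Integrable (fun x => truncated μ K ε f x * g x) μ := fun ε hε f g =>
    (hK.memLp_truncated hε (hint f)).integrable_mul (Lp.memLp g)
  have add_left : ∀ f f' g, B (f + f') g = B f g + B f' g := fun f f' g => by
    refine tendsto_nhds_unique (hB (f + f') g) (((hB f g).add (hB f' g)).congr' ?_)
    filter_upwards [self_mem_nhdsWithin] with ε hε
    have hε : 0 < ε := hε
    rw [← integral_add (hprod ε hε f g) (hprod ε hε f' g)]
    congr 1 with x
    rw [truncated_congr_ae (Lp.coeFn_add f f')]
    have := hK.truncated_add hε x (hint f) (hint f')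
    rw [← add_mul, ← this]
    rfl
  have smul_left : ∀ (c : ℝ) f g, B (c • f) g = c * B f g := fun c f g => by
    refine tendsto_nhds_unique (hB (c • f) g) (((hB f g).const_mul c).congr' ?_)
    filter_upwards [self_mem_nhdsWithin] with ε hε
    rw [← integral_const_mul]
    congr 1 with x
    rw [truncated_congr_ae (Lp.coeFn_smul c f)]
    have := truncated_const_mul (K := K) (ε := ε) μ c f x
    rw [← mul_assoc, ← this]
    rfl
  have add_right : ∀ f g g', B f (g + g') = B f g + B f g' := fun f g g' => by
    refine tendsto_nhds_unique (hB f (g + g')) (((hB f g).add (hB f g')).congr' ?_)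
    filter_upwards [self_mem_nhdsWithin] with ε hε
    have hε : 0 < ε := hε
    rw [← integral_add (hprod ε hε f g) (hprod ε hε f g')]
    refine integral_congr_ae ?_
    filter_upwards [Lp.coeFn_add g g'] with x hx
    rw [hx, Pi.add_apply]
    ring
  have smul_right : ∀ (c : ℝ) f g, B f (c • g) = c * B f g := fun c f g => by
    refine tendsto_nhds_unique (hB f (c • g)) (((hB f g).const_mul c).congr' ?_)
    filter_upwards [self_mem_nhdsWithin] with ε hε
    rw [← integral_const_mul]
    refine integral_congr_ae ?_
    filter_upwards [Lp.coeFn_smul c g] with x hx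
    rw [hx, Pi.smul_apply, smul_eq_mul]
    ring
  have bound : ∀ f g, ‖B f g‖ ≤ √C₀ * ‖f‖ * ‖g‖ := fun f g => by
    refine le_of_tendsto (hB f g).norm ?_
    filter_upwards [self_mem_nhdsWithin] with ε hε
    rw [norm_eq_sqrt, norm_eq_sqrt]
    exact hK.abs_integral_truncated_mul_le hT hε (Lp.memLp f) (Lp.memLp g)
  -- The limits form a bounded bilinear form. The conjugation in its type is the identity over `ℝ`;
  -- it is there to fit the Riesz representation.
  let B₂ : Lp ℝ 2 μ →L⋆[ℝ] Lp ℝ 2 μ →L[ℝ] ℝ :=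
    (LinearMap.mk₂'ₛₗ (starRingEnd ℝ) (RingHom.id ℝ) B add_left
      (fun c f g => by simpa using smul_left c f g) add_right
      (fun c f g => by simpa using smul_right c f g)).mkContinuous₂ (√C₀) bound
  refine ⟨InnerProductSpace.continuousLinearMapOfBilin B₂, fun f g => ?_⟩
  have h1 := InnerProductSpace.continuousLinearMapOfBilin_apply B₂ f g
  have h2 : B₂ f g = B f g := rfl
  rw [L2.inner_def] at h1
  have h3 : ∫ x, (InnerProductSpace.continuousLinearMapOfBilin B₂ f : X → ℝ) x * g x ∂μ = B f g := by
    rw [← h2, ← h1]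
    congr 1 with x
    simp [mul_comm]
  rw [h3]
  exact hB f g

end IsCZKernel

theorem IsWeakLimit.unique {K : X → X → ℝ} {T T' : Lp ℝ 2 μ →L[ℝ] Lp ℝ 2 μ}
    (hT : IsWeakLimit μ K T) (hT' : IsWeakLimit μ K T') : T = T' := by
  ext1 f
  refine ext_inner_right ℝ fun g => ?_
  have h1 := tendsto_nhds_unique (hT f g) (hT' f g)
  rw [L2.inner_def, L2.inner_def]
  simpa [mul_comm] using h1

end SingularIntegral


/-! ### Differentiation along balls and lower bounds for the measure -/

namespace SingularIntegral

set_option linter.unusedSectionVars false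

variable {X : Type*} [MetricSpace X] [SecondCountableTopology X] [MeasurableSpace X]
  [BorelSpace X] {μ : Measure X} [IsFiniteMeasure μ]

/-- The closed balls form a differentiation basis for `μ`, and almost everywhere their measures
have a polynomial lower bound. -/
structure HasBallDifferentiation (μ : Measure X) : Prop where
  vitaliFamily : ∃ v : VitaliFamily μ, ∀ x,
    Tendsto (fun r => Metric.closedBall x r) (𝓝[>] 0) (v.filterAt x)
  lower_bound : ∃ N : ℕ, ∀ᵐ x ∂μ, ∃ c : ℝ, 0 < c ∧
    ∀ᶠ r in 𝓝[>] 0, c * r ^ N ≤ μ.real (Metric.closedBall x r)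

/-- Satellite configurations are described by distances alone, so an isometry carries them over. -/
theorem hasBesicovitchCovering_of_isometry {Y Z : Type*} [MetricSpace Y] [MetricSpace Z]
    [HasBesicovitchCovering Z] (e : Y ≃ᵢ Z) : HasBesicovitchCovering Y := by
  obtain ⟨N, τ, hτ, hN⟩ := HasBesicovitchCovering.no_satelliteConfig (α := Z)
  refine ⟨N, τ, hτ, ⟨fun s => hN.false ?_⟩⟩
  exact
    { c := fun i => e (s.c i)
      r := s.r
      rpos := s.rpos
      h := fun i j hij => by simpa only [e.dist_eq] using s.h hij
      hlast := fun i hi => by simpa only [e.dist_eq] using s.hlast i hi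
      inter := fun i hi => by simpa only [e.dist_eq] using s.inter i hi }

/-- The lower bound comes from differentiating Lebesgue measure `l` with respect to `μ`: the
derivative is finite `μ`-almost everywhere, so `l(B) ≤ d * μ(B)` for small balls, and `l(B)` is a
multiple of `r ^ n`. -/
theorem IsEuclidean.hasBallDifferentiation (hX : IsEuclidean X) : HasBallDifferentiation μ := by
  obtain ⟨n, ⟨e⟩⟩ := hX
  have := hasBesicovitchCovering_of_isometry e
  refine ⟨⟨Besicovitch.vitaliFamily μ, Besicovitch.tendsto_filterAt μ⟩, n, ?_⟩
  set l : Measure X := (volume : Measure (EuclideanSpace ℝ (Fin n))).map e.symm with hl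
  have hlb : ∀ (x : X) {r : ℝ}, 0 ≤ r → l (Metric.closedBall x r) =
      ENNReal.ofReal (r ^ n) * volume (Metric.ball (0 : EuclideanSpace ℝ (Fin n)) 1) := by
    intro x r hr
    rw [hl, Measure.map_apply e.symm.continuous.measurable
      Metric.isClosed_closedBall.measurableSet, e.symm.preimage_closedBall, e.symm_symm,
      Measure.addHaar_closedBall _ _ hr, finrank_euclideanSpace_fin]
  set V := volume (Metric.ball (0 : EuclideanSpace ℝ (Fin n)) 1) with hV
  have hV0 : 0 < V := Metric.measure_ball_pos _ _ one_pos
  have hVt : V < ∞ := measure_ball_lt_top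
  have : IsLocallyFiniteMeasure l := ⟨fun x => ⟨Metric.closedBall x 1,
    Metric.closedBall_mem_nhds x one_pos, by
      rw [hlb x zero_le_one]
      exact ENNReal.mul_lt_top ENNReal.ofReal_lt_top hVt⟩⟩
  filter_upwards [VitaliFamily.ae_tendsto_rnDeriv (Besicovitch.vitaliFamily μ) l,
    Measure.rnDeriv_lt_top l μ] with x hx hx'
  have h1 := hx.comp (Besicovitch.tendsto_filterAt μ x)
  set d := l.rnDeriv μ x + 1 with hd
  have hdt : d < ∞ := ENNReal.add_lt_top.2 ⟨hx', ENNReal.one_lt_top⟩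
  have hlt : l.rnDeriv μ x < d := ENNReal.lt_add_right hx'.ne one_ne_zero
  have hd0 : d ≠ 0 := (zero_le.trans_lt hlt).ne'
  have hdr : 0 < d.toReal := ENNReal.toReal_pos hd0 hdt.ne
  refine ⟨V.toReal / d.toReal, div_pos (ENNReal.toReal_pos hV0.ne' hVt.ne) hdr, ?_⟩
  filter_upwards [h1.eventually (gt_mem_nhds hlt), self_mem_nhdsWithin] with r hr hr0
  have hr0 : 0 < r := hr0
  have h2 : l (Metric.closedBall x r) ≤ d * μ (Metric.closedBall x r) :=
    (ENNReal.div_le_iff_le_mul (Or.inr hdt.ne) (Or.inr hd0)).1 (le_of_lt hr)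
  rw [hlb x hr0.le] at h2
  have h3 := ENNReal.toReal_mono (ENNReal.mul_ne_top hdt.ne (measure_ne_top _ _)) h2
  rw [ENNReal.toReal_mul, ENNReal.toReal_mul, ENNReal.toReal_ofReal (by positivity)] at h3
  rw [div_mul_eq_mul_div, div_le_iff₀ hdr, Measure.real]
  linarith

/-- The Vitali family needs the inequality only for small radii. Off the support it is trivial,
since small balls there have measure zero. The lower bound follows by iterating doubling from radius
1, with `2 ^ N` larger than the constant. -/
theorem IsDoubling.hasBallDifferentiation (hμ : IsDoubling μ) : HasBallDifferentiation μ := by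
  obtain ⟨C, hC⟩ := hμ
  have hball : ∀ x ∈ μ.support, ∀ r : ℝ, 0 < r → μ (Metric.closedBall x (3 * r)) ≤
      (C ^ 2 : ℝ≥0) * μ (Metric.closedBall x r) := by
    intro x hx r hr
    calc μ (Metric.closedBall x (3 * r)) ≤ μ (Metric.ball x (2 * (2 * r))) :=
          measure_mono (Metric.closedBall_subset_ball (by linarith))
      _ ≤ C * μ (Metric.ball x (2 * r)) := hC x hx _ (by positivity)
      _ ≤ C * (C * μ (Metric.ball x r)) := by
          gcongr
          exact hC x hx _ hr
      _ ≤ C * (C * μ (Metric.closedBall x r)) := by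
          gcongr
          exact Metric.ball_subset_closedBall
      _ = _ := by
          push_cast
          ring
  have hev : ∀ x, ∀ᶠ r in 𝓝[>] (0 : ℝ), μ (Metric.closedBall x (3 * r)) ≤
      (C ^ 2 : ℝ≥0) * μ (Metric.closedBall x r) := by
    intro x
    by_cases hx : x ∈ μ.support
    · filter_upwards [self_mem_nhdsWithin] with r hr using hball x hx r hr
    · obtain ⟨U, hU, hU0⟩ := Measure.notMem_support_iff_exists.1 hx
      obtain ⟨δ, hδ, hδU⟩ := Metric.mem_nhds_iff.1 hU
      filter_upwards [Ioo_mem_nhdsGT (show 0 < δ / 3 by positivity)] with r hr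
      have : μ (Metric.closedBall x (3 * r)) = 0 := measure_mono_null
        ((Metric.closedBall_subset_ball (by linarith [hr.2])).trans hδU) hU0
      rw [this]
      exact zero_le
  refine ⟨⟨Vitali.vitaliFamily μ (C ^ 2) fun x => (hev x).frequently, fun x => ?_⟩, ?_⟩
  · rw [VitaliFamily.tendsto_filterAt_iff]
    refine ⟨?_, fun ε hε => ?_⟩
    · filter_upwards [hev x, self_mem_nhdsWithin] with r hr hr0
      refine ⟨Metric.isClosed_closedBall, ?_, r, Subset.rfl, hr⟩
      exact (Metric.nonempty_ball.2 hr0).mono Metric.ball_subset_interior_closedBall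
    · filter_upwards [Ioo_mem_nhdsGT hε] with r hr
      exact Metric.closedBall_subset_closedBall hr.2.le
  · obtain ⟨N, hN⟩ := pow_unbounded_of_one_lt (max C 1 : ℝ) one_lt_two
    refine ⟨N, ?_⟩
    filter_upwards [Measure.support_mem_ae (μ := μ)] with x hx
    have hb1 : 0 < μ.real (Metric.ball x 1) := ENNReal.toReal_pos
      (((Measure.mem_support_iff_forall x).1 hx _ (Metric.ball_mem_nhds x one_pos)).ne')
      (measure_ne_top _ _)
    have hstep : ∀ k : ℕ, μ.real (Metric.ball x 1) * ((1 / 2) ^ k) ^ N ≤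
        μ.real (Metric.ball x ((1 / 2) ^ k)) := by
      intro k
      induction k with
      | zero => simp
      | succ k ih =>
        have h1 := hC x hx ((1 / 2) ^ (k + 1)) (by positivity)
        have h2 : μ.real (Metric.ball x ((1 / 2) ^ k)) ≤
            C * μ.real (Metric.ball x ((1 / 2) ^ (k + 1))) := by
          have := ENNReal.toReal_mono (ENNReal.mul_ne_top ENNReal.coe_ne_top (measure_ne_top _ _)) h1
          rw [ENNReal.toReal_mul, show (2 : ℝ) * (1 / 2) ^ (k + 1) = (1 / 2) ^ k by ring] at this
          exact this
        have h3 : (C : ℝ) ≤ 2 ^ N := ((le_max_left _ _).trans hN.le)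
        have h4 : 0 ≤ μ.real (Metric.ball x ((1 / 2) ^ (k + 1))) := measureReal_nonneg
        have h5 : μ.real (Metric.ball x 1) * ((1 / 2) ^ k) ^ N ≤
            2 ^ N * μ.real (Metric.ball x ((1 / 2) ^ (k + 1))) :=
          ih.trans (h2.trans (by gcongr))
        rw [pow_succ, mul_pow, one_div, inv_pow 2 N, ← mul_assoc, ← div_eq_mul_inv,
          div_le_iff₀ (by positivity)]
        rw [one_div, pow_succ 2⁻¹ k] at h5
        linarith
    refine ⟨μ.real (Metric.ball x 1) * (1 / 2) ^ N, by positivity, ?_⟩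
    filter_upwards [Ioo_mem_nhdsGT (show (0 : ℝ) < 1 by norm_num)] with r hr
    obtain ⟨k, hk, hk'⟩ := exists_nat_pow_near_of_lt_one (x := r) (y := 1 / 2)
      hr.1 hr.2.le (by norm_num) (by norm_num)
    have hr0 := hr.1
    calc μ.real (Metric.ball x 1) * (1 / 2) ^ N * r ^ N
        = μ.real (Metric.ball x 1) * ((1 / 2) * r) ^ N := by rw [mul_pow]; ring
      _ ≤ μ.real (Metric.ball x 1) * ((1 / 2) ^ (k + 1)) ^ N := by
          gcongr
          rw [pow_succ]
          linarith
      _ ≤ μ.real (Metric.ball x ((1 / 2) ^ (k + 1))) := hstep (k + 1)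
      _ ≤ μ.real (Metric.closedBall x r) :=
          measureReal_mono (Metric.ball_subset_closedBall.trans
            (Metric.closedBall_subset_closedBall hk.le))

namespace HasBallDifferentiation

theorem ae_eventually_setIntegral_abs_sub_le (hμ : HasBallDifferentiation μ) {g : X → ℝ}
    (hg : Integrable g μ) :
    ∀ᵐ x ∂μ, ∀ η > 0, ∀ᶠ r in 𝓝[>] 0,
      ∫ y in Metric.closedBall x r, |g y - g x| ∂μ ≤ η * μ.real (Metric.closedBall x r) := by
  obtain ⟨v, hv⟩ := hμ.vitaliFamily
  filter_upwards [v.ae_tendsto_average_norm_sub hg.locallyIntegrable] with x hx η hη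
  filter_upwards [(hx.comp (hv x)).eventually (gt_mem_nhds hη)] with r hr
  simp only [Function.comp_apply, setAverage_eq, smul_eq_mul, Real.norm_eq_abs] at hr
  -- On a ball of measure zero the average carries no information, but both sides vanish.
  rcases (measureReal_nonneg (μ := μ) (s := Metric.closedBall x r)).eq_or_lt with h0 | h0
  · rw [← h0, mul_zero, setIntegral_measure_zero]
    rw [← ofReal_measureReal, ← h0, ENNReal.ofReal_zero]
  · rw [inv_mul_lt_iff₀ h0] at hr
    linarith

theorem ae_eventually_measureReal_diff_le (hμ : HasBallDifferentiation μ) {E : Set X}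
    (hE : MeasurableSet E) :
    ∀ᵐ x ∂μ, x ∈ E → ∀ η > 0, ∀ᶠ r in 𝓝[>] 0,
      μ.real (Metric.closedBall x r \ E) ≤ η * μ.real (Metric.closedBall x r) := by
  have hi : Integrable (E.indicator (1 : X → ℝ)) μ := (integrable_const 1).indicator hE
  filter_upwards [hμ.ae_eventually_setIntegral_abs_sub_le hi] with x hx hxE η hη
  filter_upwards [hx η hη] with r hr
  refine le_trans (le_of_eq ?_) hr
  have hB : MeasurableSet (Metric.closedBall x r) := Metric.isClosed_closedBall.measurableSet
  rw [← integral_indicator_one (hB.diff hE), ← integral_indicator hB]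
  congr 1 with y
  by_cases hy : y ∈ Metric.closedBall x r <;> by_cases hyE : y ∈ E <;> simp [hy, hyE, hxE]

/-- Approximate continuity of a function that need not be integrable: composition with the strictly
increasing bounded function arctan makes it integrable, and Markov's inequality at a Lebesgue point
gives the claim. -/
theorem ae_eventually_measureReal_abs_sub_lt (hμ : HasBallDifferentiation μ) {U : X → ℝ}
    (hU : AEStronglyMeasurable U μ) :
    ∀ᵐ x ∂μ, ∀ η > 0, ∀ κ > 0, ∀ᶠ r in 𝓝[>] 0,
      μ.real {z ∈ Metric.closedBall x r | η < |U z - U x|} ≤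
        κ * μ.real (Metric.closedBall x r) := by
  have hi : Integrable (fun x => Real.arctan (U x)) μ :=
    Integrable.of_bound (Real.continuous_arctan.comp_aestronglyMeasurable hU) (Real.pi / 2)
      (Eventually.of_forall fun x => abs_le.2
        ⟨(Real.neg_pi_div_two_lt_arctan _).le, (Real.arctan_lt_pi_div_two _).le⟩)
  filter_upwards [hμ.ae_eventually_setIntegral_abs_sub_le hi] with x hx η hη κ hκ
  -- The smallest change of arctan that a change of `U` by more than `η` from `U x` can produce.
  set η' := min (Real.arctan (U x + η) - Real.arctan (U x))
    (Real.arctan (U x) - Real.arctan (U x - η)) with hη'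
  have hη'0 : 0 < η' := by
    refine lt_min ?_ ?_ <;> rw [sub_pos] <;> exact Real.arctan_strictMono (by linarith)
  filter_upwards [hx (η' * κ) (by positivity)] with r hr
  have hsub : ∀ z, η < |U z - U x| → η' ≤ |Real.arctan (U z) - Real.arctan (U x)| := by
    intro z hz
    rcases lt_abs.1 hz with h1 | h1
    · refine (min_le_left _ _).trans (le_trans ?_ (le_abs_self _))
      have : Real.arctan (U x + η) ≤ Real.arctan (U z) :=
        Real.arctan_strictMono.monotone (by linarith)
      linarith
    · refine (min_le_right _ _).trans (le_trans ?_ (neg_le_abs _))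
      have : Real.arctan (U z) ≤ Real.arctan (U x - η) :=
        Real.arctan_strictMono.monotone (by linarith)
      linarith
  have hmk := mul_meas_ge_le_integral_of_nonneg (μ := μ.restrict (Metric.closedBall x r))
    (f := fun z => |Real.arctan (U z) - Real.arctan (U x)|)
    (Eventually.of_forall fun z => abs_nonneg _)
    ((hi.sub (integrable_const _)).abs.restrict) η'
  have h2 : μ.real {z ∈ Metric.closedBall x r | η < |U z - U x|} ≤
      (μ.restrict (Metric.closedBall x r)).real
        {z | η' ≤ |Real.arctan (U z) - Real.arctan (U x)|} := by
    have hB : MeasurableSet (Metric.closedBall x r) := Metric.isClosed_closedBall.measurableSet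
    rw [Measure.real, Measure.real, Measure.restrict_apply' hB]
    refine ENNReal.toReal_mono (measure_ne_top _ _) (measure_mono ?_)
    rintro z ⟨hz, hz'⟩
    exact ⟨hsub z hz', hz⟩
  refine h2.trans ?_
  have h3 := hmk.trans hr
  rw [mul_assoc] at h3
  exact le_of_mul_le_mul_left h3 hη'0

end HasBallDifferentiation

/-! ### Sets of uniform zero density -/

/-- The density of `μ` with respect to the gauge `h` tends to zero, uniformly on `E`. -/
def HasUniformZeroDensity (μ : Measure X) (h : ℝ → ℝ) (E : Set X) : Prop :=
  ∀ η > 0, ∃ R > 0, ∀ y ∈ E, ∀ s, 0 < s → s ≤ R → μ.real (Metric.ball y s) ≤ η * h s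

/-- The measure of open balls of a fixed radius is lower semicontinuous in the centre, by continuity
from below. Closedness survives the uncountable intersection over radii in the Egorov argument that
follows, where measurability alone would not. -/
theorem isClosed_setOf_measureReal_ball_le (s a : ℝ) :
    IsClosed {y : X | μ.real (Metric.ball y s) ≤ a} := by
  rw [← isOpen_compl_iff, Metric.isOpen_iff]
  intro y hy
  have hy' : a < μ.real (Metric.ball y s) := not_le.1 hy
  have hU : ⋃ n : ℕ, Metric.ball y (s - 1 / (n + 1)) = Metric.ball y s := by
    refine Subset.antisymm (iUnion_subset fun n => Metric.ball_subset_ball ?_) fun z hz => ?_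
    · have : (0 : ℝ) < 1 / (n + 1) := by positivity
      linarith
    · obtain ⟨n, hn⟩ := exists_nat_one_div_lt (sub_pos.2 (Metric.mem_ball.1 hz))
      refine mem_iUnion.2 ⟨n, ?_⟩
      rw [Metric.mem_ball]
      linarith
  have hmono : Monotone fun n : ℕ => Metric.ball y (s - 1 / ((n : ℝ) + 1)) := by
    intro n m hnm
    refine Metric.ball_subset_ball ?_
    have : (1 : ℝ) / (m + 1) ≤ 1 / (n + 1) := Nat.one_div_le_one_div hnm
    linarith
  have hlim := tendsto_measure_iUnion_atTop (μ := μ) hmono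
  rw [hU] at hlim
  have hlim' := (ENNReal.tendsto_toReal (measure_ne_top μ _)).comp hlim
  obtain ⟨n, hn⟩ := (hlim'.eventually (lt_mem_nhds hy')).exists
  refine ⟨1 / (n + 1), by positivity, fun z hz => not_le.2 (lt_of_lt_of_le hn ?_)⟩
  refine measureReal_mono (Metric.ball_subset_ball' ?_)
  rw [dist_comm]
  linarith [Metric.mem_ball.1 hz]

theorem exists_hasUniformZeroDensity {h : ℝ → ℝ} (h_pos : ∀ r : ℝ, 0 < r → 0 < h r)
    (hd : ∀ᵐ x ∂μ, Tendsto (fun r : ℝ => μ.real (Metric.ball x r) / h r) (𝓝[>] 0) (𝓝 0))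
    {δ : ℝ≥0∞} (hδ : δ ≠ 0) :
    ∃ E : Set X, MeasurableSet E ∧ μ Eᶜ ≤ δ ∧ HasUniformZeroDensity μ h E := by
  -- Egorov's argument: for every tolerance `1 / (n + 1)` the sets increase with `m` to almost all
  -- of the space, and `m n` is chosen so that the omitted measures sum to less than `δ`.
  set G : ℕ → ℕ → Set X := fun n m => ⋂ s ∈ Ioc (0 : ℝ) (1 / (m + 1)),
    {y : X | μ.real (Metric.ball y s) ≤ h s / (n + 1)} with hG
  have hGc : ∀ n m, IsClosed (G n m) := fun n m =>
    isClosed_biInter fun s _ => isClosed_setOf_measureReal_ball_le _ _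
  have hanti : ∀ n, Antitone fun m => (G n m)ᶜ := by
    intro n m m' hm
    refine compl_subset_compl.2 (biInter_mono (Ioc_subset_Ioc_right ?_) fun _ _ => Subset.rfl)
    exact Nat.one_div_le_one_div hm
  have hnull : ∀ n, μ (⋂ m, (G n m)ᶜ) = 0 := by
    intro n
    refine measure_mono_null (fun x hx => ?_) (ae_iff.1 hd)
    intro hx'
    have hlt : (0 : ℝ) < 1 / (n + 1) := by positivity
    have hev := hx'.eventually (gt_mem_nhds hlt)
    obtain ⟨δ, hδ, hδs⟩ := mem_nhdsGT_iff_exists_Ioo_subset.1 hev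
    obtain ⟨m, hm⟩ := exists_nat_one_div_lt (show (0 : ℝ) < δ from hδ)
    refine mem_iInter.1 hx m (mem_iInter₂.2 fun s hs => ?_)
    have h1 : μ.real (Metric.ball x s) / h s < 1 / (n + 1) := hδs ⟨hs.1, hs.2.trans_lt hm⟩
    rw [div_lt_iff₀ (h_pos s hs.1)] at h1
    show μ.real (Metric.ball x s) ≤ h s / (n + 1)
    rw [div_eq_mul_one_div]
    linarith
  obtain ⟨δ', hδ', hδs⟩ := ENNReal.exists_pos_sum_of_countable' hδ ℕ
  have hm : ∀ n, ∃ m, μ (G n m)ᶜ ≤ δ' n := by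
    intro n
    have := tendsto_measure_iInter_atTop (μ := μ)
      (fun m => (hGc n m).measurableSet.compl.nullMeasurableSet) (hanti n)
      ⟨0, measure_ne_top _ _⟩
    rw [hnull n] at this
    obtain ⟨m, hm⟩ := (this.eventually (gt_mem_nhds (hδ' n))).exists
    exact ⟨m, hm.le⟩
  choose m hm using hm
  refine ⟨⋂ n, G n (m n), MeasurableSet.iInter fun n => (hGc n _).measurableSet, ?_, ?_⟩
  · rw [compl_iInter]
    exact (measure_iUnion_le _).trans ((ENNReal.tsum_le_tsum hm).trans hδs.le)
  · intro η hη
    obtain ⟨n, hn⟩ := exists_nat_one_div_lt hη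
    refine ⟨1 / (m n + 1), by positivity, fun y hy s hs hs' => ?_⟩
    have h1 := mem_iInter₂.1 (mem_iInter.1 hy n) s ⟨hs, hs'⟩
    have h2 : μ.real (Metric.ball y s) ≤ h s / (n + 1) := h1
    have h3 := h_pos s hs
    calc μ.real (Metric.ball y s) ≤ 1 / (n + 1) * h s := h2.trans_eq (by ring)
      _ ≤ η * h s := by gcongr

theorem ae_of_forall_hasUniformZeroDensity {h : ℝ → ℝ} (h_pos : ∀ r : ℝ, 0 < r → 0 < h r)
    (hd : ∀ᵐ x ∂μ, Tendsto (fun r : ℝ => μ.real (Metric.ball x r) / h r) (𝓝[>] 0) (𝓝 0))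
    {P : X → Prop} (hP : ∀ E : Set X, MeasurableSet E → HasUniformZeroDensity μ h E →
      ∀ᵐ x ∂μ, x ∈ E → P x) : ∀ᵐ x ∂μ, P x := by
  have hex : ∀ n : ℕ, ∃ E : Set X, MeasurableSet E ∧ μ Eᶜ ≤ (n : ℝ≥0∞)⁻¹ ∧
      HasUniformZeroDensity μ h E := fun n =>
    exists_hasUniformZeroDensity h_pos hd (by simp)
  choose E hEm hEμ hE using hex
  have h1 : ∀ᵐ x ∂μ, ∀ n, x ∈ E n → P x := ae_all_iff.2 fun n => hP _ (hEm n) (hE n)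
  have h2 : ∀ᵐ x ∂μ, ∃ n, x ∈ E n := by
    rw [ae_iff]
    refine le_antisymm (ge_of_tendsto' ENNReal.tendsto_inv_nat_nhds_zero fun n => ?_) zero_le
    have hsub : {x | ¬∃ n, x ∈ E n} ⊆ (E n)ᶜ := fun x hx hxn => hx ⟨n, hxn⟩
    exact (measure_mono hsub).trans (hEμ n)
  filter_upwards [h1, h2] with x hx ⟨n, hn⟩ using hx n hn

end SingularIntegral


/-! ### Doubling scales and the far part of the operator -/

namespace SingularIntegral

set_option linter.unusedSectionVars false

variable {X : Type*} [MetricSpace X] [SecondCountableTopology X] [MeasurableSpace X]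
  [BorelSpace X] {μ : Measure X} [IsFiniteMeasure μ]

/-- If the measure has a polynomial lower bound at `x`, then above every small radius there is
a radius where the measure is doubling at `x`; the first such radius is taken. -/
theorem eventually_exists_doubling_scale {x : X} {N : ℕ} {c : ℝ} (hc : 0 < c)
    (hlow : ∀ᶠ r in 𝓝[>] 0, c * r ^ N ≤ μ.real (Metric.closedBall x r)) {A : ℝ}
    (hA : 16 ^ (N + 1) ≤ A) {R : ℝ} (hR : 0 < R) :
    ∀ᶠ ε in 𝓝[>] 0, ∃ k : ℕ, 16 ^ k * ε ≤ R ∧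
      μ.real (Metric.closedBall x (16 * (16 ^ k * ε))) ≤
        A * μ.real (Metric.closedBall x (16 ^ k * ε)) ∧
      ∀ j < k, A * μ.real (Metric.closedBall x (16 ^ j * ε)) ≤
        μ.real (Metric.closedBall x (16 ^ (j + 1) * ε)) := by
  classical
  have hA0 : 0 < A := lt_of_lt_of_le (by positivity) hA
  set M := μ.real univ with hM
  have hM0 : 0 ≤ M := measureReal_nonneg
  filter_upwards [hlow, Ioo_mem_nhdsGT (show 0 < min R (R ^ (N + 1) * c / (M + 1)) by positivity)]
    with ε hε hε'
  have hε0 : 0 < ε := hε'.1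
  have hεR : ε < R := hε'.2.trans_le (min_le_left _ _)
  have hεM : ε < R ^ (N + 1) * c / (M + 1) := hε'.2.trans_le (min_le_right _ _)
  have hex : ∃ k : ℕ, 16 ^ k * ε ≤ R ∧ μ.real (Metric.closedBall x (16 * (16 ^ k * ε))) ≤
      A * μ.real (Metric.closedBall x (16 ^ k * ε)) := by
    -- If no radius `16 ^ k * ε ≤ R` were doubling, the mass would grow by the factor `A ≥ 16 ^ (N +
    -- 1)` at each step, from at least `c * ε ^ N` to at least `R ^ (N + 1) * c / ε`. The extra
    -- power beyond `N` leaves the factor `1 / ε`, which exceeds the total mass for small `ε`.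
    by_contra! hcon
    obtain ⟨n, hn, hn'⟩ := exists_nat_pow_near (x := R / ε) (y := 16)
      ((one_le_div hε0).2 hεR.le) (by norm_num)
    have hstep : ∀ j ≤ n + 1, A ^ j * μ.real (Metric.closedBall x ε) ≤
        μ.real (Metric.closedBall x (16 ^ j * ε)) := by
      intro j hj
      induction j with
      | zero => simp
      | succ j ih =>
        have h1 : (16 : ℝ) ^ j * ε ≤ R := by
          rw [← le_div_iff₀ hε0]
          refine le_trans ?_ hn
          gcongr
          · norm_num
          · omega
        have h2 := hcon j h1
        calc A ^ (j + 1) * μ.real (Metric.closedBall x ε)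
            = A * (A ^ j * μ.real (Metric.closedBall x ε)) := by ring
          _ ≤ A * μ.real (Metric.closedBall x (16 ^ j * ε)) := by
              have := ih (by omega)
              gcongr
          _ ≤ _ := by
              rw [show (16 : ℝ) ^ (j + 1) * ε = 16 * (16 ^ j * ε) by ring]
              exact h2.le
    have h1 := (hstep (n + 1) le_rfl).trans (measureReal_mono (subset_univ _))
    have h2 : (R / ε) ^ (N + 1) * (c * ε ^ N) ≤ M := by
      refine le_trans ?_ h1
      gcongr
      calc (R / ε) ^ (N + 1) ≤ (16 ^ (n + 1)) ^ (N + 1) := by gcongr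
        _ = (16 ^ (N + 1)) ^ (n + 1) := by rw [← pow_mul, ← pow_mul, mul_comm]
        _ ≤ A ^ (n + 1) := by gcongr
    have h3 : (R / ε) ^ (N + 1) * (c * ε ^ N) = R ^ (N + 1) * c / ε := by
      rw [div_pow]
      field_simp
      ring
    rw [h3, div_le_iff₀ hε0] at h2
    rw [lt_div_iff₀ (by positivity)] at hεM
    nlinarith
  refine ⟨Nat.find hex, (Nat.find_spec hex).1, (Nat.find_spec hex).2, fun j hj => ?_⟩
  have h1 := Nat.find_min hex hj
  have h2 : (16 : ℝ) ^ j * ε ≤ R := by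
    refine le_trans ?_ (Nat.find_spec hex).1
    gcongr
    norm_num
  by_contra! hlt
  refine h1 ⟨h2, ?_⟩
  rw [show (16 : ℝ) ^ (j + 1) * ε = 16 * (16 ^ j * ε) by ring] at hlt
  exact hlt.le

namespace IsCZKernel

variable {K : X → X → ℝ} {h : ℝ → ℝ} {C : ℝ}

theorem abs_truncated_sub_truncated_le (hK : IsCZKernel μ K h C) {ε ε' : ℝ} (hε : 0 < ε)
    (hεε' : ε ≤ ε') (x : X) {f : X → ℝ} (hf : Integrable f μ) :
    |truncated μ K ε f x - truncated μ K ε' f x| ≤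
      (∫ y in Metric.closedBall x ε', |f y| ∂μ) / h ε := by
  have hB : MeasurableSet (Metric.closedBall x ε') := Metric.isClosed_closedBall.measurableSet
  rw [truncated_eq_integral, truncated_eq_integral,
    ← integral_sub (hK.integrable_truncKernel_mul hε x hf)
      (hK.integrable_truncKernel_mul (hε.trans_le hεε') x hf), ← integral_indicator hB,
    div_eq_inv_mul, ← integral_const_mul]
  refine abs_integral_le_integral_abs.trans (integral_mono_of_nonneg
    (Eventually.of_forall fun y => abs_nonneg _) ((hf.abs.indicator hB).const_mul _)
    (Eventually.of_forall fun y => ?_))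
  dsimp only
  have hpos := hK.pos _ hε
  rw [← sub_mul, abs_mul]
  by_cases hy : ε' ≤ dist x y
  · rw [truncKernel_of_le hy, truncKernel_of_le (hεε'.trans hy), sub_self, abs_zero, zero_mul]
    exact mul_nonneg (by positivity) (indicator_nonneg (fun _ _ => abs_nonneg _) _)
  · rw [truncKernel_of_lt (not_le.1 hy), sub_zero, indicator_of_mem]
    · gcongr
      rw [inv_eq_one_div]
      exact hK.abs_truncKernel_le hε x y
    · rw [Metric.mem_closedBall, dist_comm]
      exact (not_le.1 hy).le

/-- A step of the radius from `r` to `16 * r` costs at most a multiple of `μ(B) / h` at the larger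
radius, and `h` grows by at most `C ^ 4`. With `A ≥ 2 * C ^ 4` each nondoubling step at least
doubles `μ(B) / h`, so the costs form a geometric series controlled by its last term. -/
theorem abs_truncated_sub_truncated_pow_le (hK : IsCZKernel μ K h C) {x : X} {f : X → ℝ}
    (hf : Integrable f μ) {F A ε : ℝ} (hF : 0 ≤ F) (hA : 2 * C ^ 4 ≤ A) (hε : 0 < ε) (k : ℕ)
    (hfF : ∀ j ≤ k, ∫ y in Metric.closedBall x (16 ^ j * ε), |f y| ∂μ ≤
      F * μ.real (Metric.closedBall x (16 ^ j * ε)))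
    (hk : ∀ j < k, A * μ.real (Metric.closedBall x (16 ^ j * ε)) ≤
        μ.real (Metric.closedBall x (16 ^ (j + 1) * ε))) :
    |truncated μ K ε f x - truncated μ K (16 ^ k * ε) f x| ≤
      2 * F * C ^ 4 * (μ.real (Metric.closedBall x (16 ^ k * ε)) / h (16 ^ k * ε)) := by
  have hC := hK.one_le
  induction k with
  | zero =>
    have hpos := hK.pos _ hε
    simp only [pow_zero, one_mul, sub_self, abs_zero]
    positivity
  | succ k ih =>
    have ih' := ih (fun j hj => hfF j (by omega)) fun j hj => hk j (by omega)
    have hρ : 0 < 16 ^ k * ε := by positivity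
    have hρ' : (16 : ℝ) ^ (k + 1) * ε = 2 ^ 4 * (16 ^ k * ε) := by ring
    have hle : (16 : ℝ) ^ k * ε ≤ 16 ^ (k + 1) * ε := by
      gcongr <;> norm_num
    have h1 := hK.abs_truncated_sub_truncated_le hρ hle x hf
    have h2 := hfF (k + 1) le_rfl
    have h3 := hk k (by omega)
    have hp := hK.pos _ hρ
    have hp' := hK.pos _ (hρ.trans_le hle)
    have h4 : h (16 ^ (k + 1) * ε) ≤ C ^ 4 * h (16 ^ k * ε) := by
      rw [hρ']
      exact hK.le_pow_mul 4 hρ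
    set q := μ.real (Metric.closedBall x (16 ^ k * ε))
    set q' := μ.real (Metric.closedBall x (16 ^ (k + 1) * ε))
    have hq : 0 ≤ q := measureReal_nonneg
    have hq' : 0 ≤ q' := measureReal_nonneg
    have h5 : 1 / h (16 ^ k * ε) ≤ C ^ 4 / h (16 ^ (k + 1) * ε) := by
      rw [div_le_div_iff₀ hp hp']
      linarith
    have h6 : q / h (16 ^ k * ε) ≤ 1 / 2 * (q' / h (16 ^ (k + 1) * ε)) := by
      have : 2 * C ^ 4 * q ≤ q' := le_trans (by gcongr) h3
      calc q / h (16 ^ k * ε) = q * (1 / h (16 ^ k * ε)) := by ring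
        _ ≤ q * (C ^ 4 / h (16 ^ (k + 1) * ε)) := by gcongr
        _ = 1 / 2 * (2 * C ^ 4 * q / h (16 ^ (k + 1) * ε)) := by ring
        _ ≤ _ := by gcongr
    have h7 : (∫ y in Metric.closedBall x (16 ^ (k + 1) * ε), |f y| ∂μ) / h (16 ^ k * ε) ≤
        F * C ^ 4 * (q' / h (16 ^ (k + 1) * ε)) := by
      calc (∫ y in Metric.closedBall x (16 ^ (k + 1) * ε), |f y| ∂μ) / h (16 ^ k * ε)
          ≤ (F * q') * (1 / h (16 ^ k * ε)) := by
            rw [div_eq_mul_one_div]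
            gcongr
        _ ≤ (F * q') * (C ^ 4 / h (16 ^ (k + 1) * ε)) := by gcongr
        _ = _ := by ring
    calc |truncated μ K ε f x - truncated μ K (16 ^ (k + 1) * ε) f x|
        ≤ |truncated μ K ε f x - truncated μ K (16 ^ k * ε) f x| +
          |truncated μ K (16 ^ k * ε) f x - truncated μ K (16 ^ (k + 1) * ε) f x| :=
          abs_sub_le _ _ _
      _ ≤ 2 * F * C ^ 4 * (1 / 2 * (q' / h (16 ^ (k + 1) * ε))) +
          F * C ^ 4 * (q' / h (16 ^ (k + 1) * ε)) := by
          refine add_le_add (ih'.trans ?_) (h1.trans h7)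
          gcongr
      _ = _ := by ring

/-- The truncations converge if they converge along the doubling scales. -/
theorem tendsto_truncated_of_doubling_scales (hK : IsCZKernel μ K h C) {x : X} {f : X → ℝ}
    (hf : Integrable f μ) {N : ℕ} {c F A l : ℝ} (hc : 0 < c)
    (hlow : ∀ᶠ r in 𝓝[>] 0, c * r ^ N ≤ μ.real (Metric.closedBall x r))
    (hA : 16 ^ (N + 1) ≤ A) (hA' : 2 * C ^ 4 ≤ A) (hF : 0 ≤ F)
    (hfF : ∀ᶠ r in 𝓝[>] 0, ∫ y in Metric.closedBall x r, |f y| ∂μ ≤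
      F * μ.real (Metric.closedBall x r))
    (hd : Tendsto (fun r => μ.real (Metric.closedBall x r) / h r) (𝓝[>] 0) (𝓝 0))
    (hl : Tendsto (fun ρ => truncated μ K ρ f x) (𝓝[>] 0 ⊓ 𝓟 {ρ |
      μ.real (Metric.closedBall x (16 * ρ)) ≤ A * μ.real (Metric.closedBall x ρ)}) (𝓝 l)) :
    Tendsto (fun ε => truncated μ K ε f x) (𝓝[>] 0) (𝓝 l) := by
  have hC := hK.nonneg_const
  rw [Metric.tendsto_nhds] at hl ⊢
  intro η hη
  have h1 := hl (η / 2) (by positivity)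
  rw [eventually_inf_principal] at h1
  have h2 : ∀ᶠ r in 𝓝[>] 0,
      2 * F * C ^ 4 * (μ.real (Metric.closedBall x r) / h r) < η / 2 := by
    have := hd.const_mul (2 * F * C ^ 4)
    rw [mul_zero] at this
    exact this.eventually (gt_mem_nhds (by positivity))
  obtain ⟨R, hR, hRs⟩ := mem_nhdsGT_iff_exists_Ioo_subset.1 (h1.and (h2.and hfF))
  have hR : 0 < R := hR
  filter_upwards [eventually_exists_doubling_scale hc hlow hA (half_pos hR), self_mem_nhdsWithin]
    with ε ⟨k, hk, hkd, hkj⟩ hε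
  have hε : 0 < ε := hε
  have hρ : 0 < 16 ^ k * ε := by positivity
  obtain ⟨g1, g2, -⟩ := hRs ⟨hρ, by linarith⟩
  have g3 := hK.abs_truncated_sub_truncated_pow_le hf hF hA' hε k (fun j hj => by
    have hle : (16 : ℝ) ^ j * ε ≤ 16 ^ k * ε := by
      gcongr
      norm_num
    exact (hRs ⟨by positivity, by linarith⟩).2.2) hkj
  have g4 := g1 hkd
  rw [Real.dist_eq] at g4 ⊢
  have := abs_sub_le (truncated μ K ε f x) (truncated μ K (16 ^ k * ε) f x) l
  linarith

/-- Smoothness bounds `|K z y - K x y|` by `8 * ρ / (d * h d)` with `d = dist y x`. For `d` below a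
fixed `R`, annuli are summed for the measure `|f| μ`, whose density relative to `h` is small; beyond
`R` the bound itself tends to zero with `ρ`. -/
theorem eventually_abs_setIntegral_sub_truncated_le (hK : IsCZKernel μ K h C) {x : X} {f : X → ℝ}
    (hf : Integrable f μ)
    (hd : ∀ η > 0, ∀ᶠ r in 𝓝[>] 0, ∫ y in Metric.closedBall x r, |f y| ∂μ ≤ η * h r) :
    ∀ η > 0, ∀ᶠ ρ in 𝓝[>] 0, ∀ z ∈ Metric.closedBall x (2 * ρ),
      |∫ y in (Metric.ball x (8 * ρ))ᶜ, K z y * f y ∂μ - truncated μ K (8 * ρ) f x| ≤ η := by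
  intro η hη
  have hC := hK.one_le
  set η₁ := η / (4 * C) with hη₁
  have hη₁0 : 0 < η₁ := by positivity
  obtain ⟨R₀, hR₀, hRs⟩ := mem_nhdsGT_iff_exists_Ioo_subset.1 (hd η₁ hη₁0)
  have hR₀ : 0 < R₀ := hR₀
  set R := R₀ / 2 with hR
  have hR0 : 0 < R := by positivity
  set I := ∫ y, |f y| ∂μ with hI
  have hI0 : 0 ≤ I := integral_nonneg fun y => abs_nonneg _
  have hhR := hK.pos _ hR0
  have hev : ∀ᶠ ρ in 𝓝[>] (0 : ℝ), 8 * ρ / (R * h R) * I < η / 2 := by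
    have : Tendsto (fun ρ : ℝ => 8 * ρ / (R * h R) * I) (𝓝[>] 0) (𝓝 (8 * 0 / (R * h R) * I)) :=
      Tendsto.mono_left (Continuous.tendsto (by fun_prop) 0) nhdsWithin_le_nhds
    rw [mul_zero, zero_div, zero_mul] at this
    exact this.eventually (gt_mem_nhds (by positivity))
  filter_upwards [hev, Ioo_mem_nhdsGT (show 0 < R / 8 by positivity)] with ρ hρη hρ z hz
  have hρ0 : 0 < ρ := hρ.1
  have hρR : 8 * ρ < R := by linarith [hρ.2]
  set S := (Metric.ball x (8 * ρ))ᶜ with hS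
  have hSm : MeasurableSet S := Metric.isOpen_ball.measurableSet.compl
  have hSd : ∀ y ∈ S, 8 * ρ ≤ dist y x := fun y hy => by simpa [hS] using hy
  have hzx : dist x z ≤ 2 * ρ := by rwa [dist_comm]
  have hSz : ∀ y ∈ S, 6 * ρ ≤ dist z y := fun y hy => by
    have h1 := hSd y hy
    have h2 := dist_triangle y z x
    rw [dist_comm y z, dist_comm z x] at h2
    linarith
  have hint : ∀ w, (∀ y ∈ S, 6 * ρ ≤ dist w y) → IntegrableOn (fun y => K w y * f y) S μ := by
    intro w hw
    refine hf.restrict.bdd_mul (c := 1 / h (6 * ρ))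
      (hK.measurable.comp measurable_prodMk_left).aestronglyMeasurable ?_
    filter_upwards [ae_restrict_mem hSm] with y hy
    exact hK.abs_le (by positivity) (hw y hy)
  have hi1 := hint z hSz
  have hi2 := hint x fun y hy => by
    rw [dist_comm]
    linarith [hSd y hy]
  have hdiff : ∫ y in S, K z y * f y ∂μ - truncated μ K (8 * ρ) f x =
      ∫ y in S, (K z y - K x y) * f y ∂μ := by
    rw [truncated, ← integral_sub hi1 hi2]
    congr 1 with y
    ring
  set g : X → ℝ≥0∞ := fun y => ENNReal.ofReal (8 * ρ / (dist y x * h (dist y x))) with hg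
  set ν := μ.withDensity fun y => ‖f y‖ₑ with hν
  have hνball : ∀ s, 0 < s → s ≤ R → ν (Metric.ball x s) ≤ ENNReal.ofReal (η₁ * h s) := by
    intro s hs hsR
    rw [hν, withDensity_apply _ Metric.isOpen_ball.measurableSet]
    calc ∫⁻ y in Metric.ball x s, ‖f y‖ₑ ∂μ ≤ ∫⁻ y in Metric.closedBall x s, ‖f y‖ₑ ∂μ :=
          lintegral_mono_set Metric.ball_subset_closedBall
      _ = ENNReal.ofReal (∫ y in Metric.closedBall x s, |f y| ∂μ) := by
          rw [ofReal_integral_eq_lintegral_ofReal hf.abs.restrict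
            (Eventually.of_forall fun y => abs_nonneg _)]
          simp only [Real.enorm_eq_ofReal_abs]
      _ ≤ _ := ENNReal.ofReal_le_ofReal (hRs ⟨hs, by linarith⟩)
  have hνuniv : ν univ = ENNReal.ofReal I := by
    rw [hν, withDensity_apply _ MeasurableSet.univ, setLIntegral_univ, hI,
      ofReal_integral_eq_lintegral_ofReal hf.abs (Eventually.of_forall fun y => abs_nonneg _)]
    simp only [Real.enorm_eq_ofReal_abs]
  have hBm : MeasurableSet (Metric.ball x R) := Metric.isOpen_ball.measurableSet
  have hmain : ∫⁻ y in S, ‖(K z y - K x y) * f y‖ₑ ∂μ ≤ ENNReal.ofReal η := by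
    calc ∫⁻ y in S, ‖(K z y - K x y) * f y‖ₑ ∂μ
        ≤ ∫⁻ y in S, ((fun y => ‖f y‖ₑ) * g) y ∂μ := by
          refine setLIntegral_mono' hSm fun y hy => ?_
          have hyd := hSd y hy
          have hyx : y ≠ x := dist_pos.1 (by linarith)
          have hzy : z ≠ y := dist_pos.1 (by linarith [hSz y hy])
          have h1 := hK.smooth y x z hyx hzy (by linarith)
          have h2 : |K z y - K x y| = |K y x - K y z| := by
            rw [hK.antisymm z y, hK.antisymm x y]
            ring_nf
          have h3 := hK.pos _ (dist_pos.2 hyx)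
          rw [enorm_mul, Pi.mul_apply, mul_comm]
          gcongr
          rw [Real.enorm_eq_ofReal_abs, h2]
          refine ENNReal.ofReal_le_ofReal (h1.trans ?_)
          gcongr
          linarith
      _ = ∫⁻ y in S, g y ∂ν := by
          rw [hν, setLIntegral_withDensity_eq_setLIntegral_mul_non_measurable₀ μ
            hf.1.enorm.restrict _ hSm (Eventually.of_forall fun y => enorm_lt_top)]
      -- Restricting `ν` to the ball of radius `R` makes its growth bound valid at all radii, as the
      -- annulus sum demands.
      _ ≤ ∫⁻ y in S, g y ∂(ν.restrict (Metric.ball x R)) + ∫⁻ y in (Metric.ball x R)ᶜ, g y ∂ν := by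
          rw [Measure.restrict_restrict hSm]
          refine le_trans (lintegral_mono_set ?_) (lintegral_union_le _ _ _)
          intro y hy
          by_cases hyR : y ∈ Metric.ball x R
          · exact Or.inl ⟨hy, hyR⟩
          · exact Or.inr hyR
      _ ≤ ENNReal.ofReal (2 * C * η₁) + ENNReal.ofReal (8 * ρ / (R * h R) * I) := by
          refine add_le_add (hK.lintegral_compl_ball_le (by positivity) hη₁0.le fun s hs => ?_) ?_
          · have hs0 : 0 < s := by linarith
            rcases le_total s R with hsR | hsR
            · exact (Measure.restrict_apply_le _ _).trans (hνball s hs0 hsR)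
            · rw [Measure.restrict_apply Metric.isOpen_ball.measurableSet]
              refine (measure_mono inter_subset_right).trans ((hνball R hR0 le_rfl).trans ?_)
              have := hK.mono _ _ hR0 hsR
              exact ENNReal.ofReal_le_ofReal (by gcongr)
          · calc ∫⁻ y in (Metric.ball x R)ᶜ, g y ∂ν
                ≤ ∫⁻ y in (Metric.ball x R)ᶜ, ENNReal.ofReal (8 * ρ / (R * h R)) ∂ν := by
                  refine setLIntegral_mono' hBm.compl fun y hy => ?_
                  have hy' : R ≤ dist y x := by simpa using hy
                  have := hK.mono _ _ hR0 hy'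
                  exact ENNReal.ofReal_le_ofReal (by gcongr)
              _ ≤ ENNReal.ofReal (8 * ρ / (R * h R)) * ENNReal.ofReal I := by
                  rw [setLIntegral_const, ← hνuniv]
                  gcongr
                  exact subset_univ _
              _ = _ := by rw [← ENNReal.ofReal_mul (by positivity)]
      _ ≤ ENNReal.ofReal η := by
          rw [← ENNReal.ofReal_add (by positivity) (by positivity)]
          refine ENNReal.ofReal_le_ofReal ?_
          have : 2 * C * η₁ = η / 2 := by
            rw [hη₁]
            field_simp
            norm_num
          linarith
  rw [hdiff, ← Real.norm_eq_abs, ← ENNReal.ofReal_le_ofReal_iff hη.le, ofReal_norm]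
  exact (enorm_integral_le_lintegral_enorm _).trans hmain

end IsCZKernel

end SingularIntegral


/-! ### Choice of the radius and the average of `Tf` over a ball -/

namespace SingularIntegral

set_option linter.unusedSectionVars false

variable {X : Type*} [MetricSpace X] [SecondCountableTopology X] [MeasurableSpace X]
  [BorelSpace X] {μ : Measure X} [IsFiniteMeasure μ]

namespace IsCZKernel

variable {K : X → X → ℝ} {h : ℝ → ℝ} {C : ℝ}

/-- By averaging over the radius, some ball around `x` interacts weakly with its exterior. -/
theorem exists_setLIntegral_prod_le (hK : IsCZKernel μ K h C) {x : X} {E : Set X}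
    (hE : MeasurableSet E) {ρ ω : ℝ} (hρ : 0 < ρ) (hω : 0 ≤ ω)
    (hEd : ∀ y ∈ E, ∀ s, 0 < s → s ≤ 16 * ρ → μ.real (Metric.ball y s) ≤ ω * h s) :
    ∃ r ∈ Icc ρ (2 * ρ),
      ∫⁻ p in (E ∩ Metric.closedBall x r) ×ˢ (Metric.ball x (8 * ρ) \ Metric.closedBall x r),
        ‖K p.1 p.2‖ₑ ∂(μ.prod μ) ≤
      ENNReal.ofReal (32 * C * ω) * μ (Metric.closedBall x (2 * ρ)) := by
  have hC := hK.one_le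
  set σ := (μ.restrict E).prod (μ.restrict (Metric.ball x (8 * ρ))) with hσ
  set S : ℝ → Set (X × X) := fun r => {p | dist p.1 x ≤ r ∧ r < dist p.2 x} with hS
  set k : X × X → ℝ≥0∞ := fun p => ‖K p.1 p.2‖ₑ with hk
  have hkm : Measurable k := hK.measurable.enorm
  have hSm : MeasurableSet {q : ℝ × (X × X) | q.2 ∈ S q.1} :=
    (measurableSet_le (f := fun q : ℝ × (X × X) => dist q.2.1 x) (by fun_prop)
      measurable_fst).inter
    (measurableSet_lt (g := fun q : ℝ × (X × X) => dist q.2.2 x) measurable_fst (by fun_prop))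
  have hFm : Measurable (Function.uncurry fun (r : ℝ) (p : X × X) => (S r).indicator k p) :=
    (hkm.comp measurable_snd).indicator hSm
  have hBm : MeasurableSet (Metric.closedBall x (2 * ρ)) :=
    Metric.isClosed_closedBall.measurableSet
  -- For a fixed pair `(y, z)`, the radii that separate `y` from `z` form an interval of length at
  -- most `dist z y`, and this factor compensates the singularity of the kernel. The remaining `d /
  -- h d` is integrated around `y ∈ E`, where the density is at most `ω`; a ball of radius `16 * ρ`
  -- around `y` covers the one of radius `8 * ρ` around `x`. Division by the length `ρ` of the range
  -- of radii gives `32 * C * ω`.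
  have htot : ∫⁻ r in Icc ρ (2 * ρ), ∫⁻ p, (S r).indicator k p ∂σ ≤
      ENNReal.ofReal (2 * C * ω * (16 * ρ)) * μ (Metric.closedBall x (2 * ρ)) := by
    rw [lintegral_lintegral_swap hFm.aemeasurable]
    calc ∫⁻ p, (∫⁻ r in Icc ρ (2 * ρ), (S r).indicator k p) ∂σ
        ≤ ∫⁻ p, (Prod.fst ⁻¹' Metric.closedBall x (2 * ρ)).indicator
            (fun p => k p * ENNReal.ofReal (dist p.2 p.1)) p ∂σ := by
          refine lintegral_mono fun p => ?_
          dsimp only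
          by_cases hp : p.1 ∈ Metric.closedBall x (2 * ρ)
          · rw [indicator_of_mem (by exact hp)]
            calc ∫⁻ r in Icc ρ (2 * ρ), (S r).indicator k p
                ≤ ∫⁻ r, (S r).indicator k p := setLIntegral_le_lintegral _ _
              _ = ∫⁻ r, (Ico (dist p.1 x) (dist p.2 x)).indicator (fun _ => k p) r := by
                  refine lintegral_congr fun r => ?_
                  by_cases hr : r ∈ Ico (dist p.1 x) (dist p.2 x)
                  · rw [indicator_of_mem hr, indicator_of_mem (by exact hr)]
                  · rw [indicator_of_notMem hr, indicator_of_notMem (by exact hr)]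
              _ = k p * ENNReal.ofReal (dist p.2 x - dist p.1 x) := by
                  rw [lintegral_indicator_const measurableSet_Ico, Real.volume_Ico]
              _ ≤ _ := by
                  gcongr
                  linarith [dist_triangle p.2 p.1 x]
          · rw [indicator_of_notMem (by exact hp)]
            refine (setLIntegral_eq_zero measurableSet_Icc fun r hr => ?_).le
            refine indicator_of_notMem (fun hmem => hp ?_) _
            exact le_trans hmem.1 hr.2
      _ = ∫⁻ y in E, ∫⁻ z in Metric.ball x (8 * ρ), (Metric.closedBall x (2 * ρ)).indicator
            (fun y => k (y, z) * ENNReal.ofReal (dist z y)) y ∂μ ∂μ := by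
          rw [hσ, lintegral_prod _ (Measurable.aemeasurable ?_)]
          · rfl
          · exact Measurable.indicator (by fun_prop) (measurable_fst hBm)
      _ ≤ ∫⁻ y in E, (Metric.closedBall x (2 * ρ)).indicator
            (fun _ => ENNReal.ofReal (2 * C * ω * (16 * ρ))) y ∂μ := by
          refine setLIntegral_mono' hE fun y hy => ?_
          by_cases hyB : y ∈ Metric.closedBall x (2 * ρ)
          · simp only [indicator_of_mem hyB]
            refine le_trans ?_ (hK.lintegral_ball_le (ν := μ) (x := y) (by positivity) hω
              fun s hs hs' => ?_)
            · refine (lintegral_mono_set (t := Metric.ball y (16 * ρ)) fun z hz => ?_).trans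
                (lintegral_mono fun z => ?_)
              · have h1 := dist_triangle z x y
                rw [Metric.mem_ball] at hz ⊢
                rw [Metric.mem_closedBall] at hyB
                rw [dist_comm x y] at h1
                linarith
              · rcases eq_or_ne y z with rfl | hyz
                · simp
                · have hd : 0 < dist y z := dist_pos.2 hyz
                  have h1 := hK.size y z hyz
                  rw [hk]
                  dsimp only
                  rw [Real.enorm_eq_ofReal_abs, ← ENNReal.ofReal_mul (abs_nonneg _), dist_comm z y]
                  refine ENNReal.ofReal_le_ofReal ?_
                  calc |K y z| * dist y z ≤ 1 / h (dist y z) * dist y z := by gcongr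
                    _ = _ := by ring
            · rw [← ENNReal.ofReal_toReal (measure_ne_top μ (Metric.ball y s))]
              exact ENNReal.ofReal_le_ofReal (hEd y hy s hs hs')
          · simp only [indicator_of_notMem hyB, lintegral_zero, le_refl]
      _ ≤ _ := by
          rw [lintegral_indicator_const hBm]
          gcongr
          exact Measure.restrict_le_self
  have hvol : volume (Icc ρ (2 * ρ)) = ENNReal.ofReal ρ := by
    rw [Real.volume_Icc]
    congr 1
    ring
  obtain ⟨r, hr, hrle⟩ := exists_le_setLAverage (μ := volume) (s := Icc ρ (2 * ρ))
    (f := fun r => ∫⁻ p, (S r).indicator k p ∂σ) (by rw [hvol]; simpa using hρ)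
    (by rw [hvol]; exact ENNReal.ofReal_ne_top) hFm.lintegral_prod_right'.aemeasurable
  refine ⟨r, hr, ?_⟩
  have hset : (E ∩ Metric.closedBall x r) ×ˢ (Metric.ball x (8 * ρ) \ Metric.closedBall x r) =
      S r ∩ E ×ˢ Metric.ball x (8 * ρ) := by
    ext p
    simp only [hS, mem_prod, mem_inter_iff, Set.mem_sdiff, Metric.mem_closedBall, mem_ofPred_eq, not_le]
    tauto
  have hSr : MeasurableSet (S r) := measurable_prodMk_left hSm
  calc _ = ∫⁻ p, (S r).indicator k p ∂σ := by
        rw [lintegral_indicator hSr, hσ, Measure.prod_restrict, Measure.restrict_restrict hSr, hset]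
    _ ≤ _ := hrle
    _ ≤ ENNReal.ofReal (2 * C * ω * (16 * ρ)) * μ (Metric.closedBall x (2 * ρ)) /
        ENNReal.ofReal ρ := by
        rw [setLAverage_eq, hvol]
        gcongr
    _ = _ := by
        rw [ENNReal.mul_div_right_comm, ← ENNReal.ofReal_div_of_pos hρ]
        congr 2
        field_simp
        ring

theorem truncated_indicator_compl_ball {x z : X} {ρ δ : ℝ} (hz : z ∈ Metric.closedBall x (2 * ρ))
    (hδ : δ ≤ 6 * ρ) (K : X → X → ℝ) (f : X → ℝ) :
    truncated μ K δ ((Metric.ball x (8 * ρ))ᶜ.indicator f) z =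
      ∫ y in (Metric.ball x (8 * ρ))ᶜ, K z y * f y ∂μ := by
  have hS : MeasurableSet (Metric.ball x (8 * ρ))ᶜ := Metric.isOpen_ball.measurableSet.compl
  rw [truncated_eq_integral, ← integral_indicator hS]
  congr 1 with y
  by_cases hy : y ∈ (Metric.ball x (8 * ρ))ᶜ
  · rw [indicator_of_mem hy, indicator_of_mem hy, truncKernel_of_le]
    have h1 : 8 * ρ ≤ dist y x := by simpa using hy
    have h2 := dist_triangle y z x
    rw [Metric.mem_closedBall] at hz
    rw [dist_comm y z] at h2
    linarith
  · rw [indicator_of_notMem hy, indicator_of_notMem hy, mul_zero]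

theorem abs_integral_truncated_indicator_mul_le (hK : IsCZKernel μ K h C) {P Q : Set X}
    (hP : MeasurableSet P) (hQ : MeasurableSet Q) {δ ν : ℝ} (hν : 0 ≤ ν)
    (hPQ : ∫⁻ p in P ×ˢ Q, ‖K p.1 p.2‖ₑ ∂(μ.prod μ) ≤ ENNReal.ofReal ν) :
    |∫ z, truncated μ K δ (Q.indicator 1) z * P.indicator 1 z ∂μ| ≤ ν := by
  rw [← Real.norm_eq_abs, ← ENNReal.ofReal_le_ofReal_iff hν, ofReal_norm]
  refine (enorm_integral_le_lintegral_enorm _).trans (le_trans ?_ hPQ)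
  calc ∫⁻ z, ‖truncated μ K δ (Q.indicator 1) z * P.indicator 1 z‖ₑ ∂μ
      ≤ ∫⁻ z, P.indicator (fun z => ∫⁻ y in Q, ‖K z y‖ₑ ∂μ) z ∂μ := by
        refine lintegral_mono fun z => ?_
        by_cases hz : z ∈ P
        · simp only [indicator_of_mem hz, Pi.one_apply, mul_one]
          rw [truncated_eq_integral, ← lintegral_indicator hQ]
          refine (enorm_integral_le_lintegral_enorm _).trans (lintegral_mono fun y => ?_)
          by_cases hy : y ∈ Q
          · simp only [indicator_of_mem hy, Pi.one_apply, mul_one]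
            rcases le_or_gt δ (dist z y) with hd | hd
            · rw [truncKernel_of_le hd]
            · simp [truncKernel_of_lt hd]
          · simp [indicator_of_notMem hy]
        · simp [indicator_of_notMem hz]
    _ = ∫⁻ p in P ×ˢ Q, ‖K p.1 p.2‖ₑ ∂(μ.prod μ) := by
        rw [lintegral_indicator hP, ← Measure.prod_restrict,
          lintegral_prod (fun p : X × X => ‖K p.1 p.2‖ₑ) hK.measurable.enorm.aemeasurable]

/-- The function is split as `f₁ + a * (p + q) + f₃`: the deviation from `a` times the indicator of
`E` inside the ball of radius `8 * ρ`, the indicators of `P` and of the rest `Q` of `E` in that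
ball, and the part outside. Paired with `p`, the first is bounded in `L²`, `p` cancels by
antisymmetry, `q` is bounded by the interaction `ν`, and the last is nearly `t`. All bounds are
uniform in `δ`. -/
theorem abs_setIntegral_truncated_sub_le (hK : IsCZKernel μ K h C) {C₀ : ℝ≥0}
    (hT : MaximalBound μ K C₀) {x : X} {E : Set X} (hE : MeasurableSet E) {ρ r ν η a M t δ : ℝ}
    (hρ : 0 < ρ) (hr : r ∈ Icc ρ (2 * ρ)) {f : X → ℝ} (hf : AEStronglyMeasurable f μ)
    (hfM : ∀ y, |f y| ≤ M) (hν : 0 ≤ ν)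
    (hnear : ∫⁻ p in (E ∩ Metric.closedBall x r) ×ˢ
        (Metric.ball x (8 * ρ) \ Metric.closedBall x r), ‖K p.1 p.2‖ₑ ∂(μ.prod μ) ≤
      ENNReal.ofReal ν)
    (htail : ∀ z ∈ Metric.closedBall x (2 * ρ),
      |∫ y in (Metric.ball x (8 * ρ))ᶜ, K z y * f y ∂μ - t| ≤ η)
    (hδ : 0 < δ) (hδρ : δ ≤ 6 * ρ) :
    |∫ z, truncated μ K δ f z * (E ∩ Metric.closedBall x r).indicator 1 z ∂μ -
        μ.real (E ∩ Metric.closedBall x r) * t| ≤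
      √C₀ * √(∫ y in Metric.ball x (8 * ρ), (f y - a * E.indicator 1 y) ^ 2 ∂μ) *
        √(μ.real (E ∩ Metric.closedBall x r)) + |a| * ν +
        η * μ.real (E ∩ Metric.closedBall x r) := by
  set B8 := Metric.ball x (8 * ρ) with hB8
  set P := E ∩ Metric.closedBall x r with hP
  set Q := E ∩ (B8 \ Metric.closedBall x r) with hQ
  have hB8m : MeasurableSet B8 := Metric.isOpen_ball.measurableSet
  have hBm : MeasurableSet (Metric.closedBall x r) := Metric.isClosed_closedBall.measurableSet
  have hPm : MeasurableSet P := hE.inter hBm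
  have hQm : MeasurableSet Q := hE.inter (hB8m.diff hBm)
  set p : X → ℝ := P.indicator 1 with hp
  set q : X → ℝ := Q.indicator 1 with hq
  set f₁ : X → ℝ := B8.indicator fun y => f y - a * E.indicator 1 y with hf₁
  set f₃ : X → ℝ := B8ᶜ.indicator f with hf₃
  have hPB8 : P ⊆ B8 := fun y hy => by
    have h1 : dist y x ≤ r := hy.2
    have h2 := hr.2
    rw [hB8, Metric.mem_ball]
    linarith
  have hfi : Integrable f μ := (memLp_two_of_bound hf hfM).integrable one_le_two
  have hone : ∀ S : Set X, MeasurableSet S → MemLp (S.indicator 1 : X → ℝ) 2 μ := fun S hS =>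
    (memLp_const (1 : ℝ)).indicator hS
  have hf₁L : MemLp f₁ 2 μ :=
    ((memLp_two_of_bound hf hfM).sub ((hone E hE).const_mul a)).indicator hB8m
  have hpL := hone P hPm
  have hqL := hone Q hQm
  have hpi : Integrable p μ := hpL.integrable one_le_two
  have hqi : Integrable q μ := hqL.integrable one_le_two
  have hf₁i : Integrable f₁ μ := hf₁L.integrable one_le_two
  have hf₃i : Integrable f₃ μ := hfi.indicator hB8m.compl
  have hdec : f = fun y => f₁ y + (a * (p y + q y) + f₃ y) := by
    ext y
    simp only [hf₁, hp, hq, hf₃]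
    by_cases hy8 : y ∈ B8
    · have hy8' : y ∉ B8ᶜ := fun hc => hc hy8
      rw [indicator_of_mem hy8, indicator_of_notMem hy8']
      by_cases hyE : y ∈ E
      · by_cases hyr : y ∈ Metric.closedBall x r
        · rw [indicator_of_mem hyE, indicator_of_mem (show y ∈ P from ⟨hyE, hyr⟩),
            indicator_of_notMem (show y ∉ Q from fun hc => hc.2.2 hyr)]
          simp
        · rw [indicator_of_mem hyE, indicator_of_notMem (show y ∉ P from fun hc => hyr hc.2),
            indicator_of_mem (show y ∈ Q from ⟨hyE, hy8, hyr⟩)]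
          simp
      · rw [indicator_of_notMem hyE, indicator_of_notMem (show y ∉ P from fun hc => hyE hc.1),
          indicator_of_notMem (show y ∉ Q from fun hc => hyE hc.1)]
        simp
    · rw [indicator_of_notMem hy8, indicator_of_mem (show y ∈ B8ᶜ from hy8),
        indicator_of_notMem (show y ∉ P from fun hc => hy8 (hPB8 hc)),
        indicator_of_notMem (show y ∉ Q from fun hc => hy8 hc.2.1)]
      simp
  have hpq : Integrable (fun y => a * (p y + q y)) μ := (hpi.add hqi).const_mul a
  have hpqf : Integrable (fun y => a * (p y + q y) + f₃ y) μ := hpq.add hf₃i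
  have hTf : ∀ z, truncated μ K δ f z * p z = truncated μ K δ f₁ z * p z +
      a * (truncated μ K δ p z * p z + truncated μ K δ q z * p z) +
      truncated μ K δ f₃ z * p z := by
    intro z
    conv_lhs => rw [hdec]
    rw [hK.truncated_add hδ z hf₁i hpqf, hK.truncated_add hδ z hpq hf₃i, truncated_const_mul,
      hK.truncated_add hδ z hpi hqi]
    ring
  have hTi : ∀ g : X → ℝ, Integrable g μ → Integrable (fun z => truncated μ K δ g z * p z) μ :=
    fun g hg => (hK.memLp_truncated hδ hg).integrable_mul hpL
  have hp1 : ∫ z, p z ∂μ = μ.real P := by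
    rw [hp, integral_indicator_one hPm]
  have hp2 : ∫ z, p z ^ 2 ∂μ = μ.real P := by
    rw [← hp1]
    congr 1 with z
    by_cases hz : z ∈ P <;> simp [hp, hz]
  have hf₁2 : ∫ z, f₁ z ^ 2 ∂μ = ∫ y in B8, (f y - a * E.indicator 1 y) ^ 2 ∂μ := by
    rw [← integral_indicator hB8m]
    congr 1 with z
    by_cases hz : z ∈ B8 <;> simp [hf₁, hz]
  have e1 := hK.abs_integral_truncated_mul_le hT hδ hf₁L hpL
  rw [hp2, hf₁2] at e1
  have e2 := hK.integral_truncated_mul_self hδ hpi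
  have e3 : |∫ z, truncated μ K δ q z * p z ∂μ| ≤ ν := by
    refine hK.abs_integral_truncated_indicator_mul_le hPm hQm hν (le_trans ?_ hnear)
    exact lintegral_mono_set (prod_mono_right inter_subset_right)
  have e4 : |∫ z, truncated μ K δ f₃ z * p z ∂μ - μ.real P * t| ≤ η * μ.real P := by
    have h1 : ∫ z, truncated μ K δ f₃ z * p z ∂μ - μ.real P * t =
        ∫ z, (truncated μ K δ f₃ z * p z - t * p z) ∂μ := by
      rw [integral_sub (hTi _ hf₃i) (hpi.const_mul t), integral_const_mul, hp1, mul_comm t]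
    rw [h1, ← hp1, ← integral_const_mul]
    refine abs_integral_le_integral_abs.trans (integral_mono_of_nonneg
      (Eventually.of_forall fun z => abs_nonneg _) (hpi.const_mul η)
      (Eventually.of_forall fun z => ?_))
    dsimp only
    by_cases hz : z ∈ P
    · have hz2 : z ∈ Metric.closedBall x (2 * ρ) :=
        Metric.closedBall_subset_closedBall hr.2 hz.2
      have := htail z hz2
      rw [hf₃, truncated_indicator_compl_ball hz2 hδρ]
      simpa [hp, hz] using this
    · simp [hp, hz]
  have hI : ∫ z, truncated μ K δ f z * p z ∂μ = ∫ z, truncated μ K δ f₁ z * p z ∂μ +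
      a * (∫ z, truncated μ K δ p z * p z ∂μ + ∫ z, truncated μ K δ q z * p z ∂μ) +
      ∫ z, truncated μ K δ f₃ z * p z ∂μ := by
    have h1 : Integrable (fun z => a * (truncated μ K δ p z * p z + truncated μ K δ q z * p z)) μ :=
      ((hTi _ hpi).add (hTi _ hqi)).const_mul a
    have h2 : Integrable (fun z => truncated μ K δ f₁ z * p z +
        a * (truncated μ K δ p z * p z + truncated μ K δ q z * p z)) μ := (hTi _ hf₁i).add h1
    simp_rw [hTf]
    rw [integral_add h2 (hTi _ hf₃i), integral_add (hTi _ hf₁i) h1, integral_const_mul,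
      integral_add (hTi _ hpi) (hTi _ hqi)]
  rw [hI, e2, zero_add]
  calc _ = |∫ z, truncated μ K δ f₁ z * p z ∂μ + a * ∫ z, truncated μ K δ q z * p z ∂μ +
        (∫ z, truncated μ K δ f₃ z * p z ∂μ - μ.real P * t)| := by
        congr 1
        ring
    _ ≤ |∫ z, truncated μ K δ f₁ z * p z ∂μ| + |a * ∫ z, truncated μ K δ q z * p z ∂μ| +
        |∫ z, truncated μ K δ f₃ z * p z ∂μ - μ.real P * t| := abs_add_three _ _ _
    _ ≤ _ := by
        rw [abs_mul]
        gcongr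

end IsCZKernel

end SingularIntegral


/-! ### Almost everywhere convergence for bounded functions -/

namespace SingularIntegral

set_option linter.unusedSectionVars false

variable {X : Type*} [MetricSpace X] [SecondCountableTopology X] [MeasurableSpace X]
  [BorelSpace X] {μ : Measure X} [IsFiniteMeasure μ]

theorem exists_forall_of_eventually_nhdsGT {P : ℝ → Prop} (hP : ∀ᶠ r in 𝓝[>] 0, P r) :
    ∃ R > 0, ∀ r, 0 < r → r < R → P r := by
  obtain ⟨R, hR, hRs⟩ := mem_nhdsGT_iff_exists_Ioo_subset.1 hP
  exact ⟨R, hR, fun r hr hr' => hRs ⟨hr, hr'⟩⟩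

/-- For bounded `f`, squares cost only a factor `2 * M`: on `E` the integrand is at most `2 * M * |f
y - f x|`, off `E` at most `M ^ 2`. Thus `L¹` Lebesgue point conditions suffice for the `L²` term.
-/
theorem setIntegral_sub_indicator_sq_le {x : X} {E : Set X} (hE : MeasurableSet E) {f : X → ℝ}
    (hfi : Integrable f μ) {M r κ : ℝ} (hfM : ∀ y, |f y| ≤ M)
    (hf : ∫ y in Metric.closedBall x r, |f y - f x| ∂μ ≤ κ * μ.real (Metric.closedBall x r))
    (hE' : μ.real (Metric.closedBall x r \ E) ≤ κ * μ.real (Metric.closedBall x r)) :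
    ∫ y in Metric.ball x r, (f y - f x * E.indicator 1 y) ^ 2 ∂μ ≤
      2 * M * (1 + M) * κ * μ.real (Metric.closedBall x r) := by
  have hM : 0 ≤ M := (abs_nonneg _).trans (hfM x)
  have i1 : IntegrableOn (fun y => |f y - f x|) (Metric.closedBall x r) μ :=
    (hfi.sub (integrable_const _)).abs.restrict
  have i2 : IntegrableOn (Eᶜ.indicator fun _ => M) (Metric.closedBall x r) μ :=
    ((integrable_const M).indicator hE.compl).restrict
  have i3 : IntegrableOn (fun y => 2 * M * (|f y - f x| + Eᶜ.indicator (fun _ => M) y))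
    (Metric.closedBall x r) μ := (i1.add i2).const_mul _
  have hnn : ∀ y, 0 ≤ 2 * M * (|f y - f x| + Eᶜ.indicator (fun _ => M) y) := fun y =>
    mul_nonneg (by positivity) (add_nonneg (abs_nonneg _) (indicator_nonneg (fun _ _ => hM) _))
  calc ∫ y in Metric.ball x r, (f y - f x * E.indicator 1 y) ^ 2 ∂μ
      ≤ ∫ y in Metric.ball x r, 2 * M * (|f y - f x| + Eᶜ.indicator (fun _ => M) y) ∂μ := by
        refine integral_mono_of_nonneg (Eventually.of_forall fun y => sq_nonneg _)
          (i3.mono_set Metric.ball_subset_closedBall) (Eventually.of_forall fun y => ?_)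
        dsimp only
        have hfy := abs_le.1 (hfM y)
        have hfx := abs_le.1 (hfM x)
        by_cases hy : y ∈ E
        · rw [indicator_of_mem hy, indicator_of_notMem (show y ∉ Eᶜ from fun hc => hc hy),
            Pi.one_apply, mul_one, add_zero, ← sq_abs, sq]
          gcongr
          rw [abs_le]
          constructor <;> linarith
        · rw [indicator_of_notMem hy, indicator_of_mem (show y ∈ Eᶜ from hy), mul_zero, sub_zero]
          have h1 := mul_nonneg hM (abs_nonneg (f y - f x))
          have h2 : f y ^ 2 ≤ M ^ 2 := sq_le_sq' hfy.1 hfy.2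
          have h3 := sq_nonneg M
          linarith
    _ ≤ ∫ y in Metric.closedBall x r, 2 * M * (|f y - f x| + Eᶜ.indicator (fun _ => M) y) ∂μ :=
        setIntegral_mono_set i3 (Eventually.of_forall hnn)
          (Metric.ball_subset_closedBall.eventuallyLE)
    _ = 2 * M * (∫ y in Metric.closedBall x r, |f y - f x| ∂μ +
          μ.real (Metric.closedBall x r \ E) * M) := by
        rw [integral_const_mul, integral_add i1 i2, setIntegral_indicator hE.compl,
          setIntegral_const, smul_eq_mul, Set.sdiff_eq]
    _ ≤ 2 * M * (κ * μ.real (Metric.closedBall x r) + κ * μ.real (Metric.closedBall x r) * M) := by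
        gcongr
    _ = _ := by ring

namespace IsCZKernel

variable {K : X → X → ℝ} {h : ℝ → ℝ} {C : ℝ}

theorem tendsto_measureReal_closedBall_div (hK : IsCZKernel μ K h C) {E : Set X}
    (hE : HasUniformZeroDensity μ h E) {x : X} (hx : x ∈ E) :
    Tendsto (fun r => μ.real (Metric.closedBall x r) / h r) (𝓝[>] 0) (𝓝 0) := by
  have hC := hK.one_le
  rw [Metric.tendsto_nhds]
  intro η hη
  obtain ⟨R, hR, hRs⟩ := hE (η / (2 * C)) (by positivity)
  filter_upwards [Ioo_mem_nhdsGT (show 0 < R / 2 by positivity)] with r hr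
  have hr0 : 0 < r := hr.1
  have h1 := hRs x hx (2 * r) (by positivity) (by linarith [hr.2])
  have h2 := hK.pos r hr0
  have h3 := hK.doubling r hr0
  have h4 : μ.real (Metric.closedBall x r) ≤ μ.real (Metric.ball x (2 * r)) :=
    measureReal_mono (Metric.closedBall_subset_ball (by linarith))
  rw [Real.dist_eq, sub_zero, abs_of_nonneg (by positivity), div_lt_iff₀ h2]
  calc μ.real (Metric.closedBall x r) ≤ η / (2 * C) * (C * h r) := h4.trans (h1.trans (by gcongr))
    _ = η * h r / 2 := by field_simp
    _ < η * h r := by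
      have := mul_pos hη h2
      linarith

/-- The bound for the truncations is uniform in small `δ`, so weak convergence tested on the
indicator of `P` carries it over to `T`. -/
theorem abs_setIntegral_sub_le (hK : IsCZKernel μ K h C) {C₀ : ℝ≥0}
    (hT : MaximalBound μ K C₀) {T : Lp ℝ 2 μ →L[ℝ] Lp ℝ 2 μ} (hTw : IsWeakLimit μ K T)
    {x : X} {E : Set X} (hE : MeasurableSet E) {ρ r ν η a M t : ℝ}
    (hρ : 0 < ρ) (hr : r ∈ Icc ρ (2 * ρ)) {f : X → ℝ} (hf : MemLp f 2 μ)
    (hfM : ∀ y, |f y| ≤ M) (hν : 0 ≤ ν)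
    (hnear : ∫⁻ p in (E ∩ Metric.closedBall x r) ×ˢ
        (Metric.ball x (8 * ρ) \ Metric.closedBall x r), ‖K p.1 p.2‖ₑ ∂(μ.prod μ) ≤
      ENNReal.ofReal ν)
    (htail : ∀ z ∈ Metric.closedBall x (2 * ρ),
      |∫ y in (Metric.ball x (8 * ρ))ᶜ, K z y * f y ∂μ - t| ≤ η) :
    |∫ z in E ∩ Metric.closedBall x r, T (hf.toLp f) z ∂μ -
        μ.real (E ∩ Metric.closedBall x r) * t| ≤
      √C₀ * √(∫ y in Metric.ball x (8 * ρ), (f y - a * E.indicator 1 y) ^ 2 ∂μ) *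
        √(μ.real (E ∩ Metric.closedBall x r)) + |a| * ν +
        η * μ.real (E ∩ Metric.closedBall x r) := by
  set P := E ∩ Metric.closedBall x r with hP
  have hPm : MeasurableSet P := hE.inter Metric.isClosed_closedBall.measurableSet
  have hp : MemLp (P.indicator 1 : X → ℝ) 2 μ := (memLp_const (1 : ℝ)).indicator hPm
  have h1 := hTw (hf.toLp f) (hp.toLp _)
  have h2 : ∫ z, T (hf.toLp f) z * hp.toLp _ z ∂μ = ∫ z in P, T (hf.toLp f) z ∂μ := by
    rw [← integral_indicator hPm]
    refine integral_congr_ae ?_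
    filter_upwards [hp.coeFn_toLp] with z hz
    rw [hz]
    by_cases hzP : z ∈ P <;> simp [hzP]
  have h3 : (fun ε => ∫ z, truncated μ K ε (hf.toLp f) z * hp.toLp _ z ∂μ) =
      fun ε => ∫ z, truncated μ K ε f z * P.indicator 1 z ∂μ := by
    ext ε
    rw [truncated_congr_ae hf.coeFn_toLp]
    refine integral_congr_ae ?_
    filter_upwards [hp.coeFn_toLp] with z hz
    rw [hz]
  rw [h2, h3] at h1
  refine le_of_tendsto (h1.sub_const (μ.real P * t)).abs ?_
  filter_upwards [Ioc_mem_nhdsGT (show 0 < 6 * ρ by positivity)] with δ hδ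
  exact hK.abs_setIntegral_truncated_sub_le hT hE hρ hr hf.1 hfM hν hnear htail hδ.1 hδ.2

/-- Convergence of the truncations of a bounded function at a point of a set of uniform zero
density where several Lebesgue point conditions hold. -/
theorem tendsto_truncated_of_bounded (hK : IsCZKernel μ K h C) {C₀ : ℝ≥0}
    (hT : MaximalBound μ K C₀) {T : Lp ℝ 2 μ →L[ℝ] Lp ℝ 2 μ} (hTw : IsWeakLimit μ K T)
    {x : X} {E : Set X} (hE : MeasurableSet E) (hEu : HasUniformZeroDensity μ h E) (hxE : x ∈ E)
    {M : ℝ} {f : X → ℝ} (hf : MemLp f 2 μ) (hfM : ∀ y, |f y| ≤ M) {N : ℕ} {c : ℝ} (hc : 0 < c)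
    (hlow : ∀ᶠ r in 𝓝[>] 0, c * r ^ N ≤ μ.real (Metric.closedBall x r))
    (hx₁ : ∀ η > 0, ∀ᶠ r in 𝓝[>] 0,
      ∫ y in Metric.closedBall x r, |f y - f x| ∂μ ≤ η * μ.real (Metric.closedBall x r))
    (hx₂ : ∀ η > 0, ∀ᶠ r in 𝓝[>] 0,
      ∫ y in Metric.closedBall x r, |T (hf.toLp f) y - T (hf.toLp f) x| ∂μ ≤
        η * μ.real (Metric.closedBall x r))
    (hx₃ : ∀ η > 0, ∀ᶠ r in 𝓝[>] 0,
      μ.real (Metric.closedBall x r \ E) ≤ η * μ.real (Metric.closedBall x r)) :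
    Tendsto (fun ε => truncated μ K ε f x) (𝓝[>] 0) (𝓝 (T (hf.toLp f) x)) := by
  have hC := hK.one_le
  have hM : 0 ≤ M := (abs_nonneg _).trans (hfM x)
  have hfi : Integrable f μ := hf.integrable one_le_two
  set A : ℝ := max (16 ^ (N + 1)) (2 * C ^ 4) with hA
  have hA0 : 0 < A := lt_of_lt_of_le (by positivity) (le_max_left _ _)
  have hd := hK.tendsto_measureReal_closedBall_div hEu hxE
  have habs : ∀ r, ∫ y in Metric.closedBall x r, |f y| ∂μ ≤ M * μ.real (Metric.closedBall x r) := by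
    intro r
    refine (integral_mono hfi.abs.restrict (integrable_const M) hfM).trans ?_
    rw [setIntegral_const, smul_eq_mul, mul_comm]
  refine hK.tendsto_truncated_of_doubling_scales hfi hc hlow (le_max_left _ _) (le_max_right _ _)
    hM (Eventually.of_forall habs) hd ?_
  set G : X → ℝ := (T (hf.toLp f) : X → ℝ) with hG
  have hGi : Integrable G μ := (Lp.memLp _).integrable one_le_two
  have hd' : ∀ η > 0, ∀ᶠ r in 𝓝[>] 0, μ.real (Metric.closedBall x r) ≤ η * h r := by
    intro η hη
    filter_upwards [hd.eventually (gt_mem_nhds hη), self_mem_nhdsWithin] with r hr hr0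
    exact ((div_lt_iff₀ (hK.pos r hr0)).1 hr).le
  have htail := hK.eventually_abs_setIntegral_sub_truncated_le hfi (x := x) (by
    intro η hη
    filter_upwards [hd' (η / (M + 1)) (by positivity), self_mem_nhdsWithin] with r hr hr0
    have h1 := hK.pos r hr0
    calc _ ≤ M * μ.real (Metric.closedBall x r) := habs r
      _ ≤ (M + 1) * (η / (M + 1) * h r) := by gcongr; linarith
      _ = η * h r := by field_simp)
  set D := √(2 * M * (1 + M)) with hD
  -- The four summands stem from the `L²` deviation, the interaction with the annulus, the far part,
  -- and the oscillation of `Tf`; each comes with `τ` times the mass of a ball that is at most `A *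
  -- q`.
  set Λ := √C₀ * D * A + 32 * M * C * A + A + A with hΛ
  have hΛ0 : 0 < Λ := by positivity
  have key : ∀ τ, 0 < τ → τ ≤ 1 → ∀ᶠ ρ in 𝓝[>] 0,
      μ.real (Metric.closedBall x (16 * ρ)) ≤ A * μ.real (Metric.closedBall x ρ) →
      |truncated μ K ρ f x - G x| ≤ τ * (2 * Λ + M * A) := by
    intro τ hτ hτ1
    -- The deviation of `f` and the density of `E` enter under a square root, so they are required
    -- at level `τ ^ 2`.
    have hτ2 : 0 < τ ^ 2 := by positivity
    obtain ⟨R, hR, hRs⟩ := exists_forall_of_eventually_nhdsGT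
      ((hx₁ _ hτ2).and ((hx₂ τ hτ).and ((hx₃ _ hτ2).and ((hx₃ (1 / 2) (by norm_num)).and
        (hlow.and ((hd' τ hτ).and (htail τ hτ)))))))
    obtain ⟨R', hR', hRs'⟩ := hEu τ hτ
    filter_upwards [Ioo_mem_nhdsGT (show 0 < min R R' / 16 by positivity)] with ρ hρI hρd
    have hρ : 0 < ρ := hρI.1
    have hρR : 16 * ρ < R := by
      have := hρI.2
      have h2 := min_le_left R R'
      linarith
    have hρR' : 16 * ρ < R' := by
      have := hρI.2
      have h2 := min_le_right R R'
      linarith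
    set m : ℝ → ℝ := fun r => μ.real (Metric.closedBall x r) with hm
    have hmm : ∀ r s, r ≤ s → m r ≤ m s := fun r s hrs =>
      measureReal_mono (Metric.closedBall_subset_closedBall hrs)
    obtain ⟨-, -, -, -, glow, gd, gtail⟩ := hRs ρ hρ (by linarith)
    set q := m ρ with hq
    have hq0 : 0 < q := lt_of_lt_of_le (by positivity) glow
    have hmA : ∀ s, s ≤ 16 * ρ → m s ≤ A * q := fun s hs => (hmm _ _ hs).trans hρd
    obtain ⟨r, hr, hnear⟩ := hK.exists_setLIntegral_prod_le hE (x := x) hρ hτ.le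
      fun y hy s hs hs' => hRs' y hy s hs (hs'.trans hρR'.le)
    have hr0 : 0 < r := hρ.trans_le hr.1
    obtain ⟨-, gG, -, ghalf, -, -, -⟩ := hRs r hr0 (by linarith [hr.2])
    obtain ⟨gf, -, gE, -, -, -, -⟩ := hRs (8 * ρ) (by linarith) (by linarith)
    set u := μ.real (E ∩ Metric.closedBall x r) with hu
    have hrA : m r ≤ A * q := hmA r (by linarith [hr.2])
    have huA : u ≤ A * q := (measureReal_mono inter_subset_right).trans hrA
    -- Since `x` is a density point of `E`, the set of averaging keeps at least half of the ball, so
    -- division by its mass costs a factor of 2.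
    have hqu : q / 2 ≤ u := by
      have h1 : m r = μ.real (Metric.closedBall x r ∩ E) + μ.real (Metric.closedBall x r \ E) :=
        (measureReal_inter_add_sdiff hE).symm
      rw [inter_comm, ← hu] at h1
      have h2 := hmm ρ r hr.1
      have h3 : μ.real (Metric.closedBall x r \ E) ≤ 1 / 2 * m r := ghalf
      linarith
    set ν := 32 * C * τ * m (2 * ρ) with hν
    have hν0 : 0 ≤ ν := mul_nonneg (by positivity) measureReal_nonneg
    have hnear' : ENNReal.ofReal (32 * C * τ) * μ (Metric.closedBall x (2 * ρ)) =
        ENNReal.ofReal ν := by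
      rw [hν, ENNReal.ofReal_mul (p := 32 * C * τ) (by positivity)]
      simp only [hm, measureReal_def, ENNReal.ofReal_toReal (measure_ne_top _ _)]
    rw [hnear'] at hnear
    have hmain := hK.abs_setIntegral_sub_le hT hTw hE (a := f x) hρ hr hf hfM hν0 hnear gtail
    rw [← hG, ← hu] at hmain
    set t := truncated μ K (8 * ρ) f x with ht
    have hS : ∫ y in Metric.ball x (8 * ρ), (f y - f x * E.indicator 1 y) ^ 2 ∂μ ≤
        2 * M * (1 + M) * τ ^ 2 * (A * q) := by
      have h8 := hmA (8 * ρ) (by linarith)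
      exact (setIntegral_sub_indicator_sq_le hE hfi hfM gf gE).trans (by gcongr)
    have hSu : √(∫ y in Metric.ball x (8 * ρ), (f y - f x * E.indicator 1 y) ^ 2 ∂μ) * √u ≤
        D * τ * (A * q) := by
      calc _ ≤ √(2 * M * (1 + M) * τ ^ 2 * (A * q)) * √(A * q) := by gcongr
        _ = D * τ * (√(A * q) * √(A * q)) := by
            rw [Real.sqrt_mul (by positivity), Real.sqrt_mul (by positivity), Real.sqrt_sq hτ.le]
            ring
        _ = _ := by rw [Real.mul_self_sqrt (by positivity)]
    have hGx : |∫ z in E ∩ Metric.closedBall x r, G z ∂μ - u * G x| ≤ τ * (A * q) := by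
      have e1 : ∫ z in E ∩ Metric.closedBall x r, G z ∂μ - u * G x =
          ∫ z in E ∩ Metric.closedBall x r, (G z - G x) ∂μ := by
        rw [integral_sub hGi.restrict (integrable_const _), setIntegral_const, smul_eq_mul]
      rw [e1]
      calc _ ≤ ∫ z in E ∩ Metric.closedBall x r, |G z - G x| ∂μ := abs_integral_le_integral_abs
        _ ≤ ∫ z in Metric.closedBall x r, |G z - G x| ∂μ :=
            setIntegral_mono_set (hGi.sub (integrable_const _)).abs.restrict
              (Eventually.of_forall fun _ => abs_nonneg _) inter_subset_right.eventuallyLE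
        _ ≤ τ * m r := gG
        _ ≤ _ := by gcongr
    have hmul : u * |t - G x| ≤ τ * q * Λ := by
      have hu0 : 0 ≤ u := measureReal_nonneg
      rw [show u * |t - G x| = |u * (t - G x)| by rw [abs_mul, abs_of_nonneg hu0]]
      have e1 : u * (t - G x) = (∫ z in E ∩ Metric.closedBall x r, G z ∂μ - u * G x) -
        (∫ z in E ∩ Metric.closedBall x r, G z ∂μ - u * t) := by ring
      rw [e1]
      refine (abs_sub _ _).trans ?_
      have e2 : |f x| * ν ≤ M * (32 * C * τ * (A * q)) := by
        rw [hν]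
        have := hmA (2 * ρ) (by linarith)
        have := hfM x
        gcongr
      have e3 := mul_le_mul_of_nonneg_left hSu (Real.sqrt_nonneg C₀)
      have e4 := mul_le_mul_of_nonneg_left huA hτ.le
      rw [← mul_assoc] at e3
      have e5 : τ * q * Λ = √C₀ * (D * τ * (A * q)) + M * (32 * C * τ * (A * q)) + τ * (A * q) +
        τ * (A * q) := by
        rw [hΛ]
        ring
      linarith
    have ht1 : |t - G x| ≤ 2 * τ * Λ := by
      have := mul_le_mul_of_nonneg_right hqu (abs_nonneg (t - G x))
      have h2 : q * |t - G x| ≤ q * (2 * τ * Λ) := by linarith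
      exact le_of_mul_le_mul_left h2 hq0
    have ht2 : |truncated μ K ρ f x - t| ≤ M * A * τ := by
      refine (hK.abs_truncated_sub_truncated_le hρ (by linarith) x hfi).trans ?_
      rw [div_le_iff₀ (hK.pos ρ hρ)]
      calc _ ≤ M * m (8 * ρ) := habs _
        _ ≤ M * (A * (τ * h ρ)) := by
            have := hmA (8 * ρ) (by linarith)
            have : A * q ≤ A * (τ * h ρ) := mul_le_mul_of_nonneg_left gd hA0.le
            gcongr
            linarith
        _ = _ := by ring
    have := abs_sub_le (truncated μ K ρ f x) t (G x)
    linarith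
  rw [Metric.tendsto_nhds]
  intro η hη
  rw [eventually_inf_principal]
  have hL : 0 < 2 * Λ + M * A := by positivity
  filter_upwards [key (min 1 (η / (2 * (2 * Λ + M * A)))) (by positivity) (min_le_left _ _)]
    with ρ hρ hρd
  rw [Real.dist_eq]
  refine (hρ hρd).trans_lt ?_
  calc min 1 (η / (2 * (2 * Λ + M * A))) * (2 * Λ + M * A)
      ≤ η / (2 * (2 * Λ + M * A)) * (2 * Λ + M * A) := by
        gcongr
        exact min_le_right _ _
    _ = η / 2 := by field_simp
    _ < η := by linarith

/-- The truncations of a bounded function converge almost everywhere to the weak limit. -/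
theorem ae_tendsto_truncated_of_bounded (hK : IsCZKernel μ K h C) {C₀ : ℝ≥0}
    (hT : MaximalBound μ K C₀) (hμ : HasBallDifferentiation μ)
    (hd : ∀ᵐ x ∂μ, Tendsto (fun r : ℝ => μ.real (Metric.ball x r) / h r) (𝓝[>] 0) (𝓝 0))
    {T : Lp ℝ 2 μ →L[ℝ] Lp ℝ 2 μ} (hTw : IsWeakLimit μ K T) {M : ℝ} {f : X → ℝ}
    (hf : MemLp f 2 μ) (hfM : ∀ y, |f y| ≤ M) :
    ∀ᵐ x ∂μ, Tendsto (fun ε => truncated μ K ε f x) (𝓝[>] 0) (𝓝 (T (hf.toLp f) x)) := by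
  obtain ⟨N, hN⟩ := hμ.lower_bound
  refine ae_of_forall_hasUniformZeroDensity hK.pos hd fun E hE hEu => ?_
  filter_upwards [hN, hμ.ae_eventually_setIntegral_abs_sub_le (hf.integrable one_le_two),
    hμ.ae_eventually_setIntegral_abs_sub_le
      ((Lp.memLp (T (hf.toLp f))).integrable one_le_two),
    hμ.ae_eventually_measureReal_diff_le hE] with x ⟨c, hc, hlow⟩ hx₁ hx₂ hx₃ hxE
  exact hK.tendsto_truncated_of_bounded hT hTw hE hEu hxE hf hfM hc hlow hx₁ hx₂ (hx₃ hxE)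

end IsCZKernel

end SingularIntegral


/-! ### Convergence in measure for integrable functions -/

namespace SingularIntegral

set_option linter.unusedSectionVars false

variable {X : Type*} [MetricSpace X] [SecondCountableTopology X] [MeasurableSpace X]
  [BorelSpace X] {μ : Measure X} [IsFiniteMeasure μ]

/-- The truncated operators are uniformly of weak type `(1, 1)` with constant `B`. -/
def WeakTypeBound (μ : Measure X) (K : X → X → ℝ) (B : ℝ) : Prop :=
  ∀ (ε t : ℝ) (f : X → ℝ), 0 < ε → 0 < t → Integrable f μ →
    μ {x | t < |truncated μ K ε f x|} ≤ ENNReal.ofReal (B * (∫ y, |f y| ∂μ) / t)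

theorem _root_.MeasureTheory.TendstoInMeasure.sub_real {ι : Type*} {l : Filter ι}
    {f g : ι → X → ℝ} {F G : X → ℝ} (hf : TendstoInMeasure μ f l F)
    (hg : TendstoInMeasure μ g l G) :
    TendstoInMeasure μ (fun i x => f i x - g i x) l fun x => F x - G x := by
  rw [tendstoInMeasure_iff_norm] at hf hg ⊢
  intro ε hε
  have h1 := (hf (ε / 2) (by positivity)).add (hg (ε / 2) (by positivity))
  rw [add_zero] at h1
  refine tendsto_of_tendsto_of_tendsto_of_le_of_le tendsto_const_nhds h1 (fun i => zero_le)
    fun i => (measure_mono fun x hx => ?_).trans (measure_union_le _ _)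
  by_contra hcon
  simp only [mem_union, mem_ofPred_eq, not_or, not_le, Real.norm_eq_abs] at hcon hx
  have h2 : f i x - g i x - (F x - G x) = (f i x - F x) - (g i x - G x) := by ring
  rw [h2] at hx
  have := abs_sub (f i x - F x) (g i x - G x)
  linarith [hcon.1, hcon.2]

/-- Where `|G|` exceeds `t`, either a truncation exceeds `t / 2` or it differs from `G` by at least
`t / 2`; the measure of the second set tends to zero. -/
theorem WeakTypeBound.measure_lt_abs_le {K : X → X → ℝ} {B : ℝ} (hB : WeakTypeBound μ K B)
    {f G : X → ℝ} (hf : Integrable f μ)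
    (hG : TendstoInMeasure μ (fun ε => truncated μ K ε f) (𝓝[>] 0) G) {t : ℝ} (ht : 0 < t) :
    μ {x | t < |G x|} ≤ ENNReal.ofReal (2 * B * (∫ y, |f y| ∂μ) / t) := by
  rw [tendstoInMeasure_iff_norm] at hG
  have h1 := (hG (t / 2) (by positivity)).const_add
    (ENNReal.ofReal (2 * B * (∫ y, |f y| ∂μ) / t))
  rw [add_zero] at h1
  refine ge_of_tendsto h1 ?_
  filter_upwards [self_mem_nhdsWithin] with ε hε
  have h2 := hB ε (t / 2) f hε (by positivity) hf
  have h3 : B * (∫ y, |f y| ∂μ) / (t / 2) = 2 * B * (∫ y, |f y| ∂μ) / t := by field_simp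
  rw [h3] at h2
  refine le_trans ((measure_mono fun x hx => ?_).trans (measure_union_le _ _))
    (add_le_add_left h2 _)
  by_contra hcon
  simp only [mem_union, mem_ofPred_eq, not_or, not_le, not_lt, Real.norm_eq_abs] at hcon hx
  have := abs_sub_abs_le_abs_sub (G x) (truncated μ K ε f x)
  rw [abs_sub_comm] at this
  linarith [hcon.1, hcon.2]

namespace IsCZKernel

variable {K : X → X → ℝ} {h : ℝ → ℝ} {C B : ℝ}

theorem tendstoInMeasure_truncated_of_ae (hK : IsCZKernel μ K h C) {f G : X → ℝ}
    (hf : AEStronglyMeasurable f μ)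
    (hG : ∀ᵐ x ∂μ, Tendsto (fun ε => truncated μ K ε f x) (𝓝[>] 0) (𝓝 (G x))) :
    TendstoInMeasure μ (fun ε => truncated μ K ε f) (𝓝[>] 0) G := by
  intro η hη
  refine tendsto_of_seq_tendsto fun u hu => ?_
  refine tendstoInMeasure_of_tendsto_ae (f := fun n => truncated μ K (u n) f)
    (fun n => (hK.measurable_truncated (u n) hf).aestronglyMeasurable) ?_ η hη
  filter_upwards [hG] with x hx
  exact hx.comp hu

theorem tendstoInMeasure_truncated_sub (hK : IsCZKernel μ K h C) {f g F G : X → ℝ}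
    (hf : Integrable f μ) (hg : Integrable g μ)
    (hF : TendstoInMeasure μ (fun ε => truncated μ K ε f) (𝓝[>] 0) F)
    (hG : TendstoInMeasure μ (fun ε => truncated μ K ε g) (𝓝[>] 0) G) :
    TendstoInMeasure μ (fun ε => truncated μ K ε fun y => f y - g y) (𝓝[>] 0)
      fun x => F x - G x := by
  refine (hF.sub_real hG).congr' ?_ EventuallyEq.rfl
  filter_upwards [self_mem_nhdsWithin] with ε hε
  exact Eventually.of_forall fun x => (hK.truncated_sub hε x hf hg).symm

theorem exists_seq_isBoundedLipschitz {f : X → ℝ} (hf : Integrable f μ) :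
    ∃ g : ℕ → X → ℝ, (∀ k, IsBoundedLipschitz (g k)) ∧
      ∀ k, ∫ y, |f y - g k y| ∂μ ≤ (1 / 4) ^ k := by
  have hk : ∀ k : ℕ, ∃ g : X → ℝ, IsBoundedLipschitz g ∧ ∫ y, |f y - g y| ∂μ ≤ (1 / 4) ^ k := by
    intro k
    have hpos : (0 : ℝ) < (1 / 4) ^ k := by positivity
    obtain ⟨g, hg, hgL⟩ := exists_isBoundedLipschitz_eLpNorm_sub_le ENNReal.one_ne_top
      (memLp_one_iff_integrable.2 hf) (ENNReal.ofReal_pos.2 hpos).ne'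
    refine ⟨g, hgL, ?_⟩
    rw [eLpNorm_one_eq_lintegral_enorm] at hg
    have hi : Integrable (fun y => |f y - g y|) μ := (hf.sub hgL.integrable).abs
    rw [← ENNReal.ofReal_le_ofReal_iff hpos.le, ofReal_integral_eq_lintegral_ofReal hi
        (Eventually.of_forall fun y => abs_nonneg _)]
    simpa only [Real.enorm_eq_ofReal_abs, Pi.sub_apply] using hg
  choose g hg hg' using hk
  exact ⟨g, hg, hg'⟩

/-- The truncations of an integrable function converge in measure. -/
theorem exists_tendstoInMeasure_truncated (hK : IsCZKernel μ K h C) (hB : WeakTypeBound μ K B)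
    (hB0 : 0 ≤ B)
    (hL : ∀ g : X → ℝ, IsBoundedLipschitz g → ∃ G : X → ℝ, AEStronglyMeasurable G μ ∧
      TendstoInMeasure μ (fun ε => truncated μ K ε g) (𝓝[>] 0) G)
    {f : X → ℝ} (hf : Integrable f μ) :
    ∃ U : X → ℝ, Measurable U ∧
      TendstoInMeasure μ (fun ε => truncated μ K ε f) (𝓝[>] 0) U := by
  obtain ⟨g, hg, hfg⟩ := exists_seq_isBoundedLipschitz hf
  choose G hGm hG using fun k => hL (g k) (hg k)
  have hgi : ∀ k, Integrable (g k) μ := fun k => (hg k).integrable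
  -- Approximation to order `4⁻ᵏ` in `L¹` at level `2⁻ᵏ` leaves measures of order `2⁻ᵏ`. These are
  -- summable, so by Borel–Cantelli the limits `G k` form a Cauchy sequence almost everywhere.
  have hstep : ∀ k, μ {x | (1 / 2) ^ k < |G k x - G (k + 1) x|} ≤
      ENNReal.ofReal (4 * B) * (2 : ℝ≥0∞)⁻¹ ^ k := by
    intro k
    have h1 := hB.measure_lt_abs_le ((hgi k).sub (hgi (k + 1)))
      (hK.tendstoInMeasure_truncated_sub (hgi k) (hgi (k + 1)) (hG k) (hG (k + 1)))
      (show (0 : ℝ) < (1 / 2) ^ k by positivity)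
    refine h1.trans ?_
    have h2 : ∫ y, |(g k - g (k + 1)) y| ∂μ ≤ 2 * (1 / 4) ^ k := by
      have i1 : Integrable (fun y => |f y - g k y|) μ := (hf.sub (hgi k)).abs
      have i2 : Integrable (fun y => |f y - g (k + 1) y|) μ := (hf.sub (hgi (k + 1))).abs
      calc ∫ y, |(g k - g (k + 1)) y| ∂μ
          ≤ ∫ y, (|f y - g k y| + |f y - g (k + 1) y|) ∂μ := by
            refine integral_mono ((hgi k).sub (hgi (k + 1))).abs (i1.add i2) fun y => ?_
            have := abs_sub_le (g k y) (f y) (g (k + 1) y)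
            rwa [abs_sub_comm (g k y) (f y)] at this
        _ = ∫ y, |f y - g k y| ∂μ + ∫ y, |f y - g (k + 1) y| ∂μ := integral_add i1 i2
        _ ≤ (1 / 4) ^ k + (1 / 4) ^ (k + 1) := add_le_add (hfg k) (hfg (k + 1))
        _ ≤ 2 * (1 / 4) ^ k := by
            have : (0 : ℝ) < (1 / 4) ^ k := by positivity
            rw [pow_succ]
            linarith
    have h3 : ENNReal.ofReal (4 * B) * (2 : ℝ≥0∞)⁻¹ ^ k =
        ENNReal.ofReal (4 * B * (1 / 2) ^ k) := by
      rw [ENNReal.ofReal_mul (p := 4 * B) (by positivity), ENNReal.ofReal_pow (by positivity),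
        one_div, ENNReal.ofReal_inv_of_pos (by norm_num), ENNReal.ofReal_ofNat]
    rw [h3]
    refine ENNReal.ofReal_le_ofReal ?_
    rw [div_le_iff₀ (by positivity)]
    calc 2 * B * ∫ y, |(g k - g (k + 1)) y| ∂μ ≤ 2 * B * (2 * (1 / 4) ^ k) := by gcongr
      _ = 4 * B * (1 / 2) ^ k * (1 / 2) ^ k := by
        rw [mul_assoc (4 * B), ← mul_pow]
        norm_num
        ring
  have hsum : ∑' k, μ {x | (1 / 2) ^ k < |G k x - G (k + 1) x|} ≠ ∞ := by
    refine ne_top_of_le_ne_top ?_ (ENNReal.tsum_le_tsum hstep)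
    rw [ENNReal.tsum_mul_left, ENNReal.tsum_geometric]
    refine ENNReal.mul_ne_top ENNReal.ofReal_ne_top ?_
    simp
  have hlim : ∀ᵐ x ∂μ, ∃ l : ℝ, Tendsto (fun k => G k x) atTop (𝓝 l) := by
    filter_upwards [ae_eventually_notMem hsum] with x hx
    refine cauchySeq_tendsto_of_complete (cauchySeq_of_summable_dist ?_)
    refine Summable.of_norm_bounded_eventually_nat (g := fun k => (1 / 2 : ℝ) ^ k)
      (summable_geometric_of_lt_one (by norm_num) (by norm_num)) ?_
    filter_upwards [hx] with k hk
    simpa [Real.dist_eq] using hk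
  obtain ⟨U, hUm, hU⟩ := measurable_limit_of_tendsto_metrizable_ae (L := atTop)
    (fun k => (hGm k).aemeasurable) hlim
  refine ⟨U, hUm, ?_⟩
  have hGU := tendstoInMeasure_of_tendsto_ae hGm hU
  rw [tendstoInMeasure_iff_norm] at hGU ⊢
  intro η hη
  rw [ENNReal.tendsto_nhds_zero]
  intro κ hκ
  have hκ3 : 0 < κ / 3 := ENNReal.div_pos hκ.ne' (by norm_num)
  have h1 := ENNReal.tendsto_nhds_zero.1 (hGU (η / 3) (by positivity)) (κ / 3) hκ3
  have h2 : ∀ᶠ k : ℕ in atTop, ENNReal.ofReal (B * (1 / 4) ^ k / (η / 4)) ≤ κ / 3 := by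
    have h3 : Tendsto (fun k : ℕ => ENNReal.ofReal (B * (1 / 4) ^ k / (η / 4))) atTop (𝓝 0) := by
      rw [← ENNReal.ofReal_zero]
      refine ENNReal.tendsto_ofReal ?_
      have := ((tendsto_pow_atTop_nhds_zero_of_lt_one (r := (1 / 4 : ℝ)) (by norm_num)
        (by norm_num)).const_mul B).div_const (η / 4)
      rwa [mul_zero, zero_div] at this
    exact ENNReal.tendsto_nhds_zero.1 h3 _ hκ3
  obtain ⟨k, hk1, hk2⟩ := (h1.and h2).exists
  have hGk := hG k
  rw [tendstoInMeasure_iff_norm] at hGk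
  filter_upwards [ENNReal.tendsto_nhds_zero.1 (hGk (η / 3) (by positivity)) (κ / 3) hκ3,
    self_mem_nhdsWithin] with ε hε hε0
  -- The weak type bound for `f - g k` is uniform in `ε`, so `k` can be fixed before `ε` tends to
  -- zero.
  have h4 : μ {x | η / 4 < |truncated μ K ε (fun y => f y - g k y) x|} ≤ κ / 3 := by
    have hi : Integrable (fun y => f y - g k y) μ := hf.sub (hgi k)
    refine (hB ε (η / 4) _ hε0 (by positivity) hi).trans (le_trans ?_ hk2)
    refine ENNReal.ofReal_le_ofReal ?_
    have := hfg k
    gcongr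
  calc μ {x | η ≤ ‖truncated μ K ε f x - U x‖}
      ≤ μ (({x | η / 3 ≤ ‖G k x - U x‖} ∪ {x | η / 3 ≤ ‖truncated μ K ε (g k) x - G k x‖}) ∪
          {x | η / 4 < |truncated μ K ε (fun y => f y - g k y) x|}) := by
        refine measure_mono fun x hx => ?_
        by_contra hcon
        simp only [mem_union, mem_ofPred_eq, not_or, not_le, not_lt, Real.norm_eq_abs] at hcon hx
        rw [hK.truncated_sub hε0 x hf (hgi k)] at hcon
        have e1 := abs_sub_le (truncated μ K ε f x) (truncated μ K ε (g k) x) (U x)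
        have e2 := abs_sub_le (truncated μ K ε (g k) x) (G k x) (U x)
        linarith [hcon.1.1, hcon.1.2, hcon.2]
    _ ≤ κ / 3 + κ / 3 + κ / 3 :=
        (measure_union_le _ _).trans (add_le_add ((measure_union_le _ _).trans
          (add_le_add hk1 hε)) h4)
    _ = κ := ENNReal.add_thirds κ

end IsCZKernel

end SingularIntegral


/-! ### Almost everywhere convergence for integrable functions -/

namespace SingularIntegral

set_option linter.unusedSectionVars false

variable {X : Type*} [MetricSpace X] [SecondCountableTopology X] [MeasurableSpace X]
  [BorelSpace X] {μ : Measure X} [IsFiniteMeasure μ]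

namespace IsCZKernel

variable {K : X → X → ℝ} {h : ℝ → ℝ} {C B : ℝ}

/-- If the truncations of `g` converge in measure to a function that is approximately continuous
at `x`, and `g` has small averages around `x`, then the truncations converge at `x`. -/
theorem tendsto_truncated_of_small_averages (hK : IsCZKernel μ K h C)
    (hB : WeakTypeBound μ K B) (hB0 : 0 ≤ B) {x : X} {g W : X → ℝ} (hg : Integrable g μ)
    (hW : TendstoInMeasure μ (fun ε => truncated μ K ε g) (𝓝[>] 0) W) {N : ℕ} {c : ℝ} (hc : 0 < c)
    (hlow : ∀ᶠ r in 𝓝[>] 0, c * r ^ N ≤ μ.real (Metric.closedBall x r))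
    (hd : Tendsto (fun r => μ.real (Metric.closedBall x r) / h r) (𝓝[>] 0) (𝓝 0))
    (hg₀ : ∀ η > 0, ∀ᶠ r in 𝓝[>] 0,
      ∫ y in Metric.closedBall x r, |g y| ∂μ ≤ η * μ.real (Metric.closedBall x r))
    (hW₀ : ∀ η > 0, ∀ κ > 0, ∀ᶠ r in 𝓝[>] 0,
      μ.real {z ∈ Metric.closedBall x r | η < |W z - W x|} ≤
        κ * μ.real (Metric.closedBall x r)) :
    Tendsto (fun ε => truncated μ K ε g x) (𝓝[>] 0) (𝓝 (W x)) := by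
  have hC := hK.one_le
  set A : ℝ := max (16 ^ (N + 1)) (2 * C ^ 4) with hA
  have hA0 : 0 < A := lt_of_lt_of_le (by positivity) (le_max_left _ _)
  refine hK.tendsto_truncated_of_doubling_scales hg hc hlow (le_max_left _ _) (le_max_right _ _)
    zero_le_one (hg₀ 1 one_pos) hd ?_
  have hmh : ∀ᶠ r in 𝓝[>] 0, μ.real (Metric.closedBall x r) ≤ h r := by
    filter_upwards [hd.eventually (gt_mem_nhds one_pos), self_mem_nhdsWithin] with r hr hr0
    exact ((div_lt_one (hK.pos r hr0)).1 hr).le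
  have htail := hK.eventually_abs_setIntegral_sub_truncated_le hg (x := x) (by
    intro η hη
    filter_upwards [hg₀ η hη, hmh] with r hr hr'
    exact hr.trans (by gcongr))
  have key : ∀ η > 0, ∀ᶠ ρ in 𝓝[>] 0,
      μ.real (Metric.closedBall x (16 * ρ)) ≤ A * μ.real (Metric.closedBall x ρ) →
      |truncated μ K ρ g x - W x| ≤ 5 * η := by
    intro η hη
    -- The factor `A` pays for passing from radius `8 * ρ` to `ρ`, and `4 * (B + 1)` makes the
    -- exceptional set of the weak type inequality at most a quarter of the ball.
    set κ := η / (4 * (B + 1) * A) with hκ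
    have hκ0 : 0 < κ := by positivity
    obtain ⟨R, hR, hRs⟩ := exists_forall_of_eventually_nhdsGT
      ((hg₀ κ hκ0).and ((hW₀ η hη (1 / 4) (by norm_num)).and
        (hlow.and (hmh.and (htail η hη)))))
    filter_upwards [Ioo_mem_nhdsGT (show 0 < R / 8 by positivity)] with ρ hρI hρd
    have hρ : 0 < ρ := hρI.1
    have hρR : 8 * ρ < R := by linarith [hρI.2]
    obtain ⟨-, gW, glow, gmh, gtail⟩ := hRs ρ hρ (by linarith)
    obtain ⟨gg, -, -, -, -⟩ := hRs (8 * ρ) (by positivity) hρR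
    set q := μ.real (Metric.closedBall x ρ) with hq
    have hq0 : 0 < q := lt_of_lt_of_le (by positivity) glow
    have h8 : μ.real (Metric.closedBall x (8 * ρ)) ≤ A * q :=
      (measureReal_mono (Metric.closedBall_subset_closedBall (by linarith))).trans hρd
    have gg' : ∫ y in Metric.closedBall x (8 * ρ), |g y| ∂μ ≤ η / (4 * (B + 1)) * q := by
      refine gg.trans ?_
      calc κ * μ.real (Metric.closedBall x (8 * ρ)) ≤ κ * (A * q) := by gcongr
        _ = η / (4 * (B + 1)) * q := by
          rw [hκ]
          field_simp
    have hB8m : MeasurableSet (Metric.ball x (8 * ρ)) := Metric.isOpen_ball.measurableSet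
    set g₁ := (Metric.ball x (8 * ρ)).indicator g with hg₁
    set g₂ := (Metric.ball x (8 * ρ))ᶜ.indicator g with hg₂
    have hg₁i : Integrable g₁ μ := hg.indicator hB8m
    have hg₂i : Integrable g₂ μ := hg.indicator hB8m.compl
    have hgg : g = fun y => g₁ y + g₂ y := by
      ext y
      exact (congrFun (indicator_self_add_compl (Metric.ball x (8 * ρ)) g) y).symm
    have hg₁n : ∫ y, |g₁ y| ∂μ ≤ η / (4 * (B + 1)) * q := by
      refine le_trans ?_ gg'
      have h1 : ∫ y, |g₁ y| ∂μ = ∫ y in Metric.ball x (8 * ρ), |g y| ∂μ := by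
        rw [← integral_indicator hB8m]
        congr 1 with y
        by_cases hy : y ∈ Metric.ball x (8 * ρ) <;> simp [hg₁, hy]
      rw [h1]
      exact setIntegral_mono_set hg.abs.restrict (Eventually.of_forall fun _ => abs_nonneg _)
        Metric.ball_subset_closedBall.eventuallyLE
    rw [tendstoInMeasure_iff_measureReal_norm] at hW
    -- Convergence in measure requires `δ` far below `ρ`; any `δ ≤ 6 * ρ` leaves the exterior part
    -- unchanged near `x`.
    obtain ⟨δ, hδW, hδ⟩ := (((hW η hη).eventually (ge_mem_nhds (show 0 < q / 4 by positivity))).and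
      (Ioc_mem_nhdsGT (show 0 < 6 * ρ by positivity))).exists
    have hweak : μ.real {z | η < |truncated μ K δ g₁ z|} ≤ q / 4 := by
      refine (ENNReal.toReal_mono ENNReal.ofReal_ne_top (hB δ η g₁ hδ.1 hη hg₁i)).trans ?_
      rw [ENNReal.toReal_ofReal (div_nonneg (mul_nonneg hB0
        (integral_nonneg fun _ => abs_nonneg _)) hη.le), div_le_iff₀ hη]
      calc B * ∫ y, |g₁ y| ∂μ ≤ (B + 1) * (η / (4 * (B + 1)) * q) := by
            gcongr
            linarith
        _ = q / 4 * η := by field_simp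
    -- Each of the three conditions fails on a set of measure at most `q / 4`, so together they
    -- cannot exclude the whole ball of measure `q`.
    have hz : ∃ z ∈ Metric.closedBall x ρ, |truncated μ K δ g z - W z| < η ∧ |W z - W x| ≤ η ∧
        |truncated μ K δ g₁ z| ≤ η := by
      by_contra! hcon
      have hsub : Metric.closedBall x ρ ⊆ {z | η ≤ ‖truncated μ K δ g z - W z‖} ∪
          ({z ∈ Metric.closedBall x ρ | η < |W z - W x|} ∪ {z | η < |truncated μ K δ g₁ z|}) := by
        intro z hz
        have h1 := hcon z hz
        simp only [mem_union, mem_ofPred_eq, Real.norm_eq_abs]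
        by_cases h2 : |truncated μ K δ g z - W z| < η
        · by_cases h3 : |W z - W x| ≤ η
          · exact Or.inr (Or.inr (h1 h2 h3))
          · exact Or.inr (Or.inl ⟨hz, not_le.1 h3⟩)
        · exact Or.inl (not_lt.1 h2)
      have h1 := (measureReal_mono hsub (measure_ne_top μ _)).trans ((measureReal_union_le _ _).trans
        (add_le_add hδW ((measureReal_union_le _ _).trans (add_le_add gW hweak))))
      linarith
    obtain ⟨z, hzB, hz1, hz2, hz3⟩ := hz
    have hzB2 : z ∈ Metric.closedBall x (2 * ρ) :=
      Metric.closedBall_subset_closedBall (by linarith) hzB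
    have hz4 := gtail z hzB2
    rw [← truncated_indicator_compl_ball hzB2 hδ.2, ← hg₂] at hz4
    have hz5 : truncated μ K δ g z = truncated μ K δ g₁ z + truncated μ K δ g₂ z := by
      conv_lhs => rw [hgg]
      exact hK.truncated_add hδ.1 z hg₁i hg₂i
    have hz6 : |truncated μ K ρ g x - truncated μ K (8 * ρ) g x| ≤ η := by
      refine (hK.abs_truncated_sub_truncated_le hρ (by linarith) x hg).trans ?_
      rw [div_le_iff₀ (hK.pos ρ hρ)]
      calc ∫ y in Metric.closedBall x (8 * ρ), |g y| ∂μ ≤ η / (4 * (B + 1)) * q := gg'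
        _ ≤ η * h ρ := by
          gcongr
          exact div_le_self hη.le (by linarith)
    rw [hz5] at hz1
    rw [_root_.abs_le] at *
    rw [abs_lt] at hz1
    constructor <;> linarith [hz1.1, hz1.2, hz2.1, hz2.2, hz3.1, hz3.2, hz4.1, hz4.2, hz6.1, hz6.2]
  rw [Metric.tendsto_nhds]
  intro η hη
  rw [eventually_inf_principal]
  filter_upwards [key (η / 6) (by positivity)] with ρ hρ hρd
  rw [Real.dist_eq]
  exact (hρ hρd).trans_lt (by linarith)

/-- The truncations of an integrable function converge almost everywhere, if those of bounded
functions do. -/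
theorem ae_tendsto_truncated_of_integrable (hK : IsCZKernel μ K h C)
    (hB : WeakTypeBound μ K B) (hB0 : 0 ≤ B) (hμ : HasBallDifferentiation μ)
    (hd : ∀ᵐ x ∂μ, Tendsto (fun r : ℝ => μ.real (Metric.ball x r) / h r) (𝓝[>] 0) (𝓝 0))
    (hb : ∀ (g : X → ℝ) (M : ℝ), AEStronglyMeasurable g μ → (∀ y, |g y| ≤ M) →
      ∃ G : X → ℝ, AEStronglyMeasurable G μ ∧
        ∀ᵐ x ∂μ, Tendsto (fun ε => truncated μ K ε g x) (𝓝[>] 0) (𝓝 (G x)))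
    {f : X → ℝ} (hf : Integrable f μ) :
    ∃ U : X → ℝ, Measurable U ∧
      ∀ᵐ x ∂μ, Tendsto (fun ε => truncated μ K ε f x) (𝓝[>] 0) (𝓝 (U x)) := by
  obtain ⟨U, hUm, hU⟩ := hK.exists_tendstoInMeasure_truncated hB hB0 (fun g hg => by
    obtain ⟨M, hM⟩ := hg.2
    obtain ⟨G, hGm, hG⟩ := hb g M hg.integrable.1 hM
    exact ⟨G, hGm, hK.tendstoInMeasure_truncated_of_ae hg.integrable.1 hG⟩) hf
  refine ⟨U, hUm, ?_⟩
  obtain ⟨N, hN⟩ := hμ.lower_bound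
  refine ae_of_forall_hasUniformZeroDensity hK.pos hd fun E hE hEu => ?_
  have hEi : Integrable (E.indicator 1 : X → ℝ) μ := (integrable_const (1 : ℝ)).indicator hE
  -- The limit for the indicator of `E` is fixed before `x` is chosen and scaled by `a = f x`
  -- afterwards, so the exceptional null sets do not depend on `x`.
  obtain ⟨V, hVm, hV⟩ := hb (E.indicator 1) 1 hEi.1 fun y => by
    by_cases hy : y ∈ E <;> simp [hy]
  have hVμ := hK.tendstoInMeasure_truncated_of_ae hEi.1 hV
  filter_upwards [hN, hμ.ae_eventually_setIntegral_abs_sub_le hf,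
    hμ.ae_eventually_measureReal_diff_le hE,
    hμ.ae_eventually_measureReal_abs_sub_lt hUm.aestronglyMeasurable,
    hμ.ae_eventually_measureReal_abs_sub_lt hVm, hV] with x ⟨c, hc, hlow⟩ hx₁ hx₂ hx₃ hx₄ hVx hxE
  set a := f x with ha
  have hei : Integrable (fun y => a * (E.indicator 1 y : ℝ)) μ := hEi.const_mul a
  have haV : TendstoInMeasure μ (fun ε => truncated μ K ε fun y => a * E.indicator 1 y) (𝓝[>] 0)
      fun x => a * V x := by
    refine hK.tendstoInMeasure_truncated_of_ae hei.1 ?_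
    filter_upwards [hV] with z hz
    simp_rw [truncated_const_mul]
    exact hz.const_mul a
  have hlim := hK.tendsto_truncated_of_small_averages hB hB0 (x := x) (hf.sub hei)
    (hK.tendstoInMeasure_truncated_sub hf hei hU haV) hc hlow
    (hK.tendsto_measureReal_closedBall_div hEu hxE) (fun η hη => ?_) (fun η hη κ hκ => ?_)
  · have h1 := hlim.add (hVx.const_mul a)
    rw [sub_add_cancel] at h1
    refine h1.congr' ?_
    filter_upwards [self_mem_nhdsWithin] with ε hε
    have h2 := hK.truncated_sub hε x hf hei
    rw [truncated_const_mul] at h2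
    change truncated μ K ε (fun y => f y - a * E.indicator 1 y) x + _ = _
    rw [h2]
    ring
  · filter_upwards [hx₁ (η / 2) (by positivity),
      hx₂ hxE (η / (2 * (|a| + 1))) (by positivity)] with r hr hr'
    have i1 : IntegrableOn (fun y => |f y - a|) (Metric.closedBall x r) μ :=
      (hf.sub (integrable_const _)).abs.restrict
    have i2 : IntegrableOn (Eᶜ.indicator fun _ => |a|) (Metric.closedBall x r) μ :=
      ((integrable_const |a|).indicator hE.compl).restrict
    calc ∫ y in Metric.closedBall x r, |f y - a * E.indicator 1 y| ∂μ
        ≤ ∫ y in Metric.closedBall x r, (|f y - a| + Eᶜ.indicator (fun _ => |a|) y) ∂μ := by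
          refine integral_mono (hf.sub hei).abs.restrict (i1.add i2) fun y => ?_
          dsimp only
          by_cases hy : y ∈ E
          · simp [hy]
          · simp only [hy, not_false_eq_true, indicator_of_notMem, mul_zero, sub_zero,
              mem_compl_iff, indicator_of_mem]
            have := abs_sub_abs_le_abs_sub (f y) a
            linarith
      _ = ∫ y in Metric.closedBall x r, |f y - a| ∂μ +
          μ.real (Metric.closedBall x r \ E) * |a| := by
          rw [integral_add i1 i2, setIntegral_indicator hE.compl, setIntegral_const, smul_eq_mul,
            Set.sdiff_eq]
      _ ≤ η / 2 * μ.real (Metric.closedBall x r) +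
          η / (2 * (|a| + 1)) * μ.real (Metric.closedBall x r) * (|a| + 1) := by
          gcongr
          linarith
      _ = η * μ.real (Metric.closedBall x r) := by
          field_simp
          ring
  · filter_upwards [hx₃ (η / 2) (by positivity) (κ / 2) (by positivity),
      hx₄ (η / (2 * (|a| + 1))) (by positivity) (κ / 2) (by positivity)] with r hr hr'
    calc _ ≤ μ.real ({z ∈ Metric.closedBall x r | η / 2 < |U z - U x|} ∪
          {z ∈ Metric.closedBall x r | η / (2 * (|a| + 1)) < |V z - V x|}) := by
          refine measureReal_mono (fun z hz => ?_) (measure_ne_top μ _)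
          by_contra hcon
          simp only [mem_union, mem_ofPred_eq, not_or, not_and, not_lt] at hcon
          have h1 := hcon.1 hz.1
          have h2 := hcon.2 hz.1
          have h3 : |a| * |V z - V x| ≤ η / 2 := by
            calc |a| * |V z - V x| ≤ (|a| + 1) * (η / (2 * (|a| + 1))) := by
                  gcongr
                  linarith
              _ = η / 2 := by field_simp
          have h4 : η < |U z - a * V z - (U x - a * V x)| := hz.2
          have h5 : U z - a * V z - (U x - a * V x) = (U z - U x) - a * (V z - V x) := by ring
          rw [h5] at h4
          have h6 := abs_sub (U z - U x) (a * (V z - V x))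
          rw [abs_mul] at h6
          linarith
      _ ≤ κ / 2 * μ.real (Metric.closedBall x r) + κ / 2 * μ.real (Metric.closedBall x r) :=
          (measureReal_union_le _ _).trans (add_le_add hr hr')
      _ = _ := by ring

end IsCZKernel

end SingularIntegral


/-! ### The weak type extension and its uniqueness -/

namespace SingularIntegral

set_option linter.unusedSectionVars false

variable {X : Type*} [MetricSpace X] [SecondCountableTopology X] [MeasurableSpace X]
  [BorelSpace X] {μ : Measure X} [IsFiniteMeasure μ]

theorem exists_seq_tendsto_eLpNorm {p : ℝ≥0∞} (hp : p ≠ ∞) {f : X → ℝ} (hf : MemLp f p μ) :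
    ∃ g : ℕ → X → ℝ, (∀ k, IsBoundedLipschitz (g k)) ∧
      Tendsto (fun k => eLpNorm (g k - f) p μ) atTop (𝓝 0) := by
  have hk : ∀ k : ℕ, ∃ g : X → ℝ, eLpNorm (f - g) p μ ≤ 2⁻¹ ^ k ∧ IsBoundedLipschitz g := fun k =>
    exists_isBoundedLipschitz_eLpNorm_sub_le hp hf (pow_ne_zero _ (by simp))
  choose g hg hgL using hk
  refine ⟨g, hgL, ?_⟩
  refine tendsto_of_tendsto_of_tendsto_of_le_of_le tendsto_const_nhds
    (ENNReal.tendsto_pow_atTop_nhds_zero_of_lt_one (r := 2⁻¹) (by simp)) (fun k => zero_le)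
    fun k => ?_
  dsimp only
  rw [eLpNorm_sub_comm]
  exact hg k

/-- A linear operator of weak type `(1, 1)` is continuous into the convergence in measure. -/
theorem tendstoInMeasure_of_weakType {S : Lp ℝ 1 μ →ₗ[ℝ] (X →ₘ[μ] ℝ)} {C : ℝ}
    (hS : ∀ (f : Lp ℝ 1 μ) (t : ℝ), 0 < t →
      μ {x | t < |(S f : X → ℝ) x|} ≤ ENNReal.ofReal (C * ‖f‖ / t))
    {u : ℕ → Lp ℝ 1 μ} {f : Lp ℝ 1 μ} (hu : Tendsto u atTop (𝓝 f)) :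
    TendstoInMeasure μ (fun k => (S (u k) : X → ℝ)) atTop (S f : X → ℝ) := by
  rw [tendstoInMeasure_iff_norm]
  intro η hη
  have h1 : Tendsto (fun k => ENNReal.ofReal (C * ‖u k - f‖ / (η / 2))) atTop (𝓝 0) := by
    rw [← ENNReal.ofReal_zero]
    refine ENNReal.tendsto_ofReal ?_
    have := ((tendsto_iff_norm_sub_tendsto_zero.1 hu).const_mul C).div_const (η / 2)
    rwa [mul_zero, zero_div] at this
  refine tendsto_of_tendsto_of_tendsto_of_le_of_le tendsto_const_nhds h1 (fun k => zero_le)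
    fun k => (measure_mono_ae ?_).trans (hS (u k - f) (η / 2) (by positivity))
  filter_upwards [AEEqFun.coeFn_sub (S (u k)) (S f)] with x hx (hx' : η ≤ _)
  change η / 2 < |(S (u k - f) : X → ℝ) x|
  rw [map_sub, hx, Pi.sub_apply]
  rw [Real.norm_eq_abs] at hx'
  linarith

/-- Bounded Lipschitz functions lie in `L²`, where both extensions equal `T`, and are dense in `L¹`.
Both are continuous into convergence in measure, whose limits are unique almost everywhere. -/
theorem IsWeakTypeExtension.unique {T : Lp ℝ 2 μ →L[ℝ] Lp ℝ 2 μ}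
    {S S' : Lp ℝ 1 μ →ₗ[ℝ] (X →ₘ[μ] ℝ)} (hS : IsWeakTypeExtension μ T S)
    (hS' : IsWeakTypeExtension μ T S') : S = S' := by
  refine LinearMap.ext fun f => AEEqFun.ext ?_
  obtain ⟨g, hgL, hg⟩ := exists_seq_tendsto_eLpNorm ENNReal.one_ne_top (Lp.memLp f)
  have hu := (Lp.tendsto_Lp_iff_tendsto_eLpNorm'' g (fun k => (hgL k).memLp 1) f
    (Lp.memLp f)).2 hg
  rw [Lp.toLp_coeFn] at hu
  obtain ⟨C, hC⟩ := hS.weak_type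
  obtain ⟨C', hC'⟩ := hS'.weak_type
  refine tendstoInMeasure_ae_unique (tendstoInMeasure_of_weakType hC hu)
    ((tendstoInMeasure_of_weakType hC' hu).congr_left fun k => ?_)
  have h1 : ((hgL k).memLp (μ := μ) 1).toLp (g k) =ᵐ[μ] ((hgL k).memLp (μ := μ) 2).toLp (g k) :=
    (MemLp.coeFn_toLp _).trans (MemLp.coeFn_toLp _).symm
  exact (hS'.extends_L2 _ _ h1).trans (hS.extends_L2 _ _ h1).symm

/-- A weak type operator that agrees with `T` on bounded Lipschitz functions extends `T`. -/
theorem isWeakTypeExtension_of_isBoundedLipschitz {T : Lp ℝ 2 μ →L[ℝ] Lp ℝ 2 μ}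
    {S : Lp ℝ 1 μ →ₗ[ℝ] (X →ₘ[μ] ℝ)} {C : ℝ}
    (hS : ∀ (f : Lp ℝ 1 μ) (t : ℝ), 0 < t →
      μ {x | t < |(S f : X → ℝ) x|} ≤ ENNReal.ofReal (C * ‖f‖ / t))
    (hST : ∀ (g : X → ℝ) (hg : IsBoundedLipschitz g),
      (S ((hg.memLp 1).toLp g) : X → ℝ) =ᵐ[μ] (T ((hg.memLp 2).toLp g) : X → ℝ)) :
    IsWeakTypeExtension μ T S := by
  refine ⟨fun f f₁ hff₁ => ?_, C, hS⟩
  obtain ⟨g, hgL, hg⟩ := exists_seq_tendsto_eLpNorm ENNReal.ofNat_ne_top (Lp.memLp f)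
  have hv := (Lp.tendsto_Lp_iff_tendsto_eLpNorm'' g (fun k => (hgL k).memLp 2) f
    (Lp.memLp f)).2 hg
  rw [Lp.toLp_coeFn] at hv
  -- On a finite measure space the approximation in `L²` is also one in `L¹`, so one sequence serves
  -- for both `T` and `S`.
  have hg₁ : Tendsto (fun k => eLpNorm (g k - (f₁ : X → ℝ)) 1 μ) atTop (𝓝 0) := by
    have h1 := ENNReal.Tendsto.mul_const hg (b := μ univ ^ (1 / (1 : ℝ≥0∞).toReal -
      1 / (2 : ℝ≥0∞).toReal)) (Or.inr (ENNReal.rpow_ne_top_of_nonneg (by norm_num)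
        (measure_ne_top μ _)))
    rw [zero_mul] at h1
    refine tendsto_of_tendsto_of_tendsto_of_le_of_le tendsto_const_nhds h1 (fun k => zero_le)
      fun k => ?_
    dsimp only
    rw [eLpNorm_congr_ae ((EventuallyEq.refl _ (g k)).sub hff₁)]
    exact eLpNorm_le_eLpNorm_mul_rpow_measure_univ one_le_two
      (((hgL k).memLp 2).sub (Lp.memLp f)).1
  have hu := (Lp.tendsto_Lp_iff_tendsto_eLpNorm'' g (fun k => (hgL k).memLp 1) f₁
    (Lp.memLp f₁)).2 hg₁
  rw [Lp.toLp_coeFn] at hu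
  exact tendstoInMeasure_ae_unique (tendstoInMeasure_of_weakType hS hu)
    ((tendstoInMeasure_of_tendsto_Lp ((T.continuous.tendsto f).comp hv)).congr_left
      fun k => (hST _ (hgL k)).symm)

/-- The principal values define a linear operator from `L¹` to the measurable functions. -/
theorem IsCZKernel.exists_linearMap_tendsto_truncated {K : X → X → ℝ} {h : ℝ → ℝ} {C : ℝ}
    (hK : IsCZKernel μ K h C)
    (hlim : ∀ f : X → ℝ, Integrable f μ → ∃ U : X → ℝ, Measurable U ∧
      ∀ᵐ x ∂μ, Tendsto (fun ε => truncated μ K ε f x) (𝓝[>] 0) (𝓝 (U x))) :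
    ∃ S : Lp ℝ 1 μ →ₗ[ℝ] (X →ₘ[μ] ℝ), ∀ (f : X → ℝ) (hf : Integrable f μ), ∀ᵐ x ∂μ,
      Tendsto (fun ε : ℝ => truncated μ K ε f x) (𝓝[>] 0) (𝓝 ((S (hf.toL1 f) : X → ℝ) x)) := by
  choose U hUm hU using fun f : Lp ℝ 1 μ => hlim f (L1.integrable_coeFn f)
  let S : Lp ℝ 1 μ →ₗ[ℝ] (X →ₘ[μ] ℝ) :=
    { toFun := fun f => AEEqFun.mk (U f) (hUm f).aestronglyMeasurable
      map_add' := fun f g => by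
        rw [AEEqFun.mk_add_mk, AEEqFun.mk_eq_mk]
        filter_upwards [hU f, hU g, hU (f + g)] with x hf hg hfg
        simp only [truncated_congr_ae (Lp.coeFn_add f g)] at hfg
        refine tendsto_nhds_unique hfg ((hf.add hg).congr' ?_)
        filter_upwards [self_mem_nhdsWithin] with ε hε
        exact (hK.truncated_add hε x (L1.integrable_coeFn f) (L1.integrable_coeFn g)).symm
      map_smul' := fun c f => by
        rw [RingHom.id_apply, AEEqFun.smul_mk, AEEqFun.mk_eq_mk]
        filter_upwards [hU f, hU (c • f)] with x hf hcf
        simp only [truncated_congr_ae (Lp.coeFn_smul c f)] at hcf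
        refine tendsto_nhds_unique hcf ((hf.const_mul c).congr' ?_)
        filter_upwards with ε
        exact (truncated_const_mul μ c f x).symm }
  refine ⟨S, fun f hf => ?_⟩
  filter_upwards [hU (hf.toL1 f), AEEqFun.coeFn_mk (U (hf.toL1 f))
    (hUm (hf.toL1 f)).aestronglyMeasurable] with x hx hx'
  change Tendsto _ _ (𝓝 ((AEEqFun.mk (U (hf.toL1 f)) _ : X →ₘ[μ] ℝ) x))
  rw [hx']
  simpa only [truncated_congr_ae hf.coeFn_toL1] using hx

/-- Weak convergence in `L²` and almost everywhere convergence in `L¹` of the truncated operators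
of a kernel whose maximal operator is bounded in `L²`. -/
theorem IsCZKernel.exists_principalValue {K : X → X → ℝ} {h : ℝ → ℝ} {C : ℝ}
    (hK : IsCZKernel μ K h C) {C₀ : ℝ≥0} (hT : MaximalBound μ K C₀)
    (hμ : HasBallDifferentiation μ)
    (hd : ∀ᵐ x ∂μ, Tendsto (fun r : ℝ => μ.real (Metric.ball x r) / h r) (𝓝[>] 0) (𝓝 0)) :
    ∃ T : Lp ℝ 2 μ →L[ℝ] Lp ℝ 2 μ, IsWeakLimit μ K T ∧
      ∃ S : Lp ℝ 1 μ →ₗ[ℝ] (X →ₘ[μ] ℝ), IsWeakTypeExtension μ T S ∧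
        ∀ (f : X → ℝ) (hf : Integrable f μ), ∀ᵐ x ∂μ,
          Tendsto (fun ε : ℝ => truncated μ K ε f x) (𝓝[>] 0)
            (𝓝 ((S (hf.toL1 f) : X → ℝ) x)) := by
  obtain ⟨T, hTw⟩ := hK.exists_isWeakLimit hT
  obtain ⟨B, hB0, hB⟩ := hK.exists_measure_lt_abs_truncated_le hT
  have hB : WeakTypeBound μ K B := hB
  obtain ⟨S, hS⟩ := hK.exists_linearMap_tendsto_truncated fun f hf =>
    hK.ae_tendsto_truncated_of_integrable hB hB0 hμ hd (fun g M hg hgM =>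
      ⟨_, (Lp.memLp (T ((memLp_two_of_bound hg hgM).toLp g))).1,
        hK.ae_tendsto_truncated_of_bounded hT hμ hd hTw (memLp_two_of_bound hg hgM) hgM⟩) hf
  refine ⟨T, hTw, S, isWeakTypeExtension_of_isBoundedLipschitz (C := 2 * B) (fun f t ht => ?_)
    (fun g hg => ?_), hS⟩
  · have hf := L1.integrable_coeFn f
    have h1 := hS f hf
    rw [Integrable.toL1_coeFn] at h1
    have h2 := hB.measure_lt_abs_le hf (hK.tendstoInMeasure_truncated_of_ae hf.1 h1) ht
    rw [L1.norm_eq_integral_norm]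
    exact h2
  · obtain ⟨M, hM⟩ := hg.2
    filter_upwards [hS g hg.integrable,
      hK.ae_tendsto_truncated_of_bounded hT hμ hd hTw (hg.memLp 2) hM] with x h1 h2
    exact tendsto_nhds_unique h1 h2

/-- For `ε > 0` the truncations never see the diagonal. The kernel may therefore be set to zero
there, which makes it measurable on the whole product and antisymmetric everywhere. -/
theorem truncated_eq_of_offDiag {K K' : X → X → ℝ} (hKK' : ∀ x y, x ≠ y → K x y = K' x y)
    {ε : ℝ} (hε : 0 < ε) : truncated μ K ε = truncated μ K' ε := by
  ext f x
  refine setIntegral_congr_fun Metric.isOpen_ball.measurableSet.compl fun y hy => ?_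
  have hxy : x ≠ y := fun h => hy (by rw [h]; exact Metric.mem_ball_self hε)
  simp only [hKK' x y hxy]

theorem IsWeakLimit.congr_offDiag {K K' : X → X → ℝ} (hKK' : ∀ x y, x ≠ y → K x y = K' x y)
    {T : Lp ℝ 2 μ →L[ℝ] Lp ℝ 2 μ} (hT : IsWeakLimit μ K T) : IsWeakLimit μ K' T := by
  intro f g
  refine (hT f g).congr' ?_
  filter_upwards [self_mem_nhdsWithin] with ε hε
  rw [truncated_eq_of_offDiag hKK' hε]

open Classical in
/-- The kernel that vanishes on the diagonal and agrees with `K` elsewhere. -/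
noncomputable def offDiagKernel (K : X → X → ℝ) (x y : X) : ℝ := if x = y then 0 else K x y

theorem offDiagKernel_of_ne (K : X → X → ℝ) {x y : X} (hxy : x ≠ y) :
    offDiagKernel K x y = K x y := if_neg hxy

theorem IsAntisymmKernel.measurable_offDiagKernel {K : X → X → ℝ} (hK : IsAntisymmKernel K) :
    Measurable (Function.uncurry (offDiagKernel K)) := by
  refine measurable_of_restrict_of_restrict_compl (s := {p : X × X | p.1 ≠ p.2})
    isClosed_diagonal.measurableSet.compl ?_ ?_
  · convert! hK.measurable using 1
    ext p
    exact offDiagKernel_of_ne K p.2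
  · convert! measurable_const (a := (0 : ℝ)) using 1
    ext p
    exact if_pos (not_not.1 p.2)

theorem maximal_eq_of_offDiag {K K' : X → X → ℝ} (hKK' : ∀ x y, x ≠ y → K x y = K' x y) :
    maximal μ K = maximal μ K' := by
  ext f x
  refine iSup_congr fun ε => iSup_congr fun hε => ?_
  rw [truncated_eq_of_offDiag hKK' hε]

end SingularIntegral

theorem theorem1p6 {X : Type*} [MetricSpace X] [TopologicalSpace.SeparableSpace X]
    [MeasurableSpace X] [BorelSpace X] (μ : Measure X) [IsFiniteMeasure μ]
    (hX : SingularIntegral.IsEuclidean X ∨ SingularIntegral.IsDoubling μ)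
    (K : X → X → ℝ) (hK : SingularIntegral.IsAntisymmKernel K)
    (h : ℝ → ℝ) (h_pos : ∀ r : ℝ, 0 < r → 0 < h r) (h_mono : MonotoneOn h (Ioi 0))
    (h_lim : Tendsto h (𝓝[>] 0) (𝓝 0))
    (h_doubling : ∃ C : ℝ, ∀ r : ℝ, 0 < r → h (2 * r) ≤ C * h r)
    (K_size : ∀ x y : X, x ≠ y → |K x y| ≤ 1 / h (dist x y))
    (K_smooth : ∀ x y z : X, x ≠ y → z ≠ x → 2 * dist y z < dist x y →
      |K x y - K x z| ≤ dist y z / (dist x y * h (dist x y)))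
    (μ_growth : ∀ (x : X) (r : ℝ), 0 < r → μ.real (Metric.ball x r) ≤ h r)
    (μ_density : ∀ᵐ x ∂μ,
      Tendsto (fun r : ℝ => μ.real (Metric.ball x r) / h r) (𝓝[>] 0) (𝓝 0))
    (hT : SingularIntegral.MaximalBoundedL2 μ K) :
    ∃ T : Lp ℝ 2 μ →L[ℝ] Lp ℝ 2 μ,
      SingularIntegral.IsWeakLimit μ K T ∧
      (∀ T' : Lp ℝ 2 μ →L[ℝ] Lp ℝ 2 μ, SingularIntegral.IsWeakLimit μ K T' → T' = T) ∧
      ∃ S : Lp ℝ 1 μ →ₗ[ℝ] (X →ₘ[μ] ℝ),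
        SingularIntegral.IsWeakTypeExtension μ T S ∧
        (∀ S' : Lp ℝ 1 μ →ₗ[ℝ] (X →ₘ[μ] ℝ),
          SingularIntegral.IsWeakTypeExtension μ T S' → S' = S) ∧
        ∀ (f : X → ℝ) (hf : Integrable f μ), ∀ᵐ x ∂μ,
          Tendsto (fun ε : ℝ => SingularIntegral.truncated μ K ε f x) (𝓝[>] 0)
            (𝓝 ((S (hf.toL1 f) : X → ℝ) x)) := by
  open SingularIntegral in
  have : SecondCountableTopology X := UniformSpace.secondCountable_of_separable X
  obtain ⟨C, hC⟩ := h_doubling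
  obtain ⟨C₀, hC₀⟩ := hT
  -- All estimates are applied to the kernel that vanishes on the diagonal; the conclusions return
  -- to `K` because they involve only truncations with `ε > 0`.
  have hKK' : ∀ x y, x ≠ y → offDiagKernel K x y = K x y := fun x y => offDiagKernel_of_ne K
  have hK' : IsCZKernel μ (offDiagKernel K) h C :=
    { pos := h_pos
      mono := fun r s hr hrs => h_mono hr (hr.trans_le hrs) hrs
      doubling := hC
      lim := h_lim
      measurable := hK.measurable_offDiagKernel
      antisymm := fun x y => by
        rcases eq_or_ne x y with rfl | hxy
        · simp [offDiagKernel]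
        · rw [hKK' x y hxy, hKK' y x hxy.symm, hK.antisymm x y hxy]
      size := fun x y hxy => by
        rw [hKK' x y hxy]
        exact K_size x y hxy
      smooth := fun x y z hxy hzx hd => by
        rw [hKK' x y hxy, hKK' x z hzx.symm]
        exact K_smooth x y z hxy hzx hd
      growth := μ_growth }
  have hT' : MaximalBound μ (offDiagKernel K) C₀ := by
    intro f hf
    rw [maximal_eq_of_offDiag hKK']
    exact hC₀ f hf
  have hμ : HasBallDifferentiation μ :=
    hX.elim (fun h => h.hasBallDifferentiation) fun h => h.hasBallDifferentiation
  obtain ⟨T, hTw, S, hS, hSlim⟩ := hK'.exists_principalValue hT' hμ μ_density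
  refine ⟨T, hTw.congr_offDiag hKK', fun T' hTw' => ?_, S, hS, fun S' hS' => hS'.unique hS,
    fun f hf => ?_⟩
  · exact (hTw'.congr_offDiag fun x y hxy => (hKK' x y hxy).symm).unique hTw
  · filter_upwards [hSlim f hf] with x hx
    refine hx.congr' ?_
    filter_upwards [self_mem_nhdsWithin] with ε hε
    rw [truncated_eq_of_offDiag hKK' hε]
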